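/- **Setting.** Let $\Sigma$ be a closed (compact, boundaryless) smooth surface, smoothly embedded as a spacelike surface in a smooth Lorentzian four-manifold (spacetime) $N$ of signature $(3,1)$, with spacelike mean curvature vector $H=\sigma^{ab}\,\mathrm{II}_{ab}$; let $\sigma$ be the induced metric, $|H|=\sqrt{\langle H,H\rangle}$, and $$\alpha_H(v)=\Big\langle \nabla^N_v \tfrac{J}{|H|},\tfrac{H}{|H|}\Big\rangle ,$$ where $J$ is the reflection of $H$ through the incoming light cone in the normal bundle, that is, if the incoming null normal line is spanned by a nowhere vanishing smooth null normal field $\ell$, $J$ is the image of $H$ under the linear map of the normal plane that fixes $\ell$ and is $-1$ on the other null line, $J=\frac{\langle H,H\rangle}{\langle H,\ell\rangle}\ell-H$. (Either smooth choice of null normal line may be called incoming, both in $N$ and in $\mathbb R^{3,1}$.) Let $X=(X^0,X^1,X^2,X^3):\Sigma\to\mathbb R^{3,1}$ be a smooth isometric embedding of $(\Sigma,\sigma)$ into Minkowski space, with metric $\langle\cdot,\cdot\rangle=-(dX^0)^2+\sum_i(dX^i)^2$, whose mean curvature vector $H_0$ is spacelike, and let $|H_0|$, $\alpha_{H_0}$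 be the corresponding data of $X(\Sigma)$. No optimality of $X$ is assumed. For a future unit timelike constant vector $T$ put $\tau=-\langle X,T\rangle$, $$\rho=\frac{\sqrt{|H_0|^2+\frac{(\Delta\tau)^2}{1+|\nabla\tau|^2}}-\sqrt{|H|^2+\frac{(\Delta\tau)^2}{1+|\nabla\tau|^2}}}{\sqrt{1+|\nabla\tau|^2}},\qquad j=\rho\,d\tau-d\Big[\sinh^{-1}\Big(\frac{\rho\,\Delta\tau}{|H_0||H|}\Big)\Big]-\alpha_{H_0}+\alpha_H ,$$ with $\nabla,\Delta$ taken with respect to $\sigma$. The quasi-local conserved quantity for a Killing field $K$ of $\mathbb R^{3,1}$, with tangential part $K^\top$ along $X$, the quasi-local energy, and the quasi-local energy-momentum components are $$E(\Sigma,X,T,K)=\frac{-1}{8\pi}\int_\Sigma\big[\langle K,T\rangle\rho+j(K^\top)\big]\,d\Sigma,$$ $$E(\Sigma,X,T)=\frac1{8\pi}\int_\Sigma\Big[\rho(1+|\nabla\tau|^2)+\Delta\tau\,\sinh^{-1}\Big(\frac{\rho\Delta\tau}{|H_0||H|}\Big)-\alpha_{H_0}(\nabla\tau)+\alpha_H(\nabla\tau)\Big]d\Sigma,$$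 $$p^\gamma=\frac1{8\pi}\int_\Sigma\big[\rho\,T^\gamma+j(\nabla X^\gamma)\big]\,d\Sigma .$$ **Theorem 4.2.** Let $i\in\{1,2,3\}$, $T(s)=\sqrt{1+s^2}\,\frac{\partial}{\partial X^0}+s\,\frac{\partial}{\partial X^i}$ and $f(s)=E(\Sigma,X,T(s),T(s))$. Then $f(s)=E(\Sigma,X,T(s))$ is the quasi-local energy with respect to $X$ and the observer $T(s)$, for every $s\in\mathbb R$; $f$ is differentiable at $s=0$ and $$f'(0)=E\Big(\Sigma,X,\frac{\partial}{\partial X^0},\frac{\partial}{\partial X^i}\Big);$$ and this number is the quasi-local linear momentum up to the sign in the definition of $E$, namely $E(\Sigma,X,\frac{\partial}{\partial X^0},\frac{\partial}{\partial X^i})=-p^i$, where $p^i$ is taken with respect to $T=\frac{\partial}{\partial X^0}$. -/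

import Mathlib

open MeasureTheory
open scoped Manifold ContDiff Topology

noncomputable section

namespace QuasiLocal

/-- `ℝⁿ`, the model space of `n`-dimensional manifolds. -/
abbrev Euc (n : ℕ) : Type := EuclideanSpace ℝ (Fin n)

/-- The tangent space at a point `x` of a manifold modelled on `ℝⁿ`. By definition, Mathlib's
`TangentSpace 𝓘(ℝ, Euc n) x` is `ℝⁿ` itself, a tangent vector being represented by its components
in the preferred chart `chartAt (Euc n) x`; the standard basis vectors of `ℝⁿ` are the coordinate
vectors `∂₁, …, ∂ₙ` of that chart at `x`. -/
abbrev Tan (n : ℕ) {M : Type*} [TopologicalSpace M] [ChartedSpace (Euc n) M] (_x : M) : Type :=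
  Euc n

/-- The differential `T_x M → T_{f x} M'` of a map between manifolds (Mathlib's `mfderiv`). -/
def tmap {m n : ℕ} {M M' : Type*} [TopologicalSpace M] [ChartedSpace (Euc m) M]
    [TopologicalSpace M'] [ChartedSpace (Euc n) M'] (f : M → M') (x : M) :
    Tan m x →L[ℝ] Tan n (f x) :=
  mfderiv 𝓘(ℝ, Euc m) 𝓘(ℝ, Euc n) f x

/-- The standard basis vector `e_a` of `ℝⁿ`. -/
def basisVec {n : ℕ} (a : Fin n) : Euc n := EuclideanSpace.single a 1

/-! ### Linear algebra of a nondegenerate symmetric bilinear form -/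

/-- The matrix `B_{ab} = B(e_a, e_b)`. -/
def gram {n : ℕ} (B : Euc n →L[ℝ] Euc n →L[ℝ] ℝ) : Matrix (Fin n) (Fin n) ℝ :=
  Matrix.of fun a b => B (basisVec a) (basisVec b)

/-- The vector `β^♯ = B^{ab} β_b e_a` which is metrically dual to a covector `β`, that is
`B(β^♯, w) = β(w)`. -/
def sharp {n : ℕ} (B : Euc n →L[ℝ] Euc n →L[ℝ] ℝ) (β : Euc n →L[ℝ] ℝ) : Euc n :=
  ∑ a, ∑ b, ((gram B)⁻¹ a b * β (basisVec b)) • basisVec a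

/-- The trace `B^{ab} Q(e_a, e_b)` of a (vector-valued) bilinear map `Q` with respect to `B`. -/
def metricTrace {n : ℕ} {V : Type*} [AddCommGroup V] [Module ℝ V]
    (B : Euc n →L[ℝ] Euc n →L[ℝ] ℝ) (Q : Euc n → Euc n → V) : V :=
  ∑ a, ∑ b, (gram B)⁻¹ a b • Q (basisVec a) (basisVec b)

/-! ### Metrics, Christoffel symbols, Hessian, Laplacian, area -/

/-- A field of bilinear forms on the tangent spaces of `M`. -/
abbrev FormField (n : ℕ) (M : Type*) [TopologicalSpace M] [ChartedSpace (Euc n) M] : Type _ :=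
  ∀ x : M, Tan n x →L[ℝ] Tan n x →L[ℝ] ℝ

/-- The components of `g` in the coordinates of the preferred chart at `x₀`: the pull-back of `g`
under the inverse of that chart, a bilinear form on `ℝⁿ` for each point `z` of the chart's range. -/
def coordMetric {n : ℕ} {M : Type*} [TopologicalSpace M] [ChartedSpace (Euc n) M]
    (g : FormField n M) (x₀ : M) (z : Euc n) : Euc n →L[ℝ] Euc n →L[ℝ] ℝ :=
  (g ((chartAt (Euc n) x₀).symm z)).bilinearComp
    (tmap (chartAt (Euc n) x₀).symm z) (tmap (chartAt (Euc n) x₀).symm z)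

/-- The Christoffel symbols of the Levi-Civita connection of a metric `G` given in coordinates:
`Γ(v, w)^k = ½ G^{kl} (∂_v G_{wl} + ∂_w G_{vl} - ∂_l G_{vw})`. -/
def christoffel {n : ℕ} (G : Euc n → Euc n →L[ℝ] Euc n →L[ℝ] ℝ) (z v w : Euc n) : Euc n :=
  sharp (G z) ((1 / 2 : ℝ) •
    (fderiv ℝ G z v w + fderiv ℝ G z w v - ((fderiv ℝ G z).flip v).flip w))

/-- The Hessian `∇_v∇_w f = ∂_v∂_w f - Γ(v,w) f` of a function, in the preferred chart at `p`. -/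
def hessian {S : Type*} [TopologicalSpace S] [ChartedSpace (Euc 2) S]
    (σ : FormField 2 S) (f : S → ℝ) (p : S) (v w : Euc 2) : ℝ :=
  fderiv ℝ (fderiv ℝ (f ∘ (chartAt (Euc 2) p).symm)) (chartAt (Euc 2) p p) v w -
    fderiv ℝ (f ∘ (chartAt (Euc 2) p).symm) (chartAt (Euc 2) p p)
      (christoffel (coordMetric σ p) (chartAt (Euc 2) p p) v w)

/-- The Laplacian `Δ f = σ^{ab} ∇_a ∇_b f`. -/
def laplacian {S : Type*} [TopologicalSpace S] [ChartedSpace (Euc 2) S]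
    (σ : FormField 2 S) (f : S → ℝ) (p : S) : ℝ :=
  metricTrace (σ p) (hessian σ f p)

/-- The differential of a function, as a covector at `p`. -/
def dFun {S : Type*} [TopologicalSpace S] [ChartedSpace (Euc 2) S]
    (f : S → ℝ) (p : S) : Tan 2 p →L[ℝ] ℝ :=
  mfderiv 𝓘(ℝ, Euc 2) 𝓘(ℝ, ℝ) f p

/-- The gradient `∇ f` with respect to `σ`. -/
def surfGrad {S : Type*} [TopologicalSpace S] [ChartedSpace (Euc 2) S]
    (σ : FormField 2 S) (f : S → ℝ) (p : S) : Tan 2 p :=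
  sharp (σ p) (dFun f p)

/-- The Riemannian measure in the preferred chart at `p`: the measure `√(det σ_{ab}) du` on the
range of the chart, transported to the domain of the chart. -/
def chartMeasure {S : Type*} [TopologicalSpace S] [ChartedSpace (Euc 2) S]
    [MeasurableSpace S] (σ : FormField 2 S) (p : S) : Measure S :=
  (((volume : Measure (Euc 2)).restrict (chartAt (Euc 2) p).target).withDensity
    fun u => ENNReal.ofReal (Real.sqrt (gram (coordMetric σ p u)).det)).map
      (chartAt (Euc 2) p).symm

/-- The Riemannian measure of `σ`: the least measure that is at least `√(det σ_{ab}) du` in each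
chart. Since the chart measures agree on overlaps, this is the measure equal to
`√(det σ_{ab}) du` in each chart (on a compact manifold). -/
def areaMeasure {S : Type*} [TopologicalSpace S] [ChartedSpace (Euc 2) S]
    [MeasurableSpace S] (σ : FormField 2 S) : Measure S :=
  ⨆ p : S, chartMeasure σ p

/-- A smooth Lorentz metric on a four-manifold: smooth components in the charts,
symmetric, and at each point some vector `t` is timelike with positive definite orthogonal
complement (signature `(3, 1)`). -/
structure LorentzMetric (N : Type*) [TopologicalSpace N] [ChartedSpace (Euc 4) N] where
  /-- the bilinear form on each tangent space -/
  form : FormField 4 N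
  symm : ∀ (x : N) (v w : Tan 4 x), form x v w = form x w v
  lorentz : ∀ x : N, ∃ t : Tan 4 x, form x t t < 0 ∧
    ∀ v : Tan 4 x, form x t v = 0 → v ≠ 0 → 0 < form x v v
  smooth : ∀ x₀ : N, ContDiffOn ℝ ∞ (coordMetric form x₀) (chartAt (Euc 4) x₀).target

/-! ### Geometry of a surface in a Lorentz manifold -/

section Surface

variable {S : Type*} [TopologicalSpace S] [ChartedSpace (Euc 2) S]
  {N : Type*} [TopologicalSpace N] [ChartedSpace (Euc 4) N]

/-- The induced metric `σ(v, w) = ⟨dι v, dι w⟩`. -/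
def inducedMetric (g : LorentzMetric N) (ι : S → N) : FormField 2 S :=
  fun p => (g.form (ι p)).bilinearComp (tmap ι p) (tmap ι p)

/-- The induced metric is Riemannian. -/
def IsSpacelike (g : LorentzMetric N) (ι : S → N) : Prop :=
  ∀ (p : S) (v : Tan 2 p), v ≠ 0 → 0 < inducedMetric g ι p v v

/-- The tangential part `w^⊤`, as a tangent vector of the surface: the vector with
`σ(w^⊤, v) = ⟨w, dι v⟩`. -/
def tangentialPart (g : LorentzMetric N) (ι : S → N) (p : S) (w : Tan 4 (ι p)) : Tan 2 p :=
  sharp (inducedMetric g ι p) ((g.form (ι p) w).comp (tmap ι p))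

/-- The normal part `w^⊥ = w - dι (w^⊤)`. -/
def normalPart (g : LorentzMetric N) (ι : S → N) (p : S) (w : Tan 4 (ι p)) : Tan 4 (ι p) :=
  w - tmap ι p (tangentialPart g ι p w)

/-- `∇^N_v (dι w)` in the coordinates of the preferred charts at `p` and `ι p`, where `w` is
extended with constant coefficients: `∂_v ∂_w ι + Γ(dι v, dι w)`. -/
def secondDeriv (g : LorentzMetric N) (ι : S → N) (p : S) (v w : Euc 2) : Tan 4 (ι p) :=
  (fderiv ℝ (fderiv ℝ ((chartAt (Euc 4) (ι p)) ∘ ι ∘ (chartAt (Euc 2) p).symm))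
      (chartAt (Euc 2) p p) v w : Euc 4) +
    christoffel (coordMetric g.form (ι p)) (chartAt (Euc 4) (ι p) (ι p)) (tmap ι p v) (tmap ι p w)

/-- The second fundamental form `II(v, w) = (∇^N_v (dι w))^⊥`. -/
def secondFundForm (g : LorentzMetric N) (ι : S → N) (p : S) (v w : Euc 2) : Tan 4 (ι p) :=
  normalPart g ι p (secondDeriv g ι p v w)

/-- The mean curvature vector `H = σ^{ab} II(∂_a, ∂_b)`. -/
def meanCurv (g : LorentzMetric N) (ι : S → N) (p : S) : Tan 4 (ι p) :=
  metricTrace (V := Euc 4) (inducedMetric g ι p) (secondFundForm g ι p)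

/-- The mean curvature vector is spacelike at each point. -/
def HasSpacelikeMeanCurv (g : LorentzMetric N) (ι : S → N) : Prop :=
  ∀ p : S, 0 < g.form (ι p) (meanCurv g ι p) (meanCurv g ι p)

/-- The norm `|H|`. -/
def normMeanCurv (g : LorentzMetric N) (ι : S → N) (p : S) : ℝ :=
  Real.sqrt (g.form (ι p) (meanCurv g ι p) (meanCurv g ι p))

/-- `ℓ` is a smooth nowhere vanishing null normal vector field along the surface. For a spacelike
surface of codimension two, the light cone in each normal plane consists of two null lines; `ℓ`
spans one of them. -/
structure IsNullNormal [IsManifold 𝓘(ℝ, Euc 4) ∞ N] (g : LorentzMetric N) (ι : S → N) (ℓ : ∀ p : S, Tan 4 (ι p)) : Prop where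
  smooth : ContMDiff 𝓘(ℝ, Euc 2) 𝓘(ℝ, Euc 4).tangent ∞
    (fun p => (⟨ι p, ℓ p⟩ : TangentBundle 𝓘(ℝ, Euc 4) N))
  ne_zero : ∀ p, ℓ p ≠ 0
  null : ∀ p, g.form (ι p) (ℓ p) (ℓ p) = 0
  normal : ∀ (p : S) (v : Tan 2 p), g.form (ι p) (ℓ p) (tmap ι p v) = 0

/-- The reflection `J` of `H` through the null line spanned by `ℓ`: the linear map of the normal
plane that fixes `ℓ` and is `-1` on the other null line sends `H` to
`(⟨H,H⟩/⟨H,ℓ⟩) ℓ - H`. It satisfies `⟨J,H⟩ = 0` and `⟨J,J⟩ = -⟨H,H⟩`. -/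
def reflectedMeanCurv (g : LorentzMetric N) (ι : S → N) (ℓ : ∀ p : S, Tan 4 (ι p)) (p : S) :
    Tan 4 (ι p) :=
  (g.form (ι p) (meanCurv g ι p) (meanCurv g ι p) / g.form (ι p) (meanCurv g ι p) (ℓ p)) • ℓ p -
    meanCurv g ι p

/-- The covariant derivative `∇^N_v W` of a vector field `W` along `ι`, in the coordinates of the
preferred charts at `p` and `ι p`: `∂_v W^k + Γ^k(dι v, W)`. -/
def covDerivAlong (g : LorentzMetric N) (ι : S → N) (W : ∀ q : S, Tan 4 (ι q)) (p : S)
    (v : Tan 2 p) : Tan 4 (ι p) :=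
  (fderiv ℝ (fun u : Euc 2 =>
      (tmap (chartAt (Euc 4) (ι p)) (ι ((chartAt (Euc 2) p).symm u))
        (W ((chartAt (Euc 2) p).symm u)) : Euc 4)) (chartAt (Euc 2) p p) v : Euc 4) +
    christoffel (coordMetric g.form (ι p)) (chartAt (Euc 4) (ι p) (ι p)) (tmap ι p v) (W p)

/-- The connection one-form of the normal bundle in the mean curvature gauge,
`α_H(v) = ⟨∇^N_v (J/|H|), H/|H|⟩`. -/
def connectionForm (g : LorentzMetric N) (ι : S → N) (ℓ : ∀ p : S, Tan 4 (ι p)) (p : S)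
    (v : Tan 2 p) : ℝ :=
  g.form (ι p)
    (covDerivAlong g ι (fun q => (normMeanCurv g ι q)⁻¹ • reflectedMeanCurv g ι ℓ q) p v)
    ((normMeanCurv g ι p)⁻¹ • meanCurv g ι p)

end Surface

/-- A triple `(σ, |H|, α_H)` on a surface. -/
structure SurfaceData (S : Type*) [TopologicalSpace S] [ChartedSpace (Euc 2) S] where
  /-- the metric `σ` -/
  metric : FormField 2 S
  /-- the function `|H|` -/
  normH : S → ℝ
  /-- the one-form `α_H` -/
  alphaH : ∀ p : S, Tan 2 p → ℝ

/-- The triple `(σ, |H|, α_H)` of a surface in a Lorentz four-manifold, `α_H` being defined by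
reflecting the mean curvature vector through the null line spanned by `ℓ`. -/
def surfaceData {S : Type*} [TopologicalSpace S] [ChartedSpace (Euc 2) S]
    {N : Type*} [TopologicalSpace N] [ChartedSpace (Euc 4) N]
    (g : LorentzMetric N) (ι : S → N) (ℓ : ∀ p : S, Tan 4 (ι p)) : SurfaceData S where
  metric := inducedMetric g ι
  normH := normMeanCurv g ι
  alphaH := connectionForm g ι ℓ

/-! ### Minkowski space -/

/-- The Minkowski inner product `-(dX⁰)² + (dX¹)² + (dX²)² + (dX³)²` on `ℝ⁴`. -/
def eta : Euc 4 →L[ℝ] Euc 4 →L[ℝ] ℝ :=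
  -((EuclideanSpace.proj (0 : Fin 4) : Euc 4 →L[ℝ] ℝ).smulRight
      (EuclideanSpace.proj (0 : Fin 4) : Euc 4 →L[ℝ] ℝ)) +
    ∑ i : Fin 3, (EuclideanSpace.proj i.succ : Euc 4 →L[ℝ] ℝ).smulRight
      (EuclideanSpace.proj i.succ : Euc 4 →L[ℝ] ℝ)

theorem eta_apply (v w : Euc 4) :
    eta v w = -(v 0 * w 0) + v 1 * w 1 + v 2 * w 2 + v 3 * w 3 := by
  simp [eta, Fin.sum_univ_succ]
  ring

theorem coordMetric_eta (x₀ z : Euc 4) :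
    coordMetric (n := 4) (M := Euc 4) (fun _ => eta) x₀ z = eta := by
  have h : tmap (m := 4) (n := 4) (chartAt (Euc 4) x₀).symm z =
      ContinuousLinearMap.id ℝ (Euc 4) := by
    rw [chartAt_self_eq]
    exact mfderiv_id
  ext v w
  rw [coordMetric, h]
  rfl

/-- Minkowski space `ℝ^{3,1}`. -/
def minkowski : LorentzMetric (Euc 4) where
  form := fun _ => eta
  symm := fun x v w => by
    have h1 := eta_apply v w
    have h2 := eta_apply w v
    refine h1.trans (Eq.trans ?_ h2.symm)
    ring
  lorentz := fun x => by
    refine ⟨(EuclideanSpace.single 0 1 : Euc 4), ?_, ?_⟩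
    · refine lt_of_eq_of_lt (eta_apply _ _) ?_
      simp
    · intro v hv hne
      have h1 := eta_apply (EuclideanSpace.single 0 1 : Euc 4) v
      have h0 : (v : Euc 4) 0 = 0 := by
        have h2 := h1.symm.trans hv
        simpa using h2
      refine lt_of_lt_of_eq ?_ (eta_apply v v).symm
      by_contra hcon
      apply hne
      have h3 : (v : Euc 4) 1 = 0 := by nlinarith [sq_nonneg ((v : Euc 4) 1), sq_nonneg ((v : Euc 4) 2), sq_nonneg ((v : Euc 4) 3)]
      have h4 : (v : Euc 4) 2 = 0 := by nlinarith [sq_nonneg ((v : Euc 4) 1), sq_nonneg ((v : Euc 4) 2), sq_nonneg ((v : Euc 4) 3)]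
      have h5 : (v : Euc 4) 3 = 0 := by nlinarith [sq_nonneg ((v : Euc 4) 1), sq_nonneg ((v : Euc 4) 2), sq_nonneg ((v : Euc 4) 3)]
      have h6 : (v : Euc 4) = (0 : Euc 4) := by
        ext k
        fin_cases k
        · exact h0
        · exact h3
        · exact h4
        · exact h5
      exact h6
  smooth := fun x₀ => by
    have h : coordMetric (n := 4) (M := Euc 4) (fun _ => eta) x₀ = fun _ => eta :=
      funext (coordMetric_eta x₀)
    rw [h]
    exact contDiffOn_const

/-- The translation Killing field `∂/∂X^α`, as a vector of `ℝ^{3,1}`. -/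
def partialX (α : Fin 4) : Euc 4 := basisVec α

/-- The boosted observer `√(1+s²) ∂/∂X⁰ + s ∂/∂X^i`. -/
def boostedObserver (i : Fin 4) (s : ℝ) : Euc 4 :=
  Real.sqrt (1 + s ^ 2) • partialX 0 + s • partialX i

/-! ### Quasi-local energy and conserved quantities

`D = (σ, |H|, α_H)` are the physical data, `D₀ = (σ, |H₀|, α_{H₀})` the data of the image of the
isometric embedding `X` in `ℝ^{3,1}`, and `T` is the observer. -/

section Energy

variable {S : Type*} [TopologicalSpace S] [ChartedSpace (Euc 2) S]

/-- `X` is isometric with respect to `σ`. -/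
def IsIsometric (σ : FormField 2 S) (X : S → Euc 4) : Prop :=
  ∀ (p : S) (v w : Tan 2 p), eta (tmap X p v) (tmap X p w) = σ p v w

/-- The time function `τ = -⟨X, T⟩`. -/
def timeFn (X : S → Euc 4) (T : Euc 4) (p : S) : ℝ := -eta (X p) T

/-- `|∇τ|²`. -/
def gradSq (σ : FormField 2 S) (f : S → ℝ) (p : S) : ℝ := σ p (surfGrad σ f p) (surfGrad σ f p)

/-- The function
`ρ = (√(|H₀|² + (Δτ)²/(1+|∇τ|²)) - √(|H|² + (Δτ)²/(1+|∇τ|²))) / √(1+|∇τ|²)`. -/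
def rho (D D₀ : SurfaceData S) (X : S → Euc 4) (T : Euc 4) (p : S) : ℝ :=
  (Real.sqrt (D₀.normH p ^ 2 +
      laplacian D.metric (timeFn X T) p ^ 2 / (1 + gradSq D.metric (timeFn X T) p)) -
    Real.sqrt (D.normH p ^ 2 +
      laplacian D.metric (timeFn X T) p ^ 2 / (1 + gradSq D.metric (timeFn X T) p))) /
    Real.sqrt (1 + gradSq D.metric (timeFn X T) p)

/-- The function `sinh⁻¹(ρ Δτ / (|H₀| |H|))`. -/
def angleFn (D D₀ : SurfaceData S) (X : S → Euc 4) (T : Euc 4) (p : S) : ℝ :=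
  Real.arsinh (rho D D₀ X T p * laplacian D.metric (timeFn X T) p / (D₀.normH p * D.normH p))

/-- The one-form `j = ρ dτ - d[sinh⁻¹(ρ Δτ / (|H₀| |H|))] - α_{H₀} + α_H`. -/
def current (D D₀ : SurfaceData S) (X : S → Euc 4) (T : Euc 4) (p : S) (v : Tan 2 p) : ℝ :=
  rho D D₀ X T p * dFun (timeFn X T) p v - dFun (angleFn D D₀ X T) p v -
    D₀.alphaH p v + D.alphaH p v

/-- The tangential part `K^⊤` along `X` of a vector `K` of `ℝ^{3,1}`, as a tangent vector of the
surface with metric `σ`: the vector with `σ(K^⊤, v) = ⟨K, dX v⟩`. -/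
def tangentialVec (σ : FormField 2 S) (X : S → Euc 4) (K : Euc 4) (p : S) : Tan 2 p :=
  sharp (σ p) ((eta K).comp (tmap X p))

variable [MeasurableSpace S]

/-- The quasi-local energy with respect to `(X, T)`:
`(1/8π) ∫ [ρ(1+|∇τ|²) + Δτ sinh⁻¹(ρΔτ/(|H₀||H|)) - α_{H₀}(∇τ) + α_H(∇τ)] dΣ`. -/
def quasiLocalEnergy (D D₀ : SurfaceData S) (X : S → Euc 4) (T : Euc 4) : ℝ :=
  1 / (8 * Real.pi) * ∫ p, (rho D D₀ X T p * (1 + gradSq D.metric (timeFn X T) p) +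
    laplacian D.metric (timeFn X T) p * angleFn D D₀ X T p -
    D₀.alphaH p (surfGrad D.metric (timeFn X T) p) +
    D.alphaH p (surfGrad D.metric (timeFn X T) p)) ∂(areaMeasure D.metric)

/-- The quasi-local conserved quantity with respect to `(X, T)` and a (Killing) vector field `K` on
`ℝ^{3,1}`: `(-1/8π) ∫ [⟨K, T⟩ ρ + j(K^⊤)] dΣ`. -/
def conservedQuantity (D D₀ : SurfaceData S) (X : S → Euc 4) (T : Euc 4) (K : Euc 4 → Euc 4) : ℝ :=
  -1 / (8 * Real.pi) * ∫ p, (eta (K (X p)) T * rho D D₀ X T p +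
    current D D₀ X T p (tangentialVec D.metric X (K (X p)) p)) ∂(areaMeasure D.metric)

/-- The component `p^γ = (1/8π) ∫ [ρ T^γ + j(∇X^γ)] dΣ` of the quasi-local energy-momentum. -/
def energyMomentum (D D₀ : SurfaceData S) (X : S → Euc 4) (T : Euc 4) (γ : Fin 4) : ℝ :=
  1 / (8 * Real.pi) * ∫ p, (rho D D₀ X T p * T γ +
    current D D₀ X T p (surfGrad D.metric (fun q => X q γ) p)) ∂(areaMeasure D.metric)

end Energy

end QuasiLocal

end

open QuasiLocal

noncomputable section

namespace QuasiLocal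

open scoped Matrix

/-! ### Bilinear forms on `ℝⁿ` -/

/-! Write u = 1 + |∇τ|², L = Δτ, a = |H₀|, b = |H| and θ = sinh⁻¹(ρL/(ab)). Two facts carry the
theorem.

The first is that the energy density e = ρu + Lθ satisfies de = (ρ/2) du + θ dL: ρ and θ may be
treated as constants when e is varied. Indeed ρu = √(a²u + L²) - √(b²u + L²) (`rhoFn_mul`), and the
subtraction formula for sinh⁻¹ gives θ = sinh⁻¹(L/(b√u)) - sinh⁻¹(L/(a√u)) (`thetaFn_eq`). So e is a
difference of two expressions √(a²u + L²) - L sinh⁻¹(L/(a√u)), one for a and one for b, in each of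
which the derivatives combine explicitly (`hasDerivAt_energyDensity`).

The second is Green's identity ∫ (θ Δh + dθ(∇h)) = 0 on the closed surface
(`IsRiemannian.integral_green`).

For K = T one has K^⊤ = -∇τ and ⟨T,T⟩ = -1, so the integrand of the conserved quantity is -(ρ +
j(∇τ)). It differs from the energy density by sign and by the Green integrand of θ and τ
(`conservedQuantity_self`). For the derivative, X is fixed and τ = √(1+s²) X⁰ - s Xⁱ, so at s = 0
the variations are u' = -2⟨∇X⁰,∇Xⁱ⟩ and L' = -ΔXⁱ. Hence the derivative of the integrand is -(j(∇Xⁱ)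
+ θ ΔXⁱ + dθ(∇Xⁱ)), and Green's identity with h = Xⁱ leaves -j(∇Xⁱ). Since (∂/∂Xⁱ)^⊤ = ∇Xⁱ and ∂/∂Xⁱ
⊥ ∂/∂X⁰, this is the integrand of the conserved quantity and also of minus the momentum. No equation
for X is used.

The rest is regularity. The Laplacian, mean curvature and connection form at a point are defined in
the preferred charts of that point, so before they can be called smooth they must be compared with
their expressions in one fixed chart. This needs the transformation law of the Christoffel symbols
(`map_christoffel`) and its consequences collected under `IsChartChange`. Similarly, the area
measure is a supremum of chart measures and must be identified with each of them on its chart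
(`areaMeasure_apply`) before integrals can be computed locally. -/

/-- Bilinear forms on `ℝⁿ`. -/
abbrev BForm (n : ℕ) : Type := Euc n →L[ℝ] Euc n →L[ℝ] ℝ

theorem sum_smul_basisVec {n : ℕ} (v : Euc n) : ∑ a, v a • basisVec a = v := by
  ext b
  simp [basisVec, Finset.sum_apply, Pi.single_apply]

theorem map_eq_sum_basisVec {n : ℕ} {V : Type*} [AddCommGroup V] [Module ℝ V]
    (L : Euc n →ₗ[ℝ] V) (v : Euc n) : L v = ∑ a, v a • L (basisVec a) := by
  conv_lhs => rw [← sum_smul_basisVec v]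
  simp

theorem sharp_apply {n : ℕ} (B : BForm n) (β : Euc n →L[ℝ] ℝ) (a : Fin n) :
    sharp B β a = ∑ b, (gram B)⁻¹ a b * β (basisVec b) := by
  simp [sharp, basisVec, Finset.sum_apply, Pi.single_apply]

/-- Nondegeneracy in terms of the Gram matrix. -/
theorem gram_det_ne_zero {n : ℕ} {B : BForm n}
    (h : ∀ v, (∀ w, B v w = 0) → v = 0) : (gram B).det ≠ 0 := by
  intro hdet
  obtain ⟨v, hv0, hv⟩ := Matrix.exists_vecMul_eq_zero_iff.mpr hdet
  apply hv0
  have key : (WithLp.toLp 2 v : Euc n) = 0 := by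
    apply h
    intro w
    have h1 := map_eq_sum_basisVec (B (WithLp.toLp 2 v) : Euc n →ₗ[ℝ] ℝ) w
    simp only [ContinuousLinearMap.coe_coe] at h1
    rw [h1]
    refine Finset.sum_eq_zero fun b _ => ?_
    have h2 := map_eq_sum_basisVec ((B.flip (basisVec b)) : Euc n →ₗ[ℝ] ℝ) (WithLp.toLp 2 v)
    simp only [ContinuousLinearMap.coe_coe, ContinuousLinearMap.flip_apply] at h2
    rw [h2]
    have h3 := congrFun hv b
    simp only [Matrix.vecMul, dotProduct, gram, Matrix.of_apply, Pi.zero_apply] at h3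
    simp [h3]
  ext a
  exact congrArg (fun z : Euc n => z a) key

theorem gram_det_ne_zero_of_pos {n : ℕ} {B : BForm n} (h : ∀ v, v ≠ 0 → 0 < B v v) :
    (gram B).det ≠ 0 :=
  gram_det_ne_zero fun v hv => by
    by_contra hne
    exact (h v hne).ne' (hv v)

/-- On basis vectors this is `gram B * (gram B)⁻¹ = 1`. Symmetry enters because `sharp` places the
free index of the inverse matrix in the first slot of `B`. -/
theorem apply_sharp {n : ℕ} {B : BForm n} (hdet : (gram B).det ≠ 0)
    (hsymm : ∀ v w, B v w = B w v) (β : Euc n →L[ℝ] ℝ) (w : Euc n) : B (sharp B β) w = β w := by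
  have hbasis : ∀ c, B (sharp B β) (basisVec c) = β (basisVec c) := by
    intro c
    have h1 := map_eq_sum_basisVec ((B.flip (basisVec c)) : Euc n →ₗ[ℝ] ℝ) (sharp B β)
    simp only [ContinuousLinearMap.coe_coe, ContinuousLinearMap.flip_apply] at h1
    rw [h1]
    simp only [sharp_apply, smul_eq_mul, Finset.sum_mul]
    rw [Finset.sum_comm]
    have hinv : gram B * (gram B)⁻¹ = 1 := Matrix.mul_nonsing_inv _ (isUnit_iff_ne_zero.mpr hdet)
    have : ∀ b, ∑ a, (gram B)⁻¹ a b * β (basisVec b) * B (basisVec a) (basisVec c) =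
        (1 : Matrix (Fin n) (Fin n) ℝ) c b * β (basisVec b) := by
      intro b
      rw [← hinv, Matrix.mul_apply, Finset.sum_mul]
      refine Finset.sum_congr rfl fun a _ => ?_
      simp only [gram, Matrix.of_apply]
      rw [hsymm (basisVec a) (basisVec c)]
      ring
    simp [this, Matrix.one_apply]
  have h1 := map_eq_sum_basisVec (B (sharp B β) : Euc n →ₗ[ℝ] ℝ) w
  have h2 := map_eq_sum_basisVec (β : Euc n →ₗ[ℝ] ℝ) w
  simp only [ContinuousLinearMap.coe_coe] at h1 h2
  rw [h1, h2]
  simp [hbasis]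

theorem eq_zero_of_gram_det_ne_zero {n : ℕ} {B : BForm n} (hdet : (gram B).det ≠ 0)
    {v : Euc n} (hv : ∀ w, B v w = 0) : v = 0 := by
  have : (WithLp.ofLp v : Fin n → ℝ) = 0 := by
    by_contra hne
    apply hdet
    refine Matrix.exists_vecMul_eq_zero_iff.mp ⟨_, hne, ?_⟩
    funext b
    have h2 := map_eq_sum_basisVec ((B.flip (basisVec b)) : Euc n →ₗ[ℝ] ℝ) v
    simp only [ContinuousLinearMap.coe_coe, ContinuousLinearMap.flip_apply] at h2
    simpa [Matrix.vecMul, dotProduct, gram, hv] using h2.symm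
  ext a
  exact congrFun this a

theorem eq_of_forall_apply_eq {n : ℕ} {B : BForm n} (hdet : (gram B).det ≠ 0)
    {v v' : Euc n} (h : ∀ w, B v w = B v' w) : v = v' :=
  sub_eq_zero.mp (eq_zero_of_gram_det_ne_zero hdet fun w => by simp [h w])

theorem eq_sharp {n : ℕ} {B : BForm n} (hdet : (gram B).det ≠ 0)
    (hsymm : ∀ v w, B v w = B w v) {β : Euc n →L[ℝ] ℝ} {v : Euc n} (h : ∀ w, B v w = β w) :
    v = sharp B β :=
  eq_of_forall_apply_eq hdet fun w => by rw [h, apply_sharp hdet hsymm]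

theorem sharp_add {n : ℕ} (B : BForm n) (β γ : Euc n →L[ℝ] ℝ) :
    sharp B (β + γ) = sharp B β + sharp B γ := by
  ext a
  simp [sharp_apply, mul_add, Finset.sum_add_distrib]

theorem sharp_smul {n : ℕ} (B : BForm n) (c : ℝ) (β : Euc n →L[ℝ] ℝ) :
    sharp B (c • β) = c • sharp B β := by
  ext a
  simp only [sharp_apply, _root_.smul_apply, smul_eq_mul, PiLp.smul_apply,
    Finset.mul_sum]
  exact Finset.sum_congr rfl fun b _ => by ring

/-- The matrix of a linear map in the standard basis. -/
def stdMatrix {n : ℕ} (A : Euc n →L[ℝ] Euc n) : Matrix (Fin n) (Fin n) ℝ :=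
  Matrix.of fun c a => A (basisVec a) c

theorem det_stdMatrix {n : ℕ} (A : Euc n →L[ℝ] Euc n) : (stdMatrix A).det = A.det := by
  have : stdMatrix A = LinearMap.toMatrix (EuclideanSpace.basisFun (Fin n) ℝ).toBasis
      (EuclideanSpace.basisFun (Fin n) ℝ).toBasis (A : Euc n →ₗ[ℝ] Euc n) := by
    ext c a
    simp [stdMatrix, LinearMap.toMatrix_apply, basisVec]
  rw [this, LinearMap.det_toMatrix]

theorem gram_bilinearComp {n : ℕ} (B : BForm n) (A : Euc n →L[ℝ] Euc n) :
    gram (B.bilinearComp A A) = (stdMatrix A)ᵀ * gram B * stdMatrix A := by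
  ext a b
  simp only [gram, Matrix.of_apply, ContinuousLinearMap.bilinearComp_apply, Matrix.mul_apply,
    Matrix.transpose_apply, stdMatrix]
  have h1 := map_eq_sum_basisVec (B (A (basisVec a)) : Euc n →ₗ[ℝ] ℝ) (A (basisVec b))
  simp only [ContinuousLinearMap.coe_coe] at h1
  rw [h1]
  refine Finset.sum_congr rfl fun d _ => ?_
  have h2 := map_eq_sum_basisVec ((B.flip (basisVec d)) : Euc n →ₗ[ℝ] ℝ) (A (basisVec a))
  simp only [ContinuousLinearMap.coe_coe, ContinuousLinearMap.flip_apply] at h2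
  rw [h2]
  simp [mul_comm]

theorem det_gram_bilinearComp {n : ℕ} (B : BForm n) (A : Euc n →L[ℝ] Euc n) :
    (gram (B.bilinearComp A A)).det = A.det ^ 2 * (gram B).det := by
  rw [gram_bilinearComp, Matrix.det_mul, Matrix.det_mul, Matrix.det_transpose, det_stdMatrix]
  ring

/-- The trace does not depend on the basis. -/
theorem metricTrace_bilinearComp {n : ℕ} {V : Type*} [AddCommGroup V] [Module ℝ V]
    (B : BForm n) (A : Euc n →L[ℝ] Euc n) (hdet : (gram (B.bilinearComp A A)).det ≠ 0)
    (Q : Euc n →ₗ[ℝ] Euc n →ₗ[ℝ] V) :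
    metricTrace (B.bilinearComp A A) (fun v w => Q (A v) (A w)) =
      metricTrace B (fun v w => Q v w) := by
  set M := stdMatrix A with hM
  set P := (gram (B.bilinearComp A A))⁻¹ with hP
  -- A nondegenerate pull-back forces `A` to be invertible, since the Gram determinant picks up the
  -- factor `A.det ^ 2`.
  have hMdet : IsUnit M.det := by
    rw [isUnit_iff_ne_zero, hM, det_stdMatrix]
    rintro h0
    exact hdet (by rw [det_gram_bilinearComp, h0]; ring)
  have hMT : IsUnit Mᵀ.det := by rwa [Matrix.det_transpose]
  -- The inverse Gram matrix transforms contragrediently, so the two factors of `M` produced by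
  -- expanding `Q` turn `P` back into `(gram B)⁻¹`.
  have hinv : M * P * Mᵀ = (gram B)⁻¹ := by
    rw [hP, gram_bilinearComp, ← hM, Matrix.mul_inv_rev, Matrix.mul_inv_rev]
    calc M * (M⁻¹ * ((gram B)⁻¹ * Mᵀ⁻¹)) * Mᵀ = (M * M⁻¹) * (gram B)⁻¹ * (Mᵀ⁻¹ * Mᵀ) := by
          simp only [Matrix.mul_assoc]
      _ = _ := by
          rw [Matrix.mul_nonsing_inv _ hMdet, Matrix.nonsing_inv_mul _ hMT]
          simp
  have hQ : ∀ a b, Q (A (basisVec a)) (A (basisVec b)) =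
      ∑ c, ∑ d, (M c a * M d b) • Q (basisVec c) (basisVec d) := by
    intro a b
    rw [map_eq_sum_basisVec Q (A (basisVec a)), LinearMap.sum_apply]
    refine Finset.sum_congr rfl fun c _ => ?_
    rw [LinearMap.smul_apply, map_eq_sum_basisVec (Q (basisVec c)) (A (basisVec b)),
      Finset.smul_sum]
    refine Finset.sum_congr rfl fun d _ => ?_
    rw [smul_smul]
    rfl
  unfold metricTrace
  rw [← hP, ← hinv]
  simp only [hQ, Finset.smul_sum, smul_smul]
  calc ∑ a, ∑ b, ∑ c, ∑ d, (P a b * (M c a * M d b)) • Q (basisVec c) (basisVec d)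
      = ∑ a, ∑ c, ∑ d, ∑ b, (P a b * (M c a * M d b)) • Q (basisVec c) (basisVec d) := by
        refine Finset.sum_congr rfl fun a _ => ?_
        rw [Finset.sum_comm]
        refine Finset.sum_congr rfl fun c _ => ?_
        rw [Finset.sum_comm]
    _ = ∑ c, ∑ d, ∑ a, ∑ b, (P a b * (M c a * M d b)) • Q (basisVec c) (basisVec d) := by
        rw [Finset.sum_comm]
        refine Finset.sum_congr rfl fun c _ => ?_
        rw [Finset.sum_comm]
    _ = _ := by
        refine Finset.sum_congr rfl fun c _ => Finset.sum_congr rfl fun d _ => ?_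
        simp only [← Finset.sum_smul]
        congr 1
        simp only [Matrix.mul_apply, Matrix.transpose_apply, Finset.sum_mul]
        rw [Finset.sum_comm]
        exact Finset.sum_congr rfl fun a _ => Finset.sum_congr rfl fun b _ => by ring

theorem map_metricTrace {n : ℕ} {V W : Type*} [AddCommGroup V] [Module ℝ V] [AddCommGroup W]
    [Module ℝ W] (L : V →ₗ[ℝ] W) (B : BForm n) (Q : Euc n → Euc n → V) :
    L (metricTrace B Q) = metricTrace B (fun v w => L (Q v w)) := by
  simp [metricTrace]

theorem metricTrace_add {n : ℕ} {V : Type*} [AddCommGroup V] [Module ℝ V]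
    (B : BForm n) (Q Q' : Euc n → Euc n → V) :
    metricTrace B (fun v w => Q v w + Q' v w) = metricTrace B Q + metricTrace B Q' := by
  simp [metricTrace, Finset.sum_add_distrib]

theorem metricTrace_smul {n : ℕ} {V : Type*} [AddCommGroup V] [Module ℝ V]
    (B : BForm n) (c : ℝ) (Q : Euc n → Euc n → V) :
    metricTrace B (fun v w => c • Q v w) = c • metricTrace B Q := by
  simp only [metricTrace, Finset.smul_sum]
  refine Finset.sum_congr rfl fun a _ => Finset.sum_congr rfl fun b _ => ?_
  rw [smul_comm]

/-! ### Smooth dependence on parameters -/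

section Smooth

variable {E : Type*} [NormedAddCommGroup E] [NormedSpace ℝ E] {n : ℕ} {k : ℕ∞ω}

theorem contDiffAt_det {A : E → Matrix (Fin n) (Fin n) ℝ} {x : E}
    (h : ∀ a b, ContDiffAt ℝ k (fun y => A y a b) x) : ContDiffAt ℝ k (fun y => (A y).det) x := by
  simp only [Matrix.det_apply']
  refine ContDiffAt.sum fun s _ => ?_
  exact contDiffAt_const.mul (contDiffAt_prod fun i _ => h _ _)

/-- Cramer's rule: the inverse is the adjugate over the determinant, and an adjugate entry is the
determinant of the matrix with one row replaced by a constant row. -/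
theorem contDiffAt_matrix_inv {A : E → Matrix (Fin n) (Fin n) ℝ} {x : E}
    (h : ∀ a b, ContDiffAt ℝ k (fun y => A y a b) x) (hdet : (A x).det ≠ 0) (a b : Fin n) :
    ContDiffAt ℝ k (fun y => (A y)⁻¹ a b) x := by
  simp only [Matrix.inv_def, Ring.inverse_eq_inv', Matrix.smul_apply, smul_eq_mul,
    Matrix.adjugate_apply]
  refine ((contDiffAt_det h).inv hdet).mul (contDiffAt_det fun i j => ?_)
  by_cases hi : i = b
  · subst hi
    simp only [Matrix.updateRow_self]
    exact contDiffAt_const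
  · simp only [Matrix.updateRow_ne hi]
    exact h i j

theorem contDiffAt_gram {B : E → BForm n} {x : E} (h : ContDiffAt ℝ k B x) (a b : Fin n) :
    ContDiffAt ℝ k (fun y => gram (B y) a b) x :=
  (h.clm_apply contDiffAt_const).clm_apply contDiffAt_const

theorem contDiffAt_gram_inv {B : E → BForm n} {x : E} (h : ContDiffAt ℝ k B x)
    (hdet : (gram (B x)).det ≠ 0) (a b : Fin n) :
    ContDiffAt ℝ k (fun y => (gram (B y))⁻¹ a b) x :=
  contDiffAt_matrix_inv (contDiffAt_gram h) hdet a b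

theorem contDiffAt_sharp {B : E → BForm n} {β : E → Euc n →L[ℝ] ℝ} {x : E}
    (h : ContDiffAt ℝ k B x) (hdet : (gram (B x)).det ≠ 0) (hβ : ContDiffAt ℝ k β x) :
    ContDiffAt ℝ k (fun y => sharp (B y) (β y)) x := by
  unfold sharp
  refine ContDiffAt.sum fun a _ => ContDiffAt.sum fun b _ => ?_
  exact ((contDiffAt_gram_inv h hdet a b).mul (hβ.clm_apply contDiffAt_const)).smul
    contDiffAt_const

theorem contDiffAt_metricTrace {V : Type*} [NormedAddCommGroup V] [NormedSpace ℝ V]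
    {B : E → BForm n} {Q : E → Euc n → Euc n → V} {x : E} (h : ContDiffAt ℝ k B x)
    (hdet : (gram (B x)).det ≠ 0)
    (hQ : ∀ v w, ContDiffAt ℝ k (fun y => Q y v w) x) :
    ContDiffAt ℝ k (fun y => metricTrace (B y) (Q y)) x := by
  unfold metricTrace
  refine ContDiffAt.sum fun a _ => ContDiffAt.sum fun b _ => ?_
  exact (contDiffAt_gram_inv h hdet a b).smul (hQ _ _)

theorem contDiff_clm_flip (E F G : Type*) [NormedAddCommGroup E] [NormedSpace ℝ E]
    [NormedAddCommGroup F] [NormedSpace ℝ F] [NormedAddCommGroup G] [NormedSpace ℝ G] :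
    ContDiff ℝ k (fun f : E →L[ℝ] F →L[ℝ] G => f.flip) := by
  exact LinearIsometryEquiv.contDiff (𝕜 := ℝ) (E := E →L[ℝ] F →L[ℝ] G)
    (F := F →L[ℝ] E →L[ℝ] G) (ContinuousLinearMap.flipₗᵢ ℝ E F G)

/-- `bilinearComp` unfolds to two compositions, each followed by a `flip`, and `flip` is a linear
isometry. -/
theorem contDiffAt_bilinearComp {m : ℕ} {B : E → BForm m} {A : E → Euc n →L[ℝ] Euc m} {x : E}
    (hB : ContDiffAt ℝ k B x) (hA : ContDiffAt ℝ k A x) :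
    ContDiffAt ℝ k (fun y => (B y).bilinearComp (A y) (A y)) x := by
  have h1 : ContDiffAt ℝ k (fun y => ((B y).comp (A y)).flip) x :=
    (contDiff_clm_flip (Euc n) (Euc m) ℝ).contDiffAt.comp x (hB.clm_comp hA)
  exact (contDiff_clm_flip (Euc n) (Euc n) ℝ).contDiffAt.comp x (h1.clm_comp hA)

end Smooth

end QuasiLocal

end

noncomputable section

namespace QuasiLocal

set_option maxSynthPendingDepth 3

/-! ### Pulling back metrics and Christoffel symbols -/

theorem contDiffAt_fderiv {E F : Type*} [NormedAddCommGroup E] [NormedSpace ℝ E]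
    [NormedAddCommGroup F] [NormedSpace ℝ F] {f : E → F} {x : E} (hf : ContDiffAt ℝ ∞ f x) :
    ContDiffAt ℝ ∞ (fderiv ℝ f) x :=
  hf.fderiv_right (by simp)

/-- The last term is the non-tensorial part of a second derivative, which the change of the
Christoffel symbols will cancel. -/
theorem fderiv_fderiv_comp {E F G : Type*} [NormedAddCommGroup E] [NormedSpace ℝ E]
    [NormedAddCommGroup F] [NormedSpace ℝ F] [NormedAddCommGroup G] [NormedSpace ℝ G]
    {f : F → G} {g : E → F} {x : E} (hf : ContDiffAt ℝ ∞ f (g x)) (hg : ContDiffAt ℝ ∞ g x)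
    (v w : E) :
    fderiv ℝ (fderiv ℝ (f ∘ g)) x v w =
      fderiv ℝ (fderiv ℝ f) (g x) (fderiv ℝ g x v) (fderiv ℝ g x w) +
        fderiv ℝ f (g x) (fderiv ℝ (fderiv ℝ g) x v w) := by
  -- To be differentiated once more, the first-order chain rule must hold on a neighbourhood of `x`,
  -- so differentiability is spread from `x` to nearby points.
  have hev : fderiv ℝ (f ∘ g) =ᶠ[𝓝 x] fun y => (fderiv ℝ f (g y)).comp (fderiv ℝ g y) := by
    have h1 : ∀ᶠ y in 𝓝 x, ContDiffAt ℝ 1 f (g y) :=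
      hg.continuousAt.eventually ((hf.of_le (by norm_cast)).eventually (by decide))
    have h2 : ∀ᶠ y in 𝓝 x, ContDiffAt ℝ 1 g y := (hg.of_le (by norm_cast)).eventually (by decide)
    filter_upwards [h1, h2] with y hy1 hy2
    exact fderiv_comp y (hy1.differentiableAt (by simp)) (hy2.differentiableAt (by simp))
  have hf' : DifferentiableAt ℝ (fderiv ℝ f) (g x) :=
    (contDiffAt_fderiv hf).differentiableAt (by simp)
  have hg' : DifferentiableAt ℝ (fderiv ℝ g) x :=
    (contDiffAt_fderiv hg).differentiableAt (by simp)
  have hgd : DifferentiableAt ℝ g x := hg.differentiableAt (by simp)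
  rw [hev.fderiv_eq]
  have h3 : HasFDerivAt (fun y => fderiv ℝ f (g y)) _ x := hf'.hasFDerivAt.comp x hgd.hasFDerivAt
  rw [(h3.clm_comp hg'.hasFDerivAt).fderiv]
  simp [add_comm]

/-- The pull-back `φ^* G` of a metric on `ℝᵐ` by a map `φ : ℝⁿ → ℝᵐ`. -/
def pullForm {n m : ℕ} (G : Euc m → BForm m) (φ : Euc n → Euc m) (x : Euc n) : BForm n :=
  (G (φ x)).bilinearComp (fderiv ℝ φ x) (fderiv ℝ φ x)

theorem pullForm_apply {n m : ℕ} (G : Euc m → BForm m) (φ : Euc n → Euc m) (x v w : Euc n) :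
    pullForm G φ x v w = G (φ x) (fderiv ℝ φ x v) (fderiv ℝ φ x w) := rfl

/-- A smooth field of nondegenerate symmetric forms, at a point. -/
structure IsMetricAt {n : ℕ} (G : Euc n → BForm n) (x : Euc n) : Prop where
  smooth : ContDiffAt ℝ ∞ G x
  symm : ∀ v w, G x v w = G x w v
  det_ne_zero : (gram (G x)).det ≠ 0

theorem contDiffAt_pullForm {n m : ℕ} {G : Euc m → BForm m} {φ : Euc n → Euc m} {x : Euc n}
    (hG : ContDiffAt ℝ ∞ G (φ x)) (hφ : ContDiffAt ℝ ∞ φ x) :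
    ContDiffAt ℝ ∞ (pullForm G φ) x :=
  contDiffAt_bilinearComp (hG.comp x hφ) (contDiffAt_fderiv hφ)

/-- Lowering the index removes the inverse matrix and leaves the Koszul formula in coordinates. -/
theorem apply_christoffel {n : ℕ} {G : Euc n → BForm n} {z : Euc n} (hG : IsMetricAt G z)
    (v w l : Euc n) :
    G z (christoffel G z v w) l =
      1 / 2 * (fderiv ℝ G z v w l + fderiv ℝ G z w v l - fderiv ℝ G z l v w) := by
  rw [christoffel, apply_sharp hG.det_ne_zero hG.symm]
  simp

theorem fderiv_pullForm_apply {n m : ℕ} {G : Euc m → BForm m} {φ : Euc n → Euc m} {x : Euc n}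
    (hG : ContDiffAt ℝ ∞ G (φ x)) (hφ : ContDiffAt ℝ ∞ φ x) (v w l : Euc n) :
    fderiv ℝ (pullForm G φ) x v w l =
      fderiv ℝ G (φ x) (fderiv ℝ φ x v) (fderiv ℝ φ x w) (fderiv ℝ φ x l) +
        G (φ x) (fderiv ℝ (fderiv ℝ φ) x v w) (fderiv ℝ φ x l) +
        G (φ x) (fderiv ℝ φ x w) (fderiv ℝ (fderiv ℝ φ) x v l) := by
  have hP : DifferentiableAt ℝ (pullForm G φ) x :=
    (contDiffAt_pullForm hG hφ).differentiableAt (by simp)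
  have hD : DifferentiableAt ℝ (fderiv ℝ φ) x :=
    (contDiffAt_fderiv hφ).differentiableAt (by simp)
  have h1 : HasFDerivAt (fun y => pullForm G φ y w l)
      (((fderiv ℝ (pullForm G φ) x).flip w).flip l) x := by
    have h := ((hP.hasFDerivAt.clm_apply (hasFDerivAt_const w x)).clm_apply
      (hasFDerivAt_const l x))
    refine h.congr_fderiv ?_
    ext
    simp
  have hGφ : HasFDerivAt (fun y => G (φ y)) ((fderiv ℝ G (φ x)).comp (fderiv ℝ φ x)) x :=
    (hG.differentiableAt (by simp)).hasFDerivAt.comp x (hφ.differentiableAt (by simp)).hasFDerivAt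
  have hv : ∀ v, HasFDerivAt (fun y => fderiv ℝ φ y v) ((fderiv ℝ (fderiv ℝ φ) x).flip v) x := by
    intro v
    have h := hD.hasFDerivAt.clm_apply (hasFDerivAt_const v x)
    refine h.congr_fderiv ?_
    ext
    simp
  have h2 := (hGφ.clm_apply (hv w)).clm_apply (hv l)
  have h3 := DFunLike.congr_fun (h1.unique h2) v
  simp only [ContinuousLinearMap.flip_apply, _root_.add_apply,
    ContinuousLinearMap.comp_apply] at h3
  rw [h3]
  ring

theorem fderiv_surjective_of_det_pullForm_ne_zero {n : ℕ} {G : Euc n → BForm n}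
    {φ : Euc n → Euc n} {x : Euc n} (h : (gram (pullForm G φ x)).det ≠ 0) :
    Function.Surjective (fderiv ℝ φ x) := by
  have h0 : (fderiv ℝ φ x).det ≠ 0 := by
    intro h0
    apply h
    rw [pullForm, det_gram_bilinearComp, h0]
    ring
  have h1 : IsUnit (fderiv ℝ φ x : Euc n →ₗ[ℝ] Euc n) := by
    rw [LinearMap.isUnit_iff_isUnit_det]
    exact isUnit_iff_ne_zero.mpr h0
  exact ((Module.End.isUnit_iff _).mp h1).2

theorem det_ne_zero_of_pullForm {n : ℕ} {G : Euc n → BForm n} {φ : Euc n → Euc n} {x : Euc n}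
    (h : (gram (pullForm G φ x)).det ≠ 0) : (gram (G (φ x))).det ≠ 0 := by
  intro h0
  apply h
  rw [pullForm, det_gram_bilinearComp, h0]
  ring

/-- Both sides are paired with `fderiv ℝ φ x l`, which is an arbitrary vector because the
nondegenerate pull-back makes the differential surjective. In the Koszul formula for the pulled-back
metric each of the three derivatives contributes two terms containing the second derivative of `φ`.
By symmetry of that second derivative four of the six cancel, and the remaining two are equal and
give the inhomogeneous term. -/
theorem map_christoffel {n : ℕ} {G G' : Euc n → BForm n} {φ : Euc n → Euc n} {x : Euc n}
    (hG : IsMetricAt G (φ x)) (hG' : IsMetricAt G' x) (hφ : ContDiffAt ℝ ∞ φ x)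
    (h : G' =ᶠ[𝓝 x] pullForm G φ) (v w : Euc n) :
    fderiv ℝ φ x (christoffel G' x v w) =
      christoffel G (φ x) (fderiv ℝ φ x v) (fderiv ℝ φ x w) + fderiv ℝ (fderiv ℝ φ) x v w := by
  apply eq_of_forall_apply_eq hG.det_ne_zero
  intro l'
  have hx : G' x = pullForm G φ x := h.eq_of_nhds
  obtain ⟨l, rfl⟩ := fderiv_surjective_of_det_pullForm_ne_zero (hx ▸ hG'.det_ne_zero) l'
  have h1 : G (φ x) (fderiv ℝ φ x (christoffel G' x v w)) (fderiv ℝ φ x l) =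
      G' x (christoffel G' x v w) l := by rw [hx, pullForm_apply]
  rw [h1, apply_christoffel hG', h.fderiv_eq]
  simp only [map_add, _root_.add_apply, apply_christoffel hG,
    fderiv_pullForm_apply hG.smooth hφ]
  have hs : ∀ a b, fderiv ℝ (fderiv ℝ φ) x a b = fderiv ℝ (fderiv ℝ φ) x b a := fun a b =>
    (hφ.isSymmSndFDerivAt (by simp; norm_cast)) a b
  rw [hs w v, hs l v, hs l w, hG.symm (fderiv ℝ φ x w), hG.symm (fderiv ℝ φ x v)]
  ring

/-- The Christoffel symbols as a bilinear map. -/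
def christoffelBilin {n : ℕ} (G : Euc n → BForm n) (z : Euc n) :
    Euc n →ₗ[ℝ] Euc n →ₗ[ℝ] Euc n :=
  LinearMap.mk₂ ℝ (christoffel G z)
    (fun v v' w => by
      unfold christoffel
      rw [← sharp_add, ← smul_add]
      congr 2
      ext l
      simp
      ring)
    (fun c v w => by
      unfold christoffel
      rw [← sharp_smul, smul_comm]
      congr 2
      ext l
      simp
      ring)
    (fun v w w' => by
      unfold christoffel
      rw [← sharp_add, ← smul_add]
      congr 2
      ext l
      simp
      ring)
    (fun c v w => by
      unfold christoffel
      rw [← sharp_smul, smul_comm]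
      congr 2
      ext l
      simp
      ring)

theorem contDiffAt_christoffel {E : Type*} [NormedAddCommGroup E] [NormedSpace ℝ E] {n : ℕ}
    {G : Euc n → BForm n} {z v w : E → Euc n} {x : E} (hG : IsMetricAt G (z x))
    (hz : ContDiffAt ℝ ∞ z x) (hv : ContDiffAt ℝ ∞ v x) (hw : ContDiffAt ℝ ∞ w x) :
    ContDiffAt ℝ ∞ (fun y => christoffel G (z y) (v y) (w y)) x := by
  have hD : ContDiffAt ℝ ∞ (fun y => fderiv ℝ G (z y)) x :=
    (contDiffAt_fderiv hG.smooth).comp x hz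
  have hDf : ContDiffAt ℝ ∞ (fun y => (fderiv ℝ G (z y)).flip) x :=
    (contDiff_clm_flip _ _ _).contDiffAt.comp x hD
  have hDff : ContDiffAt ℝ ∞ (fun y => ((fderiv ℝ G (z y)).flip (v y)).flip) x :=
    (contDiff_clm_flip _ _ _).contDiffAt.comp x (hDf.clm_apply hv)
  unfold christoffel
  exact contDiffAt_sharp (hG.smooth.comp x hz) hG.det_ne_zero (ContDiffAt.const_smul (1 / 2 : ℝ)
    ((((hD.clm_apply hv).clm_apply hw).add ((hD.clm_apply hw).clm_apply hv)).sub
      (hDff.clm_apply hw)))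

/-! ### Hessian and Laplacian in coordinates -/

/-- The Hessian in coordinates. -/
def hessCoord {n : ℕ} (G : Euc n → BForm n) (h : Euc n → ℝ) (u v w : Euc n) : ℝ :=
  fderiv ℝ (fderiv ℝ h) u v w - fderiv ℝ h u (christoffel G u v w)

/-- The Laplacian in coordinates. -/
def lapCoord {n : ℕ} (G : Euc n → BForm n) (h : Euc n → ℝ) (u : Euc n) : ℝ :=
  metricTrace (G u) (hessCoord G h u)

/-- The Hessian in coordinates as a bilinear map. -/
def hessBilin {n : ℕ} (G : Euc n → BForm n) (h : Euc n → ℝ) (u : Euc n) :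
    Euc n →ₗ[ℝ] Euc n →ₗ[ℝ] ℝ :=
  LinearMap.mk₂ ℝ (hessCoord G h u)
    (fun v v' w => by
      have := LinearMap.congr_fun (map_add (christoffelBilin G u) v v') w
      simp only [christoffelBilin, LinearMap.mk₂_apply, LinearMap.add_apply] at this
      simp [hessCoord, this]
      ring)
    (fun c v w => by
      have := LinearMap.congr_fun (map_smul (christoffelBilin G u) c v) w
      simp only [christoffelBilin, LinearMap.mk₂_apply, LinearMap.smul_apply] at this
      simp [hessCoord, this]
      ring)
    (fun v w w' => by
      have := map_add (christoffelBilin G u v) w w'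
      simp only [christoffelBilin, LinearMap.mk₂_apply] at this
      simp [hessCoord, this]
      ring)
    (fun c v w => by
      have := map_smul (christoffelBilin G u v) c w
      simp only [christoffelBilin, LinearMap.mk₂_apply] at this
      simp [hessCoord, this]
      ring)

/-- The differential of `h` applied to the second derivative of `φ` appears in the second-order
chain rule and again in the law for the Christoffel symbols, with opposite signs. The Hessian is
therefore a tensor, and its trace does not see the basis. -/
theorem lapCoord_pullForm {n : ℕ} {G G' : Euc n → BForm n} {φ : Euc n → Euc n} {x : Euc n}
    {h h' : Euc n → ℝ} (hG : IsMetricAt G (φ x)) (hG' : IsMetricAt G' x)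
    (hφ : ContDiffAt ℝ ∞ φ x) (hGG : G' =ᶠ[𝓝 x] pullForm G φ)
    (hh : ContDiffAt ℝ ∞ h (φ x)) (hhh : h' =ᶠ[𝓝 x] h ∘ φ) :
    lapCoord G' h' x = lapCoord G h (φ x) := by
  have hx : G' x = (G (φ x)).bilinearComp (fderiv ℝ φ x) (fderiv ℝ φ x) := hGG.eq_of_nhds
  have hq : hessCoord G' h' x =
      fun v w => hessBilin G h (φ x) (fderiv ℝ φ x v) (fderiv ℝ φ x w) := by
    funext v w
    simp only [hessBilin, LinearMap.mk₂_apply, hessCoord]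
    rw [hhh.fderiv.fderiv_eq, hhh.fderiv_eq, fderiv_fderiv_comp hh hφ,
      fderiv_comp x (hh.differentiableAt (by simp)) (hφ.differentiableAt (by simp)),
      ContinuousLinearMap.comp_apply, map_christoffel hG hG' hφ hGG, map_add]
    ring
  rw [lapCoord, hq, hx, metricTrace_bilinearComp _ _ (hx ▸ hG'.det_ne_zero)]
  rfl

theorem contDiffAt_lapCoord {n : ℕ} {G : Euc n → BForm n} {x : Euc n} {h : Euc n → ℝ}
    (hG : IsMetricAt G x) (hh : ContDiffAt ℝ ∞ h x) : ContDiffAt ℝ ∞ (lapCoord G h) x := by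
  refine contDiffAt_metricTrace hG.smooth hG.det_ne_zero fun v w => ?_
  exact (((contDiffAt_fderiv (contDiffAt_fderiv hh)).clm_apply contDiffAt_const).clm_apply
    contDiffAt_const).sub ((contDiffAt_fderiv hh).clm_apply
      (contDiffAt_christoffel (z := id) hG contDiffAt_id contDiffAt_const contDiffAt_const))

end QuasiLocal

end

noncomputable section

namespace QuasiLocal

set_option maxSynthPendingDepth 3

/-! ### Submanifolds in coordinates -/

/-- The dual vector is determined by its pairings, and `A` is onto because the pull-back is
nondegenerate, so it suffices to pair with vectors `A l`. -/
theorem map_sharp_bilinearComp {n : ℕ} {B : BForm n} {A : Euc n →L[ℝ] Euc n}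
    (hsymm : ∀ v w, B v w = B w v) (hdet : (gram (B.bilinearComp A A)).det ≠ 0)
    (β : Euc n →L[ℝ] ℝ) : A (sharp (B.bilinearComp A A) (β.comp A)) = sharp B β := by
  have hA : A.det ≠ 0 := by
    intro h0
    apply hdet
    rw [det_gram_bilinearComp, h0]
    ring
  have hB : (gram B).det ≠ 0 := by
    intro h0
    apply hdet
    rw [det_gram_bilinearComp, h0]
    ring
  have h1 : IsUnit (A : Euc n →ₗ[ℝ] Euc n) := by
    rw [LinearMap.isUnit_iff_isUnit_det]
    exact isUnit_iff_ne_zero.mpr hA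
  have hsurj : Function.Surjective A := ((Module.End.isUnit_iff _).mp h1).2
  refine eq_sharp hB hsymm fun w => ?_
  obtain ⟨l, rfl⟩ := hsurj w
  exact apply_sharp hdet (fun v w => hsymm _ _) (β.comp A) l

/-- The component of `w` which is `B`-orthogonal to the range of `D`. -/
def normalProj {n m : ℕ} (B : BForm m) (D : Euc n →L[ℝ] Euc m) (w : Euc m) : Euc m :=
  w - D (sharp (B.bilinearComp D D) ((B w).comp D))

theorem normalProj_add {n m : ℕ} (B : BForm m) (D : Euc n →L[ℝ] Euc m) (w w' : Euc m) :
    normalProj B D (w + w') = normalProj B D w + normalProj B D w' := by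
  simp only [normalProj, map_add, ContinuousLinearMap.add_comp, sharp_add]
  abel

theorem normalProj_smul {n m : ℕ} (B : BForm m) (D : Euc n →L[ℝ] Euc m) (c : ℝ) (w : Euc m) :
    normalProj B D (c • w) = c • normalProj B D w := by
  simp only [normalProj, map_smul, ContinuousLinearMap.smul_comp, sharp_smul, smul_sub]

theorem normalProj_map {n m : ℕ} {B : BForm m} {D : Euc n →L[ℝ] Euc m}
    (hsymm : ∀ v w, B v w = B w v) (hdet : (gram (B.bilinearComp D D)).det ≠ 0) (v : Euc n) :
    normalProj B D (D v) = 0 := by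
  have h : v = sharp (B.bilinearComp D D) ((B (D v)).comp D) :=
    eq_sharp hdet (fun v w => hsymm _ _) fun w => rfl
  rw [normalProj, ← h, sub_self]

theorem apply_normalProj {n m : ℕ} {B : BForm m} {D : Euc n →L[ℝ] Euc m}
    (hsymm : ∀ v w, B v w = B w v) (hdet : (gram (B.bilinearComp D D)).det ≠ 0) (w : Euc m)
    (v : Euc n) : B (normalProj B D w) (D v) = 0 := by
  have := apply_sharp hdet (fun v w => hsymm _ _) ((B w).comp D) v
  simp only [ContinuousLinearMap.bilinearComp_apply, ContinuousLinearMap.comp_apply] at this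
  simp [normalProj, this]

/-- `Ψ` is isometric from `B'` to `B` and intertwines the two parametrizations of the tangent plane.
The tangential part is natural by `map_sharp_bilinearComp`, hence so is its complement. -/
theorem map_normalProj {n m : ℕ} {B B' : BForm m} {Ψ : Euc m →L[ℝ] Euc m}
    {A : Euc n →L[ℝ] Euc n} {D D' : Euc n →L[ℝ] Euc m} (hB : B' = B.bilinearComp Ψ Ψ)
    (hD : Ψ.comp D' = D.comp A) (hsymm : ∀ v w, B v w = B w v)
    (hdet : (gram (B'.bilinearComp D' D')).det ≠ 0) (w : Euc m) :
    Ψ (normalProj B' D' w) = normalProj B D (Ψ w) := by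
  have hD' : ∀ v, Ψ (D' v) = D (A v) := fun v => DFunLike.congr_fun hD v
  have h1 : B'.bilinearComp D' D' = (B.bilinearComp D D).bilinearComp A A := by
    ext v w
    simp [hB, hD']
  have h2 : (B' w).comp D' = ((B (Ψ w)).comp D).comp A := by
    ext v
    simp [hB, hD']
  rw [normalProj, normalProj, map_sub, hD', h2]
  rw [h1] at hdet ⊢
  rw [map_sharp_bilinearComp (B := B.bilinearComp D D) (fun v w => hsymm _ _) hdet]

/-- The second derivative `∂_v ∂_w F + Γ(dF v, dF w)` in coordinates. -/
def secondCoord {n m : ℕ} (G : Euc m → BForm m) (F : Euc n → Euc m) (u v w : Euc n) : Euc m :=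
  fderiv ℝ (fderiv ℝ F) u v w + christoffel G (F u) (fderiv ℝ F u v) (fderiv ℝ F u w)

/-- The mean curvature vector in coordinates. -/
def meanCurvCoord {n m : ℕ} (G : Euc m → BForm m) (F : Euc n → Euc m) (u : Euc n) : Euc m :=
  metricTrace (pullForm G F u) (fun v w => normalProj (G (F u)) (fderiv ℝ F u)
    (secondCoord G F u v w))

/-- The covariant derivative along `F` in coordinates. -/
def covCoord {n m : ℕ} (G : Euc m → BForm m) (F W : Euc n → Euc m) (u v : Euc n) : Euc m :=
  fderiv ℝ W u v + christoffel G (F u) (fderiv ℝ F u v) (W u)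

/-- The second fundamental form in coordinates, as a bilinear map. -/
def normalSecondBilin {n m : ℕ} (G : Euc m → BForm m) (F : Euc n → Euc m) (u : Euc n) :
    Euc n →ₗ[ℝ] Euc n →ₗ[ℝ] Euc m :=
  LinearMap.mk₂ ℝ (fun v w => normalProj (G (F u)) (fderiv ℝ F u) (secondCoord G F u v w))
    (fun v v' w => by
      have := LinearMap.congr_fun (map_add (christoffelBilin G (F u)) (fderiv ℝ F u v)
        (fderiv ℝ F u v')) (fderiv ℝ F u w)
      simp only [christoffelBilin, LinearMap.mk₂_apply, LinearMap.add_apply] at this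
      rw [← normalProj_add]
      congr 1
      simp only [secondCoord, map_add, _root_.add_apply, this]
      abel)
    (fun c v w => by
      have := LinearMap.congr_fun (map_smul (christoffelBilin G (F u)) c (fderiv ℝ F u v))
        (fderiv ℝ F u w)
      simp only [christoffelBilin, LinearMap.mk₂_apply, LinearMap.smul_apply] at this
      rw [← normalProj_smul]
      congr 1
      simp only [secondCoord, map_smul, _root_.smul_apply, this, smul_add])
    (fun v w w' => by
      have := map_add (christoffelBilin G (F u) (fderiv ℝ F u v)) (fderiv ℝ F u w)
        (fderiv ℝ F u w')
      simp only [christoffelBilin, LinearMap.mk₂_apply] at this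
      rw [← normalProj_add]
      congr 1
      simp only [secondCoord, map_add, this]
      abel)
    (fun c v w => by
      have := map_smul (christoffelBilin G (F u) (fderiv ℝ F u v)) c (fderiv ℝ F u w)
      simp only [christoffelBilin, LinearMap.mk₂_apply] at this
      rw [← normalProj_smul]
      congr 1
      simp only [secondCoord, map_smul, this, smul_add])

/-- `F` is, near `u`, a smooth parametrized submanifold on which the metric `G` is nondegenerate. -/
structure IsImmersedAt {n m : ℕ} (G : Euc m → BForm m) (F : Euc n → Euc m) (u : Euc n) : Prop where
  metric : IsMetricAt G (F u)
  smooth : ContDiffAt ℝ ∞ F u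
  det_ne_zero : (gram (pullForm G F u)).det ≠ 0

/-- Two local descriptions `(G', F')` and `(G, F)` of a submanifold that are related by the
coordinate changes `φ` of the submanifold and `Ψ` of the ambient manifold. -/
structure IsChartChange {n m : ℕ} (G' : Euc m → BForm m) (F' : Euc n → Euc m)
    (G : Euc m → BForm m) (F : Euc n → Euc m) (φ : Euc n → Euc n) (Ψ : Euc m → Euc m)
    (x : Euc n) : Prop where
  source : IsImmersedAt G' F' x
  target : IsImmersedAt G F (φ x)
  smooth : ContDiffAt ℝ ∞ φ x
  smooth_ambient : ContDiffAt ℝ ∞ Ψ (F' x)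
  metric_eq : G' =ᶠ[𝓝 (F' x)] pullForm G Ψ
  map_eq : Ψ ∘ F' =ᶠ[𝓝 x] F ∘ φ

namespace IsChartChange

variable {n m : ℕ} {G' : Euc m → BForm m} {F' : Euc n → Euc m}
    {G : Euc m → BForm m} {F : Euc n → Euc m} {φ : Euc n → Euc n} {Ψ : Euc m → Euc m}
    {x : Euc n}

theorem apply_eq (h : IsChartChange G' F' G F φ Ψ x) : Ψ (F' x) = F (φ x) := h.map_eq.eq_of_nhds

theorem fderiv_comp_eq (h : IsChartChange G' F' G F φ Ψ x) :
    (fderiv ℝ Ψ (F' x)).comp (fderiv ℝ F' x) = (fderiv ℝ F (φ x)).comp (fderiv ℝ φ x) := by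
  rw [← fderiv_comp x (h.smooth_ambient.differentiableAt (by simp))
    (h.source.smooth.differentiableAt (by simp)), h.map_eq.fderiv_eq,
    fderiv_comp x (h.target.smooth.differentiableAt (by simp))
    (h.smooth.differentiableAt (by simp))]

theorem fderiv_apply_eq (h : IsChartChange G' F' G F φ Ψ x) (v : Euc n) :
    fderiv ℝ Ψ (F' x) (fderiv ℝ F' x v) = fderiv ℝ F (φ x) (fderiv ℝ φ x v) :=
  DFunLike.congr_fun h.fderiv_comp_eq v

theorem metric_apply_eq (h : IsChartChange G' F' G F φ Ψ x) :
    G' (F' x) = (G (F (φ x))).bilinearComp (fderiv ℝ Ψ (F' x)) (fderiv ℝ Ψ (F' x)) := by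
  rw [h.metric_eq.eq_of_nhds, pullForm, h.apply_eq]

theorem pullForm_eq (h : IsChartChange G' F' G F φ Ψ x) : pullForm G' F' x =
    (pullForm G F (φ x)).bilinearComp (fderiv ℝ φ x) (fderiv ℝ φ x) := by
  ext v w
  simp only [pullForm_apply, ContinuousLinearMap.bilinearComp_apply, h.metric_apply_eq,
    h.fderiv_apply_eq]

/-- Differentiating `Ψ ∘ F' = F ∘ φ` twice produces a second derivative of `Ψ` that the ambient
Christoffel law cancels. The error that survives comes from `φ` and is tangent to the surface. -/
theorem map_secondCoord (h : IsChartChange G' F' G F φ Ψ x) (v w : Euc n) :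
    fderiv ℝ Ψ (F' x) (secondCoord G' F' x v w) =
      secondCoord G F (φ x) (fderiv ℝ φ x v) (fderiv ℝ φ x w) +
        fderiv ℝ F (φ x) (fderiv ℝ (fderiv ℝ φ) x v w) := by
  have h1 := fderiv_fderiv_comp h.smooth_ambient h.source.smooth v w
  rw [h.map_eq.fderiv.fderiv_eq, fderiv_fderiv_comp h.target.smooth h.smooth] at h1
  have hm : IsMetricAt G (Ψ (F' x)) := h.apply_eq ▸ h.target.metric
  rw [secondCoord, map_add, map_christoffel hm h.source.metric h.smooth_ambient h.metric_eq,
    h.fderiv_apply_eq, h.fderiv_apply_eq, h.apply_eq, secondCoord]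
  have h2 : fderiv ℝ Ψ (F' x) (fderiv ℝ (fderiv ℝ F') x v w) =
      fderiv ℝ (fderiv ℝ F) (φ x) (fderiv ℝ φ x v) (fderiv ℝ φ x w) +
        fderiv ℝ F (φ x) (fderiv ℝ (fderiv ℝ φ) x v w) -
        fderiv ℝ (fderiv ℝ Ψ) (F' x) (fderiv ℝ F' x v) (fderiv ℝ F' x w) := by
    rw [h1]
    abel
  rw [h2]
  abel

/-- The normal projection kills the tangential error of `map_secondCoord`. The second fundamental
form is thus a tensor, and its trace is independent of the coordinates. -/
theorem map_meanCurvCoord (h : IsChartChange G' F' G F φ Ψ x) :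
    fderiv ℝ Ψ (F' x) (meanCurvCoord G' F' x) = meanCurvCoord G F (φ x) := by
  have hL := map_metricTrace (fderiv ℝ Ψ (F' x) : Euc m →ₗ[ℝ] Euc m) (pullForm G' F' x)
    (fun v w => normalProj (G' (F' x)) (fderiv ℝ F' x) (secondCoord G' F' x v w))
  simp only [ContinuousLinearMap.coe_coe] at hL
  have hq : (fun v w => fderiv ℝ Ψ (F' x)
      (normalProj (G' (F' x)) (fderiv ℝ F' x) (secondCoord G' F' x v w))) =
      fun v w => normalSecondBilin G F (φ x) (fderiv ℝ φ x v) (fderiv ℝ φ x w) := by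
    funext v w
    rw [map_normalProj h.metric_apply_eq h.fderiv_comp_eq h.target.metric.symm
      h.source.det_ne_zero, h.map_secondCoord, normalProj_add,
      normalProj_map h.target.metric.symm h.target.det_ne_zero, add_zero]
    rfl
  rw [meanCurvCoord, hL, hq, h.pullForm_eq,
    metricTrace_bilinearComp _ _ (h.pullForm_eq ▸ h.source.det_ne_zero)]
  rfl

/-- Differentiating the transformation rule of the components of the field creates a second
derivative of `Ψ`, evaluated on the tangent vector and the field. The ambient Christoffel law
contains the same term with the opposite sign. -/
theorem map_covCoord (h : IsChartChange G' F' G F φ Ψ x) {W W' : Euc n → Euc m}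
    (hW : DifferentiableAt ℝ W (φ x))
    (hW' : DifferentiableAt ℝ W' x)
    (hWW : (fun y => fderiv ℝ Ψ (F' y) (W' y)) =ᶠ[𝓝 x] W ∘ φ) (v : Euc n) :
    fderiv ℝ Ψ (F' x) (covCoord G' F' W' x v) = covCoord G F W (φ x) (fderiv ℝ φ x v) := by
  have hD : HasFDerivAt (fderiv ℝ Ψ) (fderiv ℝ (fderiv ℝ Ψ) (F' x)) (F' x) :=
    ((contDiffAt_fderiv h.smooth_ambient).differentiableAt (by simp)).hasFDerivAt
  have hF' : HasFDerivAt F' (fderiv ℝ F' x) x :=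
    (h.source.smooth.differentiableAt (by simp)).hasFDerivAt
  have hDF : HasFDerivAt (fun y => fderiv ℝ Ψ (F' y)) _ x := hD.comp x hF'
  have h1 := DFunLike.congr_fun (hDF.clm_apply hW'.hasFDerivAt).fderiv v
  rw [hWW.fderiv_eq, fderiv_comp x hW (h.smooth.differentiableAt (by simp))] at h1
  simp only [ContinuousLinearMap.comp_apply, _root_.add_apply,
    ContinuousLinearMap.flip_apply] at h1
  have hm : IsMetricAt G (Ψ (F' x)) := h.apply_eq ▸ h.target.metric
  have h2 : fderiv ℝ Ψ (F' x) (W' x) = W (φ x) := hWW.eq_of_nhds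
  rw [covCoord, map_add, map_christoffel hm h.source.metric h.smooth_ambient h.metric_eq,
    h.fderiv_apply_eq, h.apply_eq, covCoord, h1, h2]
  abel

end IsChartChange

/-! ### Smoothness of the coordinate expressions -/

section Smooth

variable {n m : ℕ} {G : Euc m → BForm m} {F : Euc n → Euc m} {u : Euc n}

theorem contDiffAt_normalProj {E : Type*} [NormedAddCommGroup E] [NormedSpace ℝ E]
    {B : E → BForm m} {D : E → Euc n →L[ℝ] Euc m} {w : E → Euc m} {x : E}
    (hB : ContDiffAt ℝ ∞ B x) (hD : ContDiffAt ℝ ∞ D x) (hw : ContDiffAt ℝ ∞ w x)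
    (hdet : (gram ((B x).bilinearComp (D x) (D x))).det ≠ 0) :
    ContDiffAt ℝ ∞ (fun y => normalProj (B y) (D y) (w y)) x :=
  hw.sub (hD.clm_apply (contDiffAt_sharp (contDiffAt_bilinearComp hB hD) hdet
    ((hB.clm_apply hw).clm_comp hD)))

theorem IsImmersedAt.contDiffAt_meanCurvCoord (h : IsImmersedAt G F u) :
    ContDiffAt ℝ ∞ (meanCurvCoord G F) u := by
  have hD := contDiffAt_fderiv h.smooth
  refine contDiffAt_metricTrace (contDiffAt_pullForm h.metric.smooth h.smooth) h.det_ne_zero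
    fun v w => ?_
  refine contDiffAt_normalProj (h.metric.smooth.comp u h.smooth) hD ?_ h.det_ne_zero
  exact (((contDiffAt_fderiv hD).clm_apply contDiffAt_const).clm_apply contDiffAt_const).add
    (contDiffAt_christoffel h.metric h.smooth (hD.clm_apply contDiffAt_const)
      (hD.clm_apply contDiffAt_const))

theorem IsImmersedAt.contDiffAt_covCoord (h : IsImmersedAt G F u) {W : Euc n → Euc m}
    {V : Euc n → Euc n} (hW : ContDiffAt ℝ ∞ W u) (hV : ContDiffAt ℝ ∞ V u) :
    ContDiffAt ℝ ∞ (fun y => covCoord G F W y (V y)) u :=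
  ((contDiffAt_fderiv hW).clm_apply hV).add (contDiffAt_christoffel h.metric h.smooth
    ((contDiffAt_fderiv h.smooth).clm_apply hV) hW)

end Smooth

end QuasiLocal

end

noncomputable section

namespace QuasiLocal

set_option maxSynthPendingDepth 3

/-! ### Maps between manifolds in charts -/

section Charts

variable {n m : ℕ} {M M' : Type*} [TopologicalSpace M] [ChartedSpace (Euc n) M]
  [TopologicalSpace M'] [ChartedSpace (Euc m) M']

theorem tmap_comp_apply {k : ℕ} {M'' : Type*} [TopologicalSpace M''] [ChartedSpace (Euc k) M'']
    {f : M → M'} {h : M' → M''} {x : M}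
    (hh : MDifferentiableAt 𝓘(ℝ, Euc m) 𝓘(ℝ, Euc k) h (f x))
    (hf : MDifferentiableAt 𝓘(ℝ, Euc n) 𝓘(ℝ, Euc m) f x) (v : Euc n) :
    (tmap (m := n) (n := k) (h ∘ f) x v : Euc k) = tmap (m := m) (n := k) h (f x) (tmap (m := n) (n := m) f x v) :=
  mfderiv_comp_apply x hh hf v

theorem tmap_congr {f f' : M → M'} {x : M} (h : f =ᶠ[𝓝 x] f') (v : Euc n) :
    (tmap (m := n) (n := m) f x v : Euc m) = tmap (m := n) (n := m) f' x v :=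
  DFunLike.congr_fun (h.mfderiv_eq (I := 𝓘(ℝ, Euc n)) (I' := 𝓘(ℝ, Euc m))) v

theorem tmap_id_apply (x : M) (v : Euc n) : (tmap (m := n) (n := n) (id : M → M) x v : Euc n) = v :=
  DFunLike.congr_fun (mfderiv_id (I := 𝓘(ℝ, Euc n)) (x := x)) v

theorem tmap_eq_fderiv (f : Euc n → Euc m) (x : Euc n) (v : Euc n) :
    (tmap (m := n) (n := m) f x v : Euc m) = fderiv ℝ f x v :=
  DFunLike.congr_fun (mfderiv_eq_fderiv (𝕜 := ℝ) (f := f) (x := x)) v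

/-- The expression of `f` in the preferred charts at `p` and `y`. -/
def locRep (f : M → M') (p : M) (y : M') : Euc n → Euc m :=
  chartAt (Euc m) y ∘ f ∘ (chartAt (Euc n) p).symm

theorem locRep_chart {f : M → M'} {p q : M} {y : M'} (hq : q ∈ (chartAt (Euc n) p).source) :
    locRep (n := n) (m := m) f p y (chartAt (Euc n) p q) = chartAt (Euc m) y (f q) := by
  simp [locRep, hq]

theorem tmap_eq_fderiv_locRep {f : M → M'} {q : M}
    (h : MDifferentiableAt 𝓘(ℝ, Euc n) 𝓘(ℝ, Euc m) f q) (v : Euc n) :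
    (tmap (m := n) (n := m) f q v : Euc m) = fderiv ℝ (locRep (n := n) (m := m) f q (f q)) (chartAt (Euc n) q q) v := by
  rw [tmap, h.mfderiv]
  simp [writtenInExtChartAt, locRep]

theorem eventually_locRep_source {f : M → M'} {p : M} {y : M'} {z : Euc n}
    (hz : z ∈ (chartAt (Euc n) p).target)
    (hf : ContinuousAt f ((chartAt (Euc n) p).symm z))
    (hy : f ((chartAt (Euc n) p).symm z) ∈ (chartAt (Euc m) y).source) :
    ∀ᶠ z' in 𝓝 z, z' ∈ (chartAt (Euc n) p).target ∧
      f ((chartAt (Euc n) p).symm z') ∈ (chartAt (Euc m) y).source := by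
  refine Filter.Eventually.and ((chartAt (Euc n) p).open_target.mem_nhds hz) ?_
  have : ContinuousAt (fun z' => f ((chartAt (Euc n) p).symm z')) z :=
    hf.comp ((chartAt (Euc n) p).continuousAt_symm hz)
  exact this.eventually ((chartAt (Euc m) y).open_source.mem_nhds hy)

/-- The pull-back of a field of forms under a map between manifolds. -/
def pullField (g : FormField m M') (f : M → M') : FormField n M :=
  fun p => (g (f p)).bilinearComp (tmap (m := n) (n := m) f p) (tmap (m := n) (n := m) f p)

theorem coordMetric_apply (g : FormField n M) (p : M) (z v w : Euc n) :
    coordMetric g p z v w = g ((chartAt (Euc n) p).symm z)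
      (tmap (m := n) (n := n) (chartAt (Euc n) p).symm z v) (tmap (m := n) (n := n) (chartAt (Euc n) p).symm z w) := rfl

theorem pullField_id (g : FormField n M) : pullField (n := n) (m := n) g (id : M → M) = g := by
  funext p
  ext v w
  change g p (tmap (m := n) (n := n) (id : M → M) p v) (tmap (m := n) (n := n) (id : M → M) p w) = _
  rw [tmap_id_apply, tmap_id_apply]

variable [IsManifold 𝓘(ℝ, Euc n) ∞ M] [IsManifold 𝓘(ℝ, Euc m) ∞ M']

theorem contMDiffAt_chart {p q : M}
    (hq : q ∈ (chartAt (Euc n) p).source) :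
    ContMDiffAt 𝓘(ℝ, Euc n) 𝓘(ℝ, Euc n) ∞ (chartAt (Euc n) p) q :=
  contMDiffOn_chart.contMDiffAt ((chartAt (Euc n) p).open_source.mem_nhds hq)

theorem contMDiffAt_chart_symm {p : M} {z : Euc n} (hz : z ∈ (chartAt (Euc n) p).target) :
    ContMDiffAt 𝓘(ℝ, Euc n) 𝓘(ℝ, Euc n) ∞ (chartAt (Euc n) p).symm z :=
  contMDiffOn_chart_symm.contMDiffAt ((chartAt (Euc n) p).open_target.mem_nhds hz)

theorem contDiffAt_locRep {f : M → M'} {p : M} {y : M'} {z : Euc n}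
    (hz : z ∈ (chartAt (Euc n) p).target)
    (hf : ContMDiffAt 𝓘(ℝ, Euc n) 𝓘(ℝ, Euc m) ∞ f ((chartAt (Euc n) p).symm z))
    (hy : f ((chartAt (Euc n) p).symm z) ∈ (chartAt (Euc m) y).source) :
    ContDiffAt ℝ ∞ (locRep (n := n) (m := m) f p y) z := by
  rw [← contMDiffAt_iff_contDiffAt]
  exact (contMDiffAt_chart hy).comp z (hf.comp z (contMDiffAt_chart_symm hz))

theorem tmap_chart_symm_tmap_chart {p q : M} (hq : q ∈ (chartAt (Euc n) p).source) (v : Euc n) :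
    (tmap (m := n) (n := n) (chartAt (Euc n) p).symm (chartAt (Euc n) p q)
      (tmap (m := n) (n := n) (chartAt (Euc n) p) q v) : Euc n) = v := by
  have h := tmap_comp_apply (f := chartAt (Euc n) p) (h := (chartAt (Euc n) p).symm) (x := q)
    ((contMDiffAt_chart_symm ((chartAt (Euc n) p).map_source hq)).mdifferentiableAt (by simp))
    ((contMDiffAt_chart hq).mdifferentiableAt (by simp)) v
  rw [← h, tmap_congr (f' := id) _ v, tmap_id_apply]
  exact (chartAt (Euc n) p).eventually_left_inverse hq

theorem tmap_chart_tmap_chart_symm {p : M} {z : Euc n} (hz : z ∈ (chartAt (Euc n) p).target)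
    (v : Euc n) : (tmap (m := n) (n := n) (chartAt (Euc n) p) ((chartAt (Euc n) p).symm z)
      (tmap (m := n) (n := n) (chartAt (Euc n) p).symm z v) : Euc n) = v := by
  have h := tmap_comp_apply (f := (chartAt (Euc n) p).symm) (h := chartAt (Euc n) p) (x := z)
    ((contMDiffAt_chart ((chartAt (Euc n) p).map_target hz)).mdifferentiableAt (by simp))
    ((contMDiffAt_chart_symm hz).mdifferentiableAt (by simp)) v
  rw [← h, tmap_congr (f' := id) _ v, tmap_id_apply]
  exact (chartAt (Euc n) p).eventually_right_inverse hz

theorem fderiv_locRep {f : M → M'} {p : M} {y : M'} {z : Euc n}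
    (hz : z ∈ (chartAt (Euc n) p).target)
    (hf : ContMDiffAt 𝓘(ℝ, Euc n) 𝓘(ℝ, Euc m) ∞ f ((chartAt (Euc n) p).symm z))
    (hy : f ((chartAt (Euc n) p).symm z) ∈ (chartAt (Euc m) y).source) (v : Euc n) :
    fderiv ℝ (locRep (n := n) (m := m) f p y) z v =
      tmap (m := m) (n := m) (chartAt (Euc m) y) (f ((chartAt (Euc n) p).symm z))
        (tmap (m := n) (n := m) f ((chartAt (Euc n) p).symm z) (tmap (m := n) (n := n) (chartAt (Euc n) p).symm z v)) := by
  have h1 := (contMDiffAt_chart_symm hz).mdifferentiableAt (n := ∞) (by simp)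
  have h2 := hf.mdifferentiableAt (by simp)
  have h3 := tmap_comp_apply (f := f ∘ (chartAt (Euc n) p).symm) (h := chartAt (Euc m) y) (x := z)
    ((contMDiffAt_chart hy).mdifferentiableAt (by simp)) (h2.comp z h1) v
  rw [← tmap_eq_fderiv, locRep, h3, tmap_comp_apply h2 h1]
  rfl

/-- Tangent vectors at `q` are by definition component vectors in the chart at `q`, so the
differential of that chart is the identity. This lets pointwise definitions be read as coordinate
expressions. -/
theorem tmap_chart_self (q : M) (v : Euc n) : (tmap (m := n) (n := n) (chartAt (Euc n) q) q v : Euc n) = v := by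
  rw [tmap_eq_fderiv_locRep ((contMDiffAt_chart (mem_chart_source (Euc n) q)).mdifferentiableAt
    (by simp))]
  have : locRep (n := n) (m := n) (chartAt (Euc n) q) q (chartAt (Euc n) q q) =ᶠ[𝓝 (chartAt (Euc n) q q)] id := by
    filter_upwards [(chartAt (Euc n) q).open_target.mem_nhds (mem_chart_target (Euc n) q)]
      with z hz
    simp only [locRep, Function.comp_apply, id, (chartAt (Euc n) q).right_inv hz]
    rfl
  rw [this.fderiv_eq]
  simp

theorem fderiv_locRep_chart {f : M → M'} {p q : M} {y : M'}
    (hq : q ∈ (chartAt (Euc n) p).source) (hf : ContMDiffAt 𝓘(ℝ, Euc n) 𝓘(ℝ, Euc m) ∞ f q)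
    (hy : f q ∈ (chartAt (Euc m) y).source) (v : Euc n) :
    fderiv ℝ (locRep (n := n) (m := m) f p y) (chartAt (Euc n) p q) (tmap (m := n) (n := n) (chartAt (Euc n) p) q v) =
      tmap (m := m) (n := m) (chartAt (Euc m) y) (f q) (tmap (m := n) (n := m) f q v) := by
  have hz := (chartAt (Euc n) p).map_source hq
  have hl := (chartAt (Euc n) p).left_inv hq
  rw [fderiv_locRep hz (by rwa [hl]) (by rwa [hl]), tmap_chart_symm_tmap_chart hq, hl]

/-- The differential of a chart is the differential of the coordinate change to it from the
preferred chart. -/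
theorem fderiv_locRep_id {p q : M} (hq : q ∈ (chartAt (Euc n) p).source) (v : Euc n) :
    fderiv ℝ (locRep (n := n) (m := n) id q p) (chartAt (Euc n) q q) v = tmap (m := n) (n := n) (chartAt (Euc n) p) q v := by
  have h := fderiv_locRep_chart (f := (id : M → M)) (p := q) (q := q) (y := p)
    (mem_chart_source (Euc n) q) contMDiffAt_id hq v
  rwa [tmap_chart_self, tmap_id_apply] at h

theorem coordMetric_chart_apply (g : FormField n M) {p q : M}
    (hq : q ∈ (chartAt (Euc n) p).source) (v w : Euc n) :
    coordMetric g p (chartAt (Euc n) p q) (tmap (m := n) (n := n) (chartAt (Euc n) p) q v)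
      (tmap (m := n) (n := n) (chartAt (Euc n) p) q w) = g q v w := by
  rw [coordMetric_apply, tmap_chart_symm_tmap_chart hq, tmap_chart_symm_tmap_chart hq,
    (chartAt (Euc n) p).left_inv hq]

theorem coordMetric_self (g : FormField n M) (q : M) :
    coordMetric g q (chartAt (Euc n) q q) = g q := by
  ext v w
  have h := coordMetric_chart_apply g (mem_chart_source (Euc n) q) v w
  rwa [tmap_chart_self, tmap_chart_self] at h

theorem coordMetric_pullField (g : FormField m M') {f : M → M'} {p : M} {y : M'} {z : Euc n}
    (hz : z ∈ (chartAt (Euc n) p).target)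
    (hf : ContMDiffAt 𝓘(ℝ, Euc n) 𝓘(ℝ, Euc m) ∞ f ((chartAt (Euc n) p).symm z))
    (hy : f ((chartAt (Euc n) p).symm z) ∈ (chartAt (Euc m) y).source) :
    coordMetric (pullField (n := n) (m := m) g f) p z = pullForm (coordMetric g y) (locRep (n := n) (m := m) f p y) z := by
  ext v w
  rw [pullForm_apply, fderiv_locRep hz hf hy, fderiv_locRep hz hf hy]
  exact (coordMetric_chart_apply g hy _ _).symm

/-- A coordinate change is the local representative of the identity map, so the law for the
components of a form is a special case of the law for pull-backs. -/
theorem coordMetric_eq_pullForm (g : FormField n M) {p q : M} {z : Euc n}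
    (hz : z ∈ (chartAt (Euc n) q).target)
    (hp : (chartAt (Euc n) q).symm z ∈ (chartAt (Euc n) p).source) :
    coordMetric g q z = pullForm (coordMetric g p) (locRep (n := n) (m := n) id q p) z := by
  have h := coordMetric_pullField g (f := (id : M → M)) (y := p) hz contMDiffAt_id hp
  rwa [pullField_id] at h

/-- A smooth field of nondegenerate symmetric forms on a manifold. -/
structure IsSmoothForm (g : FormField n M) : Prop where
  symm : ∀ (x : M) (v w : Euc n), g x v w = g x w v
  det_ne_zero : ∀ x : M, (gram (g x)).det ≠ 0
  smooth : ∀ p : M, ContDiffOn ℝ ∞ (coordMetric g p) (chartAt (Euc n) p).target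

/-- The components are compared with those in the preferred chart of the point itself, where they
are `g`. The two Gram determinants differ by a squared Jacobian factor. -/
theorem det_gram_coordMetric_ne_zero {g : FormField n M} (hg : ∀ x : M, (gram (g x)).det ≠ 0)
    {p : M} {z : Euc n} (hz : z ∈ (chartAt (Euc n) p).target) :
    (gram (coordMetric g p z)).det ≠ 0 := by
  have hr := (chartAt (Euc n) p).map_target hz
  have h := coordMetric_eq_pullForm g (p := p) (q := (chartAt (Euc n) p).symm z)
    (mem_chart_target (Euc n) _) (by simpa using hr)
  rw [coordMetric_self] at h
  have h2 := det_ne_zero_of_pullForm (h ▸ hg _)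
  rwa [locRep_chart (mem_chart_source (Euc n) _), id, (chartAt (Euc n) p).right_inv hz] at h2

theorem IsSmoothForm.isMetricAt {g : FormField n M} (hg : IsSmoothForm g) {p : M} {z : Euc n}
    (hz : z ∈ (chartAt (Euc n) p).target) : IsMetricAt (coordMetric g p) z where
  smooth := (hg.smooth p).contDiffAt ((chartAt (Euc n) p).open_target.mem_nhds hz)
  symm _ _ := hg.symm _ _ _
  det_ne_zero := det_gram_coordMetric_ne_zero hg.det_ne_zero hz

theorem IsSmoothForm.pullField {g : FormField m M'} (hg : IsSmoothForm g) {f : M → M'}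
    (hf : ContMDiff 𝓘(ℝ, Euc n) 𝓘(ℝ, Euc m) ∞ f)
    (hdet : ∀ x : M, (gram (pullField (n := n) (m := m) g f x)).det ≠ 0) : IsSmoothForm (pullField (n := n) (m := m) g f) where
  symm _ _ _ := hg.symm _ _ _
  det_ne_zero := hdet
  smooth p := by
    intro z hz
    refine ContDiffAt.contDiffWithinAt ?_
    have hy := mem_chart_source (Euc m) (f ((chartAt (Euc n) p).symm z))
    have hev : coordMetric (QuasiLocal.pullField (n := n) (m := m) g f) p =ᶠ[𝓝 z]
        pullForm (coordMetric g (f ((chartAt (Euc n) p).symm z)))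
          (locRep (n := n) (m := m) f p (f ((chartAt (Euc n) p).symm z))) := by
      filter_upwards [eventually_locRep_source hz hf.continuous.continuousAt hy] with z' hz'
      exact coordMetric_pullField g hz'.1 hf.contMDiffAt hz'.2
    refine ContDiffAt.congr_of_eventuallyEq ?_ hev
    have hl := contDiffAt_locRep hz hf.contMDiffAt hy
    refine contDiffAt_pullForm (hg.isMetricAt ?_).smooth hl
    exact (chartAt (Euc m) _).map_source hy

theorem IsSmoothForm.isImmersedAt {g : FormField m M'} (hg : IsSmoothForm g) {f : M → M'}
    (hf : ContMDiff 𝓘(ℝ, Euc n) 𝓘(ℝ, Euc m) ∞ f)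
    (hdet : ∀ x : M, (gram (QuasiLocal.pullField (n := n) (m := m) g f x)).det ≠ 0) {p : M} {y : M'} {z : Euc n}
    (hz : z ∈ (chartAt (Euc n) p).target)
    (hy : f ((chartAt (Euc n) p).symm z) ∈ (chartAt (Euc m) y).source) :
    IsImmersedAt (coordMetric g y) (locRep (n := n) (m := m) f p y) z where
  metric := hg.isMetricAt ((chartAt (Euc m) y).map_source hy)
  smooth := contDiffAt_locRep hz hf.contMDiffAt hy
  det_ne_zero := by
    rw [← coordMetric_pullField g hz hf.contMDiffAt hy]
    exact det_gram_coordMetric_ne_zero hdet hz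

/-- Quantities at `q` are defined in the charts at `q` and `f q`, which jump with `q`. This compares
them with the fixed charts at `p` and `y`, in which dependence on `q` is visibly smooth. -/
theorem IsSmoothForm.isChartChange {g : FormField m M'} (hg : IsSmoothForm g) {f : M → M'}
    (hf : ContMDiff 𝓘(ℝ, Euc n) 𝓘(ℝ, Euc m) ∞ f)
    (hdet : ∀ x : M, (gram (QuasiLocal.pullField (n := n) (m := m) g f x)).det ≠ 0) {p q : M} {y : M'}
    (hq : q ∈ (chartAt (Euc n) p).source) (hy : f q ∈ (chartAt (Euc m) y).source) :
    IsChartChange (coordMetric g (f q)) (locRep (n := n) (m := m) f q (f q)) (coordMetric g y) (locRep (n := n) (m := m) f p y)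
      (locRep (n := n) (m := n) id q p) (locRep (n := m) (m := m) id (f q) y) (chartAt (Euc n) q q) := by
  have hqq := mem_chart_source (Euc n) q
  have hqt := mem_chart_target (Euc n) q
  have hl := (chartAt (Euc n) q).left_inv hqq
  have hfq := mem_chart_source (Euc m) (f q)
  refine ⟨hg.isImmersedAt hf hdet hqt (by rw [hl]; exact hfq), ?_, ?_, ?_, ?_, ?_⟩
  · rw [locRep_chart hqq, id]
    refine hg.isImmersedAt hf hdet ((chartAt (Euc n) p).map_source hq) ?_
    rwa [(chartAt (Euc n) p).left_inv hq]
  · exact contDiffAt_locRep hqt contMDiffAt_id (by rwa [hl])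
  · rw [locRep_chart hqq]
    refine contDiffAt_locRep (mem_chart_target (Euc m) _) contMDiffAt_id ?_
    rwa [(chartAt (Euc m) _).left_inv hfq]
  · rw [locRep_chart hqq]
    have hev := eventually_locRep_source (f := (id : M' → M')) (mem_chart_target (Euc m) (f q))
      continuousAt_id (y := y) (by rwa [(chartAt (Euc m) _).left_inv hfq])
    filter_upwards [hev] with z hz
    exact coordMetric_eq_pullForm g hz.1 hz.2
  · have h1 := eventually_locRep_source hqt hf.continuous.continuousAt (y := f q)
      (by rw [hl]; exact hfq)
    have h2 := eventually_locRep_source (f := (id : M → M)) hqt continuousAt_id (y := p)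
      (by rwa [hl])
    filter_upwards [h1, h2] with z hz1 hz2
    have h3 := (chartAt (Euc m) (f q)).left_inv hz1.2
    have h4 := (chartAt (Euc n) p).left_inv hz2.2
    simp only [locRep, Function.comp_apply, id] at h3 h4 ⊢
    rw [h3, h4]

end Charts

end QuasiLocal

end

noncomputable section

namespace QuasiLocal

set_option maxSynthPendingDepth 3

/-! ### Vector fields along maps -/

section Along

variable {n m : ℕ} {M M' : Type*} [TopologicalSpace M] [ChartedSpace (Euc n) M]
  [TopologicalSpace M'] [ChartedSpace (Euc m) M']

/-- The components of a vector field `W` along `f` in the preferred charts at `p` and `y`. -/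
def vecRep (f : M → M') (W : M → Euc m) (p : M) (y : M') (u : Euc n) : Euc m :=
  tmap (m := m) (n := m) (chartAt (Euc m) y) (f ((chartAt (Euc n) p).symm u))
    (W ((chartAt (Euc n) p).symm u))

theorem vecRep_chart {f : M → M'} {W : M → Euc m} {p q : M} {y : M'}
    (hq : q ∈ (chartAt (Euc n) p).source) :
    vecRep (n := n) f W p y (chartAt (Euc n) p q) =
      tmap (m := m) (n := m) (chartAt (Euc m) y) (f q) (W q) := by
  rw [vecRep, (chartAt (Euc n) p).left_inv hq]

/-- `W` is a smooth vector field along `f`. -/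
def IsSmoothAlong (n : ℕ) {m : ℕ} {M M' : Type*} [TopologicalSpace M] [ChartedSpace (Euc n) M]
    [TopologicalSpace M'] [ChartedSpace (Euc m) M'] (f : M → M') (W : M → Euc m) : Prop :=
  ∀ p : M, ContDiffAt ℝ ∞ (vecRep (n := n) f W p (f p)) (chartAt (Euc n) p p)

theorem tendsto_chart_symm (p : M) :
    Filter.Tendsto (chartAt (Euc n) p).symm (𝓝 (chartAt (Euc n) p p)) (𝓝 p) := by
  have h := (chartAt (Euc n) p).continuousAt_symm (mem_chart_target (Euc n) p)
  rwa [ContinuousAt, (chartAt (Euc n) p).left_inv (mem_chart_source (Euc n) p)] at h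

theorem eventually_mem_chart_source (p : M) : ∀ᶠ q in 𝓝 p, q ∈ (chartAt (Euc n) p).source :=
  (chartAt (Euc n) p).open_source.mem_nhds (mem_chart_source (Euc n) p)

theorem vecRep_congr {f : M → M'} {W : M → Euc m} {F : Euc n → Euc m} {p : M} {y : M'}
    (h : ∀ᶠ q in 𝓝 p, tmap (m := m) (n := m) (chartAt (Euc m) y) (f q) (W q) =
      F (chartAt (Euc n) p q)) :
    vecRep (n := n) f W p y =ᶠ[𝓝 (chartAt (Euc n) p p)] F := by
  filter_upwards [(tendsto_chart_symm p).eventually h,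
    (chartAt (Euc n) p).open_target.mem_nhds (mem_chart_target (Euc n) p)] with u hu hu'
  rw [vecRep, hu, (chartAt (Euc n) p).right_inv hu']

theorem IsSmoothAlong.sub {f : M → M'} {W W' : M → Euc m} (h : IsSmoothAlong n f W)
    (h' : IsSmoothAlong n f W') : IsSmoothAlong n f (fun q => W q - W' q) := fun p => by
  have := (h p).sub (h' p)
  refine this.congr_of_eventuallyEq (Filter.Eventually.of_forall fun u => ?_)
  simp [vecRep]

/-- This is the hypothesis on the components of a field that `IsChartChange.map_covCoord` requires;
it has to hold near the point because it is differentiated there. -/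
theorem vecRep_chartChange [IsManifold 𝓘(ℝ, Euc m) ∞ M'] {f : M → M'} (hf : Continuous f)
    (W : M → Euc m) {p q : M} {y : M'}
    (hq : q ∈ (chartAt (Euc n) p).source) (hy : f q ∈ (chartAt (Euc m) y).source) :
    (fun z => fderiv ℝ (locRep (n := m) (m := m) id (f q) y)
      (locRep (n := n) (m := m) f q (f q) z) (vecRep (n := n) f W q (f q) z))
      =ᶠ[𝓝 (chartAt (Euc n) q q)]
        vecRep (n := n) f W p y ∘ locRep (n := n) (m := n) id q p := by
  have hqq := mem_chart_source (Euc n) q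
  have hqt := mem_chart_target (Euc n) q
  have hl := (chartAt (Euc n) q).left_inv hqq
  have h1 := eventually_locRep_source hqt hf.continuousAt (y := f q)
    (by rw [hl]; exact mem_chart_source (Euc m) (f q))
  have h2 := eventually_locRep_source (f := (id : M → M)) hqt continuousAt_id (y := p)
    (by rwa [hl])
  have h3 := eventually_locRep_source hqt hf.continuousAt (y := y) (by rwa [hl])
  filter_upwards [h1, h2, h3] with z hz1 hz2 hz3
  have h4 : locRep (n := n) (m := n) id q p z =
    chartAt (Euc n) p ((chartAt (Euc n) q).symm z) := rfl
  rw [Function.comp_apply, h4, vecRep_chart (q := (chartAt (Euc n) q).symm z) hz2.2]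
  have h5 := fderiv_locRep_chart (f := (id : M' → M')) hz1.2 contMDiffAt_id hz3.2
    (W ((chartAt (Euc n) q).symm z))
  rwa [tmap_id_apply] at h5

variable [IsManifold 𝓘(ℝ, Euc n) ∞ M]

theorem contDiffAt_comp_chart_symm {V : Type*} [NormedAddCommGroup V] [NormedSpace ℝ V]
    {h : M → V} {p : M} {z : Euc n}
    (hz : z ∈ (chartAt (Euc n) p).target)
    (hh : ContMDiffAt 𝓘(ℝ, Euc n) 𝓘(ℝ, V) ∞ h ((chartAt (Euc n) p).symm z)) :
    ContDiffAt ℝ ∞ (h ∘ (chartAt (Euc n) p).symm) z := by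
  rw [← contMDiffAt_iff_contDiffAt]
  exact hh.comp z (contMDiffAt_chart_symm hz)

theorem contMDiffAt_of_eventuallyEq_comp_chart {V : Type*} [NormedAddCommGroup V]
    [NormedSpace ℝ V] {h : M → V} {p : M} {F : Euc n → V}
    (hF : ContDiffAt ℝ ∞ F (chartAt (Euc n) p p))
    (hh : ∀ᶠ q in 𝓝 p, h q = F (chartAt (Euc n) p q)) :
    ContMDiffAt 𝓘(ℝ, Euc n) 𝓘(ℝ, V) ∞ h p :=
  ((contMDiffAt_iff_contDiffAt.mpr hF).comp p
    (contMDiffAt_chart (mem_chart_source (Euc n) p))).congr_of_eventuallyEq hh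

theorem IsSmoothAlong.smul {f : M → M'} {W : M → Euc m} {k : M → ℝ} (h : IsSmoothAlong n f W)
    (hk : ContMDiff 𝓘(ℝ, Euc n) 𝓘(ℝ, ℝ) ∞ k) :
    IsSmoothAlong n f (fun q => k q • W q) := fun p => by
  have := (contDiffAt_comp_chart_symm (mem_chart_target (Euc n) p) hk.contMDiffAt).smul (h p)
  refine this.congr_of_eventuallyEq (Filter.Eventually.of_forall fun u => ?_)
  simp [vecRep]

variable [IsManifold 𝓘(ℝ, Euc m) ∞ M']

theorem IsSmoothForm.contMDiff_apply {g : FormField m M'} (hg : IsSmoothForm g) {f : M → M'}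
    (hf : ContMDiff 𝓘(ℝ, Euc n) 𝓘(ℝ, Euc m) ∞ f) {W W' : M → Euc m}
    (h : IsSmoothAlong n f W) (h' : IsSmoothAlong n f W') :
    ContMDiff 𝓘(ℝ, Euc n) 𝓘(ℝ, ℝ) ∞ (fun q => g (f q) (W q) (W' q)) := fun p => by
  have hp := mem_chart_source (Euc n) p
  have hl := (chartAt (Euc n) p).left_inv hp
  have hlr : ContDiffAt ℝ ∞ (locRep (n := n) (m := m) f p (f p)) (chartAt (Euc n) p p) :=
    contDiffAt_locRep (mem_chart_target (Euc n) p) hf.contMDiffAt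
      (by rw [hl]; exact mem_chart_source _ _)
  have hG : ContDiffAt ℝ ∞ (coordMetric g (f p))
      (locRep (n := n) (m := m) f p (f p) (chartAt (Euc n) p p)) := by
    rw [locRep_chart hp]
    exact (hg.isMetricAt (mem_chart_target (Euc m) _)).smooth
  refine contMDiffAt_of_eventuallyEq_comp_chart
    (((hG.comp _ hlr).clm_apply (h p)).clm_apply (h' p)) ?_
  filter_upwards [eventually_mem_chart_source (n := n) p,
    hf.continuous.continuousAt.eventually (eventually_mem_chart_source (n := m) (f p))] with q hq hq'
  rw [vecRep_chart hq, vecRep_chart hq, Function.comp_apply, locRep_chart hq,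
    coordMetric_chart_apply g hq']

end Along

/-! ### Functions on a surface -/

section Surface

variable {S : Type*} [TopologicalSpace S] [ChartedSpace (Euc 2) S]

theorem dFun_eq_fderiv {h : S → ℝ} {q : S} (hh : MDifferentiableAt 𝓘(ℝ, Euc 2) 𝓘(ℝ, ℝ) h q)
    (v : Euc 2) :
    dFun h q v = fderiv ℝ (h ∘ (chartAt (Euc 2) q).symm) (chartAt (Euc 2) q q) v := by
  rw [dFun, hh.mfderiv]
  simp [writtenInExtChartAt]
  rfl

theorem comp_chart_symm_eventuallyEq (h : S → ℝ) {p q : S}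
    (hq : q ∈ (chartAt (Euc 2) p).source) :
    h ∘ (chartAt (Euc 2) q).symm =ᶠ[𝓝 (chartAt (Euc 2) q q)]
      (h ∘ (chartAt (Euc 2) p).symm) ∘ locRep (n := 2) (m := 2) id q p := by
  have h2 := eventually_locRep_source (f := (id : S → S)) (mem_chart_target (Euc 2) q)
    continuousAt_id (y := p) (by rwa [(chartAt (Euc 2) q).left_inv (mem_chart_source (Euc 2) q)])
  filter_upwards [h2] with z hz
  have h4 := (chartAt (Euc 2) p).left_inv hz.2
  simp only [locRep, Function.comp_apply, id] at h4 ⊢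
  rw [h4]

variable {σ : FormField 2 S} {h k : S → ℝ}

theorem IsSmoothForm.apply_surfGrad (hσ : IsSmoothForm σ) (h : S → ℝ) (q : S) (v : Euc 2) :
    σ q (surfGrad σ h q) v = dFun h q v :=
  apply_sharp (hσ.det_ne_zero q) (hσ.symm q) _ _

variable [IsManifold 𝓘(ℝ, Euc 2) ∞ S]

theorem dFun_eq_fderiv_comp (hh : ContMDiff 𝓘(ℝ, Euc 2) 𝓘(ℝ, ℝ) ∞ h) {p q : S}
    (hq : q ∈ (chartAt (Euc 2) p).source) (v : Euc 2) :
    dFun h q v = fderiv ℝ (h ∘ (chartAt (Euc 2) p).symm) (chartAt (Euc 2) p q)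
      (tmap (m := 2) (n := 2) (chartAt (Euc 2) p) q v) := by
  have hqq := mem_chart_source (Euc 2) q
  rw [dFun_eq_fderiv (hh.contMDiffAt.mdifferentiableAt (by simp)),
    (comp_chart_symm_eventuallyEq h hq).fderiv_eq, fderiv_comp]
  · rw [ContinuousLinearMap.comp_apply, fderiv_locRep_id hq, locRep_chart hqq, id]
  · rw [locRep_chart hqq, id]
    exact (contDiffAt_comp_chart_symm ((chartAt (Euc 2) p).map_source hq)
      hh.contMDiffAt).differentiableAt (by simp)
  · refine (contDiffAt_locRep (mem_chart_target (Euc 2) q) contMDiffAt_id ?_).differentiableAt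
      (by simp)
    rwa [(chartAt (Euc 2) q).left_inv hqq]

theorem IsSmoothForm.tmap_surfGrad (hσ : IsSmoothForm σ)
    (hh : ContMDiff 𝓘(ℝ, Euc 2) 𝓘(ℝ, ℝ) ∞ h) {p q : S} (hq : q ∈ (chartAt (Euc 2) p).source) :
    (tmap (m := 2) (n := 2) (chartAt (Euc 2) p) q (surfGrad σ h q) : Euc 2) =
      sharp (coordMetric σ p (chartAt (Euc 2) p q))
        (fderiv ℝ (h ∘ (chartAt (Euc 2) p).symm) (chartAt (Euc 2) p q)) := by
  have h1 : (coordMetric σ p (chartAt (Euc 2) p q)).bilinearComp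
      (tmap (m := 2) (n := 2) (chartAt (Euc 2) p) q)
      (tmap (m := 2) (n := 2) (chartAt (Euc 2) p) q) = σ q := by
    ext v w
    exact coordMetric_chart_apply σ hq v w
  have h2 : dFun h q = (fderiv ℝ (h ∘ (chartAt (Euc 2) p).symm) (chartAt (Euc 2) p q)).comp
      (tmap (m := 2) (n := 2) (chartAt (Euc 2) p) q) := by
    ext v
    exact dFun_eq_fderiv_comp hh hq v
  rw [surfGrad, h2, ← h1]
  refine map_sharp_bilinearComp (B := coordMetric σ p (chartAt (Euc 2) p q))
    (A := tmap (m := 2) (n := 2) (chartAt (Euc 2) p) q) (fun v w => hσ.symm _ _ _) ?_ _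
  rw [h1]
  exact hσ.det_ne_zero q

theorem IsSmoothForm.isSmoothAlong_surfGrad (hσ : IsSmoothForm σ)
    (hh : ContMDiff 𝓘(ℝ, Euc 2) 𝓘(ℝ, ℝ) ∞ h) :
    IsSmoothAlong 2 (id : S → S) (fun q => surfGrad σ h q) := fun p => by
  have hm := hσ.isMetricAt (mem_chart_target (Euc 2) p)
  refine ContDiffAt.congr_of_eventuallyEq (contDiffAt_sharp hm.smooth hm.det_ne_zero
    (contDiffAt_fderiv (contDiffAt_comp_chart_symm (mem_chart_target (Euc 2) p)
      hh.contMDiffAt))) (vecRep_congr ?_)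
  filter_upwards [eventually_mem_chart_source (n := 2) p] with q hq
  exact hσ.tmap_surfGrad hh hq

/-- By duality `dk(∇h) = σ(∇k, ∇h)`, a pairing of two smooth vector fields. -/
theorem IsSmoothForm.contMDiff_dFun_surfGrad (hσ : IsSmoothForm σ)
    (hk : ContMDiff 𝓘(ℝ, Euc 2) 𝓘(ℝ, ℝ) ∞ k) (hh : ContMDiff 𝓘(ℝ, Euc 2) 𝓘(ℝ, ℝ) ∞ h) :
    ContMDiff 𝓘(ℝ, Euc 2) 𝓘(ℝ, ℝ) ∞ (fun q => dFun k q (surfGrad σ h q)) := by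
  have := hσ.contMDiff_apply contMDiff_id (hσ.isSmoothAlong_surfGrad hk)
    (hσ.isSmoothAlong_surfGrad hh)
  exact this.congr fun q => (hσ.apply_surfGrad k q _).symm

/-- The left side uses the chart at `q`, the right side a chart fixed for all nearby `q`;
`lapCoord_pullForm` for the coordinate change joins them. -/
theorem IsSmoothForm.laplacian_eq_lapCoord (hσ : IsSmoothForm σ)
    (hh : ContMDiff 𝓘(ℝ, Euc 2) 𝓘(ℝ, ℝ) ∞ h) {p q : S} (hq : q ∈ (chartAt (Euc 2) p).source) :
    laplacian σ h q = lapCoord (coordMetric σ p) (h ∘ (chartAt (Euc 2) p).symm)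
      (chartAt (Euc 2) p q) := by
  have hqq := mem_chart_source (Euc 2) q
  have hqt := mem_chart_target (Euc 2) q
  have h1 : laplacian σ h q = lapCoord (coordMetric σ q) (h ∘ (chartAt (Euc 2) q).symm)
      (chartAt (Euc 2) q q) := by
    rw [lapCoord, coordMetric_self]
    rfl
  have hx : locRep (n := 2) (m := 2) id q p (chartAt (Euc 2) q q) = chartAt (Euc 2) p q :=
    locRep_chart hqq
  have hqp : id ((chartAt (Euc 2) q).symm (chartAt (Euc 2) q q)) ∈ (chartAt (Euc 2) p).source := by
    rwa [(chartAt (Euc 2) q).left_inv hqq]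
  rw [h1, ← hx]
  refine lapCoord_pullForm ?_ (hσ.isMetricAt hqt) (contDiffAt_locRep hqt contMDiffAt_id hqp) ?_ ?_
    (comp_chart_symm_eventuallyEq h hq)
  · rw [hx]
    exact hσ.isMetricAt ((chartAt (Euc 2) p).map_source hq)
  · filter_upwards [eventually_locRep_source (f := (id : S → S)) hqt continuousAt_id hqp]
      with z hz
    exact coordMetric_eq_pullForm σ hz.1 hz.2
  · rw [hx]
    exact contDiffAt_comp_chart_symm ((chartAt (Euc 2) p).map_source hq) hh.contMDiffAt

theorem IsSmoothForm.contMDiff_laplacian (hσ : IsSmoothForm σ)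
    (hh : ContMDiff 𝓘(ℝ, Euc 2) 𝓘(ℝ, ℝ) ∞ h) :
    ContMDiff 𝓘(ℝ, Euc 2) 𝓘(ℝ, ℝ) ∞ (laplacian σ h) := fun p => by
  refine contMDiffAt_of_eventuallyEq_comp_chart (contDiffAt_lapCoord
    (hσ.isMetricAt (mem_chart_target (Euc 2) p))
    (contDiffAt_comp_chart_symm (mem_chart_target (Euc 2) p) hh.contMDiffAt)) ?_
  filter_upwards [eventually_mem_chart_source (n := 2) p] with q hq
  exact hσ.laplacian_eq_lapCoord hh hq

theorem dFun_lincomb (hh : ContMDiff 𝓘(ℝ, Euc 2) 𝓘(ℝ, ℝ) ∞ h)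
    (hk : ContMDiff 𝓘(ℝ, Euc 2) 𝓘(ℝ, ℝ) ∞ k) (a b : ℝ) (q : S) :
    dFun (fun x => a * h x + b * k x) q = a • dFun h q + b • dFun k q := by
  have hd := contDiffAt_comp_chart_symm (mem_chart_target (Euc 2) q) (hh.contMDiffAt)
  have kd := contDiffAt_comp_chart_symm (mem_chart_target (Euc 2) q) (hk.contMDiffAt)
  have hs : ContMDiff 𝓘(ℝ, Euc 2) 𝓘(ℝ, ℝ) ∞ (fun x => a * h x + b * k x) :=
    (contMDiff_const.mul hh).add (contMDiff_const.mul hk)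
  ext v
  rw [_root_.add_apply, _root_.smul_apply, _root_.smul_apply,
    dFun_eq_fderiv (hs.contMDiffAt.mdifferentiableAt (by simp)),
    dFun_eq_fderiv (hh.contMDiffAt.mdifferentiableAt (by simp)),
    dFun_eq_fderiv (hk.contMDiffAt.mdifferentiableAt (by simp))]
  have hdd := (hd.differentiableAt (by simp)).hasFDerivAt
  have kdd := (kd.differentiableAt (by simp)).hasFDerivAt
  have := ((hdd.const_mul a).add (kdd.const_mul b)).fderiv
  exact DFunLike.congr_fun this v

theorem surfGrad_lincomb (σ : FormField 2 S) (hh : ContMDiff 𝓘(ℝ, Euc 2) 𝓘(ℝ, ℝ) ∞ h)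
    (hk : ContMDiff 𝓘(ℝ, Euc 2) 𝓘(ℝ, ℝ) ∞ k) (a b : ℝ) (q : S) :
    surfGrad σ (fun x => a * h x + b * k x) q = a • surfGrad σ h q + b • surfGrad σ k q := by
  rw [surfGrad, dFun_lincomb hh hk, sharp_add, sharp_smul, sharp_smul]
  rfl

theorem laplacian_lincomb (σ : FormField 2 S) (hh : ContMDiff 𝓘(ℝ, Euc 2) 𝓘(ℝ, ℝ) ∞ h)
    (hk : ContMDiff 𝓘(ℝ, Euc 2) 𝓘(ℝ, ℝ) ∞ k) (a b : ℝ) (q : S) :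
    laplacian σ (fun x => a * h x + b * k x) q = a * laplacian σ h q + b * laplacian σ k q := by
  have hH : hessian σ (fun x => a * h x + b * k x) q =
      fun v w => a • hessian σ h q v w + b • hessian σ k q v w := by
    funext v w
    set c := (chartAt (Euc 2) q).symm with hc
    have hd : ∀ z ∈ (chartAt (Euc 2) q).target,
        fderiv ℝ ((fun x => a * h x + b * k x) ∘ c) z =
          a • fderiv ℝ (h ∘ c) z + b • fderiv ℝ (k ∘ c) z := by
      intro z hz
      have h1 := (contDiffAt_comp_chart_symm hz hh.contMDiffAt).differentiableAt (by simp)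
      have h2 := (contDiffAt_comp_chart_symm hz hk.contMDiffAt).differentiableAt (by simp)
      exact ((h1.hasFDerivAt.const_mul a).add (h2.hasFDerivAt.const_mul b)).fderiv
    have hqt := mem_chart_target (Euc 2) q
    have hev : fderiv ℝ ((fun x => a * h x + b * k x) ∘ c) =ᶠ[𝓝 (chartAt (Euc 2) q q)]
        fun z => a • fderiv ℝ (h ∘ c) z + b • fderiv ℝ (k ∘ c) z := by
      filter_upwards [(chartAt (Euc 2) q).open_target.mem_nhds hqt] with z hz
      exact hd z hz
    have h1 := (contDiffAt_fderiv (contDiffAt_comp_chart_symm hqt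
      hh.contMDiffAt)).differentiableAt (by simp)
    have h2 := (contDiffAt_fderiv (contDiffAt_comp_chart_symm hqt
      hk.contMDiffAt)).differentiableAt (by simp)
    have h3 := ((h1.hasFDerivAt.const_smul a).add (h2.hasFDerivAt.const_smul b)).fderiv
    have h4 := hev.fderiv_eq.trans h3
    simp only [hessian, ← hc, h4, hd _ hqt, _root_.add_apply, _root_.smul_apply, smul_eq_mul]
    ring
  rw [laplacian, hH, metricTrace_add, metricTrace_smul, metricTrace_smul]
  rfl

end Surface

end QuasiLocal

end

noncomputable section

namespace QuasiLocal

set_option maxSynthPendingDepth 3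
set_option linter.unusedSectionVars false

/-! ### Mean curvature and connection form in charts -/

theorem LorentzMetric.isSmoothForm {N : Type*} [TopologicalSpace N] [ChartedSpace (Euc 4) N]
    (g : LorentzMetric N) : IsSmoothForm g.form where
  symm := g.symm
  det_ne_zero x := gram_det_ne_zero fun v hv => by
    obtain ⟨t, -, ht⟩ := g.lorentz x
    by_contra hne
    have h1 : g.form x t v = 0 := (g.symm x t v).trans (hv t)
    exact (ht v h1 hne).ne' (hv v)
  smooth := g.smooth

/-- In a Lorentz four-space, a null vector normal to a spacelike plane is not orthogonal to a
spacelike vector normal to the plane. -/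
theorem apply_ne_zero_of_null {B : BForm 4} (hsymm : ∀ v w, B v w = B w v)
    {t : Euc 4} (ht : B t t < 0) {D : Euc 2 →L[ℝ] Euc 4} (hD : ∀ v, v ≠ 0 → 0 < B (D v) (D v))
    {H l : Euc 4} (hH : 0 < B H H) (hHD : ∀ v, B H (D v) = 0) (hl : l ≠ 0) (hll : B l l = 0)
    (hlD : ∀ v, B l (D v) = 0) : B H l ≠ 0 := by
  intro h0
  -- If `B H l = 0`, then `H`, `l` and the plane are mutually orthogonal and together span a
  -- subspace on which `B` is nonnegative. The map `Φ` parametrizes this span. It is injective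
  -- between four-dimensional spaces, so the timelike vector `t` would lie in its range.
  let Φ : (ℝ × ℝ × Euc 2) →ₗ[ℝ] Euc 4 :=
    { toFun := fun x => x.1 • H + x.2.1 • l + D x.2.2
      map_add' := fun x y => by
        simp only [Prod.fst_add, Prod.snd_add, add_smul, map_add]
        abel
      map_smul' := fun c x => by
        simp only [Prod.smul_fst, Prod.smul_snd, smul_eq_mul, map_smul, smul_add, mul_smul,
          RingHom.id_apply] }
  have hΦ : ∀ x, Φ x = x.1 • H + x.2.1 • l + D x.2.2 := fun x => rfl
  have hB : ∀ x, B (Φ x) (Φ x) = x.1 ^ 2 * B H H + B (D x.2.2) (D x.2.2) := by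
    intro x
    have h1 : B l H = 0 := (hsymm l H).trans h0
    have h2 : B (D x.2.2) H = 0 := (hsymm _ H).trans (hHD _)
    have h3 : B (D x.2.2) l = 0 := (hsymm _ l).trans (hlD _)
    simp only [hΦ, map_add, map_smul, _root_.add_apply, _root_.smul_apply, smul_eq_mul, h0, h1, h2,
      h3, hll, hHD, hlD]
    ring
  have hnn : ∀ v, 0 ≤ B (D v) (D v) := by
    intro v
    by_cases hv : v = 0
    · simp [hv]
    · exact (hD v hv).le
  have hinj : Function.Injective Φ := by
    rw [← LinearMap.ker_eq_bot, LinearMap.ker_eq_bot']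
    intro x hx
    have h1 := hB x
    rw [hx] at h1
    simp only [map_zero] at h1
    have h2 : 0 ≤ x.1 ^ 2 * B H H := mul_nonneg (sq_nonneg _) hH.le
    have h3 : x.1 ^ 2 * B H H = 0 := by linarith [hnn x.2.2]
    have h4 : B (D x.2.2) (D x.2.2) = 0 := by linarith [hnn x.2.2]
    have h5 : x.1 = 0 := by
      rcases mul_eq_zero.mp h3 with h | h
      · exact pow_eq_zero_iff (two_ne_zero) |>.mp h
      · exact absurd h hH.ne'
    have h6 : x.2.2 = 0 := by
      by_contra hne
      exact (hD _ hne).ne' h4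
    have h7 : x.2.1 • l = 0 := by
      have := hΦ x
      rw [hx, h5, h6] at this
      simpa using this.symm
    have h8 : x.2.1 = 0 := (smul_eq_zero.mp h7).resolve_right hl
    exact Prod.ext h5 (Prod.ext h8 h6)
  have hsurj : Function.Surjective Φ := by
    refine (LinearMap.injective_iff_surjective_of_finrank_eq_finrank ?_).mp hinj
    simp
  obtain ⟨x, rfl⟩ := hsurj t
  rw [hB] at ht
  linarith [hnn x.2.2, mul_nonneg (sq_nonneg x.1) hH.le]

section Surface

variable {S : Type*} [TopologicalSpace S] [ChartedSpace (Euc 2) S]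
  {N : Type*} [TopologicalSpace N] [ChartedSpace (Euc 4) N]
  {g : LorentzMetric N} {ι : S → N}

theorem IsSpacelike.det_ne_zero (h : IsSpacelike g ι) (x : S) :
    (gram (pullField (n := 2) (m := 4) g.form ι x)).det ≠ 0 :=
  gram_det_ne_zero_of_pos (h x)

variable [IsManifold 𝓘(ℝ, Euc 2) ∞ S] [IsManifold 𝓘(ℝ, Euc 4) ∞ N]

theorem IsSpacelike.isSmoothForm (h : IsSpacelike g ι)
    (hι : ContMDiff 𝓘(ℝ, Euc 2) 𝓘(ℝ, Euc 4) ∞ ι) : IsSmoothForm (inducedMetric g ι) :=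
  g.isSmoothForm.pullField hι h.det_ne_zero

theorem tmap_eq_fderiv_locRep_clm (hι : ContMDiff 𝓘(ℝ, Euc 2) 𝓘(ℝ, Euc 4) ∞ ι) (q : S) :
    (tmap (m := 2) (n := 4) ι q : Euc 2 →L[ℝ] Euc 4) =
      fderiv ℝ (locRep (n := 2) (m := 4) ι q (ι q)) (chartAt (Euc 2) q q) := by
  ext1 v
  exact tmap_eq_fderiv_locRep (hι.contMDiffAt.mdifferentiableAt (by simp)) v

theorem form_eq_coordMetric_locRep (g : LorentzMetric N) (ι : S → N) (q : S) :
    (g.form (ι q) : BForm 4) = coordMetric g.form (ι q)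
      (locRep (n := 2) (m := 4) ι q (ι q) (chartAt (Euc 2) q q)) := by
  rw [locRep_chart (mem_chart_source (Euc 2) q), coordMetric_self]

theorem meanCurv_eq_meanCurvCoord (hι : ContMDiff 𝓘(ℝ, Euc 2) 𝓘(ℝ, Euc 4) ∞ ι) (q : S) :
    (meanCurv g ι q : Euc 4) = meanCurvCoord (coordMetric g.form (ι q))
      (locRep (n := 2) (m := 4) ι q (ι q)) (chartAt (Euc 2) q q) := by
  have hl := (chartAt (Euc 2) q).left_inv (mem_chart_source (Euc 2) q)
  have h1 : inducedMetric g ι q = pullForm (coordMetric g.form (ι q))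
      (locRep (n := 2) (m := 4) ι q (ι q)) (chartAt (Euc 2) q q) := by
    rw [← coordMetric_pullField g.form (mem_chart_target (Euc 2) q) hι.contMDiffAt
      (by rw [hl]; exact mem_chart_source (Euc 4) (ι q)), coordMetric_self]
    rfl
  rw [meanCurv, meanCurvCoord, h1]
  congr 1
  funext v w
  have h2 : (secondDeriv g ι q v w : Euc 4) = secondCoord (coordMetric g.form (ι q))
      (locRep (n := 2) (m := 4) ι q (ι q)) (chartAt (Euc 2) q q) v w := by
    rw [secondCoord, ← tmap_eq_fderiv_locRep_clm hι, locRep_chart (mem_chart_source (Euc 2) q)]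
    rfl
  rw [← h2, ← tmap_eq_fderiv_locRep_clm hι, ← form_eq_coordMetric_locRep]
  rfl

theorem IsSpacelike.isChartChange (h : IsSpacelike g ι)
    (hι : ContMDiff 𝓘(ℝ, Euc 2) 𝓘(ℝ, Euc 4) ∞ ι) {p q : S} {y : N}
    (hq : q ∈ (chartAt (Euc 2) p).source) (hy : ι q ∈ (chartAt (Euc 4) y).source) :
    IsChartChange (coordMetric g.form (ι q)) (locRep (n := 2) (m := 4) ι q (ι q))
      (coordMetric g.form y) (locRep (n := 2) (m := 4) ι p y)
      (locRep (n := 2) (m := 2) id q p) (locRep (n := 4) (m := 4) id (ι q) y)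
      (chartAt (Euc 2) q q) :=
  g.isSmoothForm.isChartChange hι h.det_ne_zero hq hy

theorem fderiv_locRep_ambient (ι : S → N) {q : S} {y : N}
    (hy : ι q ∈ (chartAt (Euc 4) y).source) (w : Euc 4) :
    fderiv ℝ (locRep (n := 4) (m := 4) id (ι q) y)
      (locRep (n := 2) (m := 4) ι q (ι q) (chartAt (Euc 2) q q)) w =
      tmap (m := 4) (n := 4) (chartAt (Euc 4) y) (ι q) w := by
  rw [locRep_chart (mem_chart_source (Euc 2) q), fderiv_locRep_id hy]

theorem IsSpacelike.tmap_meanCurv (h : IsSpacelike g ι)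
    (hι : ContMDiff 𝓘(ℝ, Euc 2) 𝓘(ℝ, Euc 4) ∞ ι) {p q : S} {y : N}
    (hq : q ∈ (chartAt (Euc 2) p).source) (hy : ι q ∈ (chartAt (Euc 4) y).source) :
    (tmap (m := 4) (n := 4) (chartAt (Euc 4) y) (ι q) (meanCurv g ι q) : Euc 4) =
      meanCurvCoord (coordMetric g.form y) (locRep (n := 2) (m := 4) ι p y)
        (chartAt (Euc 2) p q) := by
  have hx := (h.isChartChange hι hq hy).map_meanCurvCoord
  rw [fderiv_locRep_ambient ι hy, locRep_chart (mem_chart_source (Euc 2) q), id] at hx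
  rw [meanCurv_eq_meanCurvCoord hι, hx]

theorem IsSpacelike.isSmoothAlong_meanCurv (h : IsSpacelike g ι)
    (hι : ContMDiff 𝓘(ℝ, Euc 2) 𝓘(ℝ, Euc 4) ∞ ι) :
    IsSmoothAlong 2 ι (meanCurv g ι) := fun p => by
  have hl := (chartAt (Euc 2) p).left_inv (mem_chart_source (Euc 2) p)
  have him := g.isSmoothForm.isImmersedAt hι h.det_ne_zero (mem_chart_target (Euc 2) p)
    (y := ι p) (by rw [hl]; exact mem_chart_source (Euc 4) (ι p))
  refine him.contDiffAt_meanCurvCoord.congr_of_eventuallyEq (vecRep_congr ?_)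
  filter_upwards [eventually_mem_chart_source (n := 2) p,
    hι.continuous.continuousAt.eventually (eventually_mem_chart_source (n := 4) (ι p))] with q hq hq'
  exact h.tmap_meanCurv hι hq hq'

/-- Smoothness as a map into the tangent bundle is smoothness of the fibre component in the
trivialization at `ι p`. That trivialization acts by the differential of the coordinate change to
the chart at `ι p`, which is what `vecRep` uses. -/
theorem IsNullNormal.isSmoothAlong {ℓ : ∀ p : S, Tan 4 (ι p)} (h : IsNullNormal g ι ℓ)
    (hι : ContMDiff 𝓘(ℝ, Euc 2) 𝓘(ℝ, Euc 4) ∞ ι) : IsSmoothAlong 2 ι ℓ := fun p => by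
  have h1 := (Bundle.contMDiffAt_totalSpace.mp (h.smooth p)).2
  have h2 := contDiffAt_comp_chart_symm (mem_chart_target (Euc 2) p)
    (by rw [(chartAt (Euc 2) p).left_inv (mem_chart_source (Euc 2) p)]; exact h1)
  refine h2.congr_of_eventuallyEq (vecRep_congr ?_)
  filter_upwards [eventually_mem_chart_source (n := 2) p,
    hι.continuous.continuousAt.eventually (eventually_mem_chart_source (n := 4) (ι p))] with q hq hq'
  rw [Function.comp_apply, (chartAt (Euc 2) p).left_inv hq, TangentBundle.trivializationAt_apply]
  rw [← fderiv_locRep_id hq']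
  simp [locRep]

theorem IsSpacelike.tmap_covDerivAlong (h : IsSpacelike g ι)
    (hι : ContMDiff 𝓘(ℝ, Euc 2) 𝓘(ℝ, Euc 4) ∞ ι) {W : S → Euc 4} (hW : IsSmoothAlong 2 ι W)
    {p q : S} {y : N} (hq : q ∈ (chartAt (Euc 2) p).source)
    (hy : ι q ∈ (chartAt (Euc 4) y).source)
    (hd : DifferentiableAt ℝ (vecRep (n := 2) ι W p y) (chartAt (Euc 2) p q)) (v : Euc 2) :
    (tmap (m := 4) (n := 4) (chartAt (Euc 4) y) (ι q) (covDerivAlong g ι W q v) : Euc 4) =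
      covCoord (coordMetric g.form y) (locRep (n := 2) (m := 4) ι p y)
        (vecRep (n := 2) ι W p y) (chartAt (Euc 2) p q)
        (tmap (m := 2) (n := 2) (chartAt (Euc 2) p) q v) := by
  have hqq := mem_chart_source (Euc 2) q
  have hx : locRep (n := 2) (m := 2) id q p (chartAt (Euc 2) q q) = chartAt (Euc 2) p q :=
    locRep_chart hqq
  have h1 : (covDerivAlong g ι W q v : Euc 4) = covCoord (coordMetric g.form (ι q))
      (locRep (n := 2) (m := 4) ι q (ι q)) (vecRep (n := 2) ι W q (ι q))
      (chartAt (Euc 2) q q) v := by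
    rw [covCoord, vecRep_chart hqq, tmap_chart_self, locRep_chart hqq,
      ← tmap_eq_fderiv_locRep_clm hι]
    rfl
  have h2 := (h.isChartChange hι hq hy).map_covCoord (W := vecRep (n := 2) ι W p y)
    (W' := vecRep (n := 2) ι W q (ι q)) (by rwa [hx])
    ((hW q).differentiableAt (by simp)) (vecRep_chartChange hι.continuous W hq hy) v
  rw [fderiv_locRep_ambient ι hy, hx, fderiv_locRep_id hq] at h2
  rw [h1, h2]

theorem IsSpacelike.isSmoothAlong_covDerivAlong (h : IsSpacelike g ι)
    (hι : ContMDiff 𝓘(ℝ, Euc 2) 𝓘(ℝ, Euc 4) ∞ ι) {W : S → Euc 4} (hW : IsSmoothAlong 2 ι W)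
    {V : S → Euc 2} (hV : IsSmoothAlong 2 (id : S → S) V) :
    IsSmoothAlong 2 ι (fun q => covDerivAlong g ι W q (V q)) := fun p => by
  have hl := (chartAt (Euc 2) p).left_inv (mem_chart_source (Euc 2) p)
  have him := g.isSmoothForm.isImmersedAt hι h.det_ne_zero (mem_chart_target (Euc 2) p)
    (y := ι p) (by rw [hl]; exact mem_chart_source (Euc 4) (ι p))
  refine (him.contDiffAt_covCoord (hW p) (hV p)).congr_of_eventuallyEq (vecRep_congr ?_)
  have hd : ∀ᶠ u in 𝓝 (chartAt (Euc 2) p p), ContDiffAt ℝ 1 (vecRep (n := 2) ι W p (ι p)) u :=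
    ((hW p).of_le (by norm_cast)).eventually (by decide)
  have hc := (chartAt (Euc 2) p).continuousAt (mem_chart_source (Euc 2) p)
  filter_upwards [eventually_mem_chart_source (n := 2) p, hc.eventually hd,
    hι.continuous.continuousAt.eventually (eventually_mem_chart_source (n := 4) (ι p))]
    with q hq hdq hq'
  rw [h.tmap_covDerivAlong hι hW hq hq' (hdq.differentiableAt (by simp)), vecRep_chart hq]
  rfl

theorem covDerivAlong_lincomb (g : LorentzMetric N) (ι : S → N) (W : S → Euc 4) (q : S)
    (a b : ℝ) (v w : Euc 2) :
    (covDerivAlong g ι W q (a • v + b • w) : Euc 4) =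
      a • covDerivAlong g ι W q v + b • covDerivAlong g ι W q w := by
  let G := coordMetric g.form (ι q)
  let z := chartAt (Euc 4) (ι q) (ι q)
  let L := fderiv ℝ (fun u : Euc 2 => (tmap (m := 4) (n := 4) (chartAt (Euc 4) (ι q))
    (ι ((chartAt (Euc 2) q).symm u)) (W ((chartAt (Euc 2) q).symm u)) : Euc 4))
    (chartAt (Euc 2) q q)
  have h0 : ∀ x : Euc 2, (covDerivAlong g ι W q x : Euc 4) =
      L x + christoffelBilin G z (tmap (m := 2) (n := 4) ι q x) (W q) := fun x => rfl
  rw [h0, h0, h0, map_add L, map_smul L, map_smul L, map_add (tmap (m := 2) (n := 4) ι q),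
    map_smul (tmap (m := 2) (n := 4) ι q), map_smul (tmap (m := 2) (n := 4) ι q),
    map_add (christoffelBilin G z), map_smul (christoffelBilin G z),
    map_smul (christoffelBilin G z), LinearMap.add_apply, LinearMap.smul_apply,
    LinearMap.smul_apply, smul_add, smul_add]
  abel

/-! ### The data of a surface -/

theorem contMDiff_normSq_meanCurv (h : IsSpacelike g ι)
    (hι : ContMDiff 𝓘(ℝ, Euc 2) 𝓘(ℝ, Euc 4) ∞ ι) :
    ContMDiff 𝓘(ℝ, Euc 2) 𝓘(ℝ, ℝ) ∞
      (fun q => g.form (ι q) (meanCurv g ι q) (meanCurv g ι q)) :=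
  g.isSmoothForm.contMDiff_apply hι (h.isSmoothAlong_meanCurv hι) (h.isSmoothAlong_meanCurv hι)

theorem normMeanCurv_pos (hH : HasSpacelikeMeanCurv g ι) (q : S) : 0 < normMeanCurv g ι q :=
  Real.sqrt_pos.mpr (hH q)

theorem contMDiff_normMeanCurv (h : IsSpacelike g ι)
    (hι : ContMDiff 𝓘(ℝ, Euc 2) 𝓘(ℝ, Euc 4) ∞ ι) (hH : HasSpacelikeMeanCurv g ι) :
    ContMDiff 𝓘(ℝ, Euc 2) 𝓘(ℝ, ℝ) ∞ (normMeanCurv g ι) := fun q =>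
  (contMDiffAt_iff_contDiffAt.mpr (Real.contDiffAt_sqrt (hH q).ne')).comp q
    (contMDiff_normSq_meanCurv h hι q)

/-- This is the denominator in the formula for `J`, so its non-vanishing is what makes `J` smooth.
The mean curvature vector is normal because it is a trace of normal vectors, and the Lorentzian
linear algebra then applies. -/
theorem form_meanCurv_null_ne_zero (h : IsSpacelike g ι)
    (hH : HasSpacelikeMeanCurv g ι) {ℓ : ∀ p : S, Tan 4 (ι p)} (hℓ : IsNullNormal g ι ℓ) (q : S) :
    g.form (ι q) (meanCurv g ι q) (ℓ q) ≠ 0 := by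
  obtain ⟨t, ht, -⟩ := g.lorentz (ι q)
  refine apply_ne_zero_of_null (g.symm (ι q)) ht (D := tmap (m := 2) (n := 4) ι q) (h q) (hH q) ?_
    (hℓ.ne_zero q) (hℓ.null q) (hℓ.normal q)
  intro v
  have h1 : ∀ w, g.form (ι q) (normalPart g ι q w) (tmap (m := 2) (n := 4) ι q v) = 0 :=
    fun w => apply_normalProj (g.symm (ι q)) (h.det_ne_zero q) w v
  have h2 := map_metricTrace ((g.form (ι q)).flip (tmap (m := 2) (n := 4) ι q v) : Euc 4 →ₗ[ℝ] ℝ)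
    (inducedMetric g ι q) (secondFundForm g ι q)
  refine h2.trans ?_
  refine Finset.sum_eq_zero fun a _ => Finset.sum_eq_zero fun b _ => ?_
  rw [smul_eq_mul]
  exact mul_eq_zero_of_right _ (h1 _)

theorem isSmoothAlong_normalized_reflected (h : IsSpacelike g ι)
    (hι : ContMDiff 𝓘(ℝ, Euc 2) 𝓘(ℝ, Euc 4) ∞ ι) (hH : HasSpacelikeMeanCurv g ι)
    {ℓ : ∀ p : S, Tan 4 (ι p)} (hℓ : IsNullNormal g ι ℓ) :
    IsSmoothAlong 2 ι
      (fun q => (normMeanCurv g ι q)⁻¹ • reflectedMeanCurv g ι ℓ q : S → Euc 4) := by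
  have hHs := h.isSmoothAlong_meanCurv hι
  have hls := hℓ.isSmoothAlong hι
  have hHl := g.isSmoothForm.contMDiff_apply hι hHs hls
  have hk : ContMDiff 𝓘(ℝ, Euc 2) 𝓘(ℝ, ℝ) ∞ (fun q => g.form (ι q) (meanCurv g ι q)
      (meanCurv g ι q) / g.form (ι q) (meanCurv g ι q) (ℓ q)) :=
    (contMDiff_normSq_meanCurv h hι).div₀ hHl (form_meanCurv_null_ne_zero h hH hℓ)
  have hn : ContMDiff 𝓘(ℝ, Euc 2) 𝓘(ℝ, ℝ) ∞ (fun q => (normMeanCurv g ι q)⁻¹) :=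
    (contMDiff_normMeanCurv h hι hH).inv₀ fun q => (normMeanCurv_pos hH q).ne'
  exact ((hls.smul hk).sub hHs).smul hn

theorem contMDiff_connectionForm (h : IsSpacelike g ι)
    (hι : ContMDiff 𝓘(ℝ, Euc 2) 𝓘(ℝ, Euc 4) ∞ ι) (hH : HasSpacelikeMeanCurv g ι)
    {ℓ : ∀ p : S, Tan 4 (ι p)} (hℓ : IsNullNormal g ι ℓ) {V : S → Euc 2}
    (hV : IsSmoothAlong 2 (id : S → S) V) :
    ContMDiff 𝓘(ℝ, Euc 2) 𝓘(ℝ, ℝ) ∞ (fun q => connectionForm g ι ℓ q (V q)) := by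
  have hn : ContMDiff 𝓘(ℝ, Euc 2) 𝓘(ℝ, ℝ) ∞ (fun q => (normMeanCurv g ι q)⁻¹) :=
    (contMDiff_normMeanCurv h hι hH).inv₀ fun q => (normMeanCurv_pos hH q).ne'
  exact g.isSmoothForm.contMDiff_apply hι (h.isSmoothAlong_covDerivAlong hι
    (isSmoothAlong_normalized_reflected h hι hH hℓ) hV) ((h.isSmoothAlong_meanCurv hι).smul hn)

theorem connectionForm_lincomb (g : LorentzMetric N) (ι : S → N) (ℓ : ∀ p : S, Tan 4 (ι p))
    (q : S) (a b : ℝ) (v w : Euc 2) :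
    connectionForm g ι ℓ q (a • v + b • w) =
      a * connectionForm g ι ℓ q v + b * connectionForm g ι ℓ q w := by
  let L : Euc 4 →L[ℝ] ℝ := (g.form (ι q)).flip ((normMeanCurv g ι q)⁻¹ • meanCurv g ι q)
  have h0 : ∀ x : Euc 2, connectionForm g ι ℓ q x = L (covDerivAlong g ι
      (fun q => (normMeanCurv g ι q)⁻¹ • reflectedMeanCurv g ι ℓ q) q x) := fun x => rfl
  rw [h0, h0, h0, ← smul_eq_mul, ← smul_eq_mul, ← map_smul L, ← map_smul L, ← map_add L]
  exact congrArg L (covDerivAlong_lincomb g ι _ q a b v w)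

end Surface

end QuasiLocal

end

noncomputable section

namespace QuasiLocal

set_option maxSynthPendingDepth 3

/-! ### The area measure -/

section Measure

/-- A smooth field of forms is a Riemannian metric. -/
structure IsRiemannian {n : ℕ} {M : Type*} [TopologicalSpace M] [ChartedSpace (Euc n) M]
    (σ : FormField n M) : Prop extends IsSmoothForm σ where
  pos : ∀ (x : M) (v : Euc n), v ≠ 0 → 0 < σ x v v

variable {S : Type*} [TopologicalSpace S] [ChartedSpace (Euc 2) S]
  {σ : FormField 2 S}

/-- The density `√(det σ_{ab})` in the preferred chart at `p`. -/
def areaDensity (σ : FormField 2 S) (p : S) (u : Euc 2) : ℝ :=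
  Real.sqrt (gram (coordMetric σ p u)).det

theorem continuousOn_areaDensity (hσ : IsSmoothForm σ) (p : S) :
    ContinuousOn (areaDensity σ p) (chartAt (Euc 2) p).target := by
  intro u hu
  have h := (hσ.smooth p).contDiffAt ((chartAt (Euc 2) p).open_target.mem_nhds hu)
  exact ((contDiffAt_det (contDiffAt_gram h)).continuousAt.sqrt).continuousWithinAt

variable [MeasurableSpace S] [BorelSpace S]

theorem aemeasurable_chart_symm (p : S) :
    AEMeasurable (chartAt (Euc 2) p).symm
      ((volume : Measure (Euc 2)).restrict (chartAt (Euc 2) p).target) :=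
  (chartAt (Euc 2) p).continuousOn_symm.aemeasurable (chartAt (Euc 2) p).open_target.measurableSet

theorem chartMeasure_apply (σ : FormField 2 S) (p : S) {A : Set S} (hA : MeasurableSet A) :
    chartMeasure σ p A = ∫⁻ u in (chartAt (Euc 2) p).symm ⁻¹' A ∩ (chartAt (Euc 2) p).target,
      ENNReal.ofReal (areaDensity σ p u) := by
  rw [chartMeasure, Measure.map_apply_of_aemeasurable
    ((aemeasurable_chart_symm p).mono_ac (withDensity_absolutelyContinuous _ _)) hA,
    withDensity_apply', Measure.restrict_restrict' (chartAt (Euc 2) p).open_target.measurableSet]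
  rfl

theorem chartMeasure_inter_source (σ : FormField 2 S) (p : S) {A : Set S} (hA : MeasurableSet A) :
    chartMeasure σ p (A ∩ (chartAt (Euc 2) p).source) = chartMeasure σ p A := by
  rw [chartMeasure_apply σ p hA,
    chartMeasure_apply σ p (hA.inter (chartAt (Euc 2) p).open_source.measurableSet)]
  congr 2
  ext u
  constructor
  · rintro ⟨⟨h1, -⟩, h2⟩
    exact ⟨h1, h2⟩
  · rintro ⟨h1, h2⟩
    exact ⟨⟨h1, (chartAt (Euc 2) p).map_target h2⟩, h2⟩

/-- The inverse chart is controlled only on its target, so the preimage is taken in the subtype and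
then pushed forward along the inclusion of an open set. -/
theorem measurableSet_chart_symm_preimage (p : S) {A : Set S} (hA : MeasurableSet A) :
    MeasurableSet ((chartAt (Euc 2) p).symm ⁻¹' A ∩ (chartAt (Euc 2) p).target) := by
  have h1 : Measurable ((chartAt (Euc 2) p).target.domRestrict (chartAt (Euc 2) p).symm) :=
    (continuousOn_iff_continuous_domRestrict.mp (chartAt (Euc 2) p).continuousOn_symm).measurable
  have h2 := MeasurableSet.subtype_image (chartAt (Euc 2) p).open_target.measurableSet (h1 hA)
  convert h2 using 1
  ext u
  constructor
  · rintro ⟨h3, h4⟩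
    exact ⟨⟨u, h4⟩, h3, rfl⟩
  · rintro ⟨⟨u, h4⟩, h3, rfl⟩
    exact ⟨h3, h4⟩

variable [IsManifold 𝓘(ℝ, Euc 2) ∞ S]

/-- The chart measures agree on overlaps. -/
theorem chartMeasure_eq (σ : FormField 2 S) (p q : S) {A : Set S} (hA : MeasurableSet A)
    (hp : A ⊆ (chartAt (Euc 2) p).source) (hq : A ⊆ (chartAt (Euc 2) q).source) :
    chartMeasure σ p A = chartMeasure σ q A := by
  rw [chartMeasure_apply σ p hA, chartMeasure_apply σ q hA]
  set s := (chartAt (Euc 2) p).symm ⁻¹' A ∩ (chartAt (Euc 2) p).target with hs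
  set φ := locRep (n := 2) (m := 2) (id : S → S) p q with hφ
  have hφu : ∀ u, φ u = chartAt (Euc 2) q ((chartAt (Euc 2) p).symm u) := fun u => rfl
  have himage : (chartAt (Euc 2) q).symm ⁻¹' A ∩ (chartAt (Euc 2) q).target = φ '' s := by
    ext u
    constructor
    · rintro ⟨h1, h2⟩
      refine ⟨chartAt (Euc 2) p ((chartAt (Euc 2) q).symm u),
        ⟨?_, (chartAt (Euc 2) p).map_source (hp h1)⟩, ?_⟩
      · rw [Set.mem_preimage, (chartAt (Euc 2) p).left_inv (hp h1)]
        exact h1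
      · rw [hφu, (chartAt (Euc 2) p).left_inv (hp h1), (chartAt (Euc 2) q).right_inv h2]
    · rintro ⟨u, ⟨h1, h2⟩, rfl⟩
      refine ⟨?_, (chartAt (Euc 2) q).map_source (hq h1)⟩
      rw [Set.mem_preimage, hφu, (chartAt (Euc 2) q).left_inv (hq h1)]
      exact h1
  have hinj : Set.InjOn φ s := by
    rintro u ⟨h1, h2⟩ v ⟨h3, h4⟩ huv
    have h5 := (chartAt (Euc 2) q).injOn (hq h1) (hq h3) huv
    exact (chartAt (Euc 2) p).symm.injOn h2 h4 h5
  have hd : ∀ u ∈ s, HasFDerivWithinAt φ (fderiv ℝ φ u) s u := by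
    rintro u ⟨h1, h2⟩
    exact ((contDiffAt_locRep h2 contMDiffAt_id (hq h1)).differentiableAt
      (by simp)).hasFDerivAt.hasFDerivWithinAt
  rw [himage, lintegral_image_eq_lintegral_abs_det_fderiv_mul volume
    (measurableSet_chart_symm_preimage p hA) hd hinj]
  refine setLIntegral_congr_fun (measurableSet_chart_symm_preimage p hA) ?_
  rintro u ⟨h1, h2⟩
  have h3 : coordMetric σ p u = pullForm (coordMetric σ q) φ u :=
    coordMetric_eq_pullForm σ h2 (hq h1)
  -- The Gram determinant scales by the square of the Jacobian, so its root scales by the absolute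
  -- value, exactly the factor in the change of variables formula.
  have h4 : areaDensity σ p u = |(fderiv ℝ φ u).det| * areaDensity σ q (φ u) := by
    rw [areaDensity, h3, pullForm, det_gram_bilinearComp, Real.sqrt_mul (sq_nonneg _),
      Real.sqrt_sq_eq_abs]
    rfl
  simp only [h4]
  rw [ENNReal.ofReal_mul (abs_nonneg _)]

variable [CompactSpace S]

/-- The supremum dominates each chart measure. Conversely, countably many charts cover the surface,
and cutting the cover into disjoint pieces glues their measures to a measure `μ`. Since chart
measures agree on overlaps, `μ` equals every chart measure on its own chart, so it is an upper bound
of the whole family and bounds the supremum. -/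
theorem areaMeasure_apply (σ : FormField 2 S) (p : S) {A : Set S} (hA : MeasurableSet A)
    (hp : A ⊆ (chartAt (Euc 2) p).source) : areaMeasure σ A = chartMeasure σ p A := by
  obtain ⟨s, hsc, hs⟩ := countable_cover_nhds_of_sigmaCompact
    (fun x : S => (chartAt (Euc 2) x).open_source.mem_nhds (mem_chart_source (Euc 2) x))
  have hne : s.Nonempty := by
    by_contra h
    rw [Set.not_nonempty_iff_eq_empty] at h
    rw [h] at hs
    have : p ∈ (Set.univ : Set S) := Set.mem_univ p
    rw [← hs] at this
    simp at this
  obtain ⟨c, rfl⟩ := hsc.exists_eq_range hne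
  set U : ℕ → Set S := fun k => (chartAt (Euc 2) (c k)).source with hU
  have hcov : ⋃ k, disjointed U k = Set.univ := by
    rw [iUnion_disjointed, ← hs]
    simp [hU]
  have hmeas : ∀ k, MeasurableSet (disjointed U k) :=
    MeasurableSet.disjointed fun k => (chartAt (Euc 2) (c k)).open_source.measurableSet
  set μ : Measure S := Measure.sum fun k => (chartMeasure σ (c k)).restrict (disjointed U k)
    with hμ
  have key : ∀ (q : S) (B : Set S), MeasurableSet B → B ⊆ (chartAt (Euc 2) q).source →
      μ B = chartMeasure σ q B := by
    intro q B hB hq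
    have h1 : B = ⋃ k, B ∩ disjointed U k := by rw [← Set.inter_iUnion, hcov, Set.inter_univ]
    have h2 : chartMeasure σ q B = ∑' k, chartMeasure σ q (B ∩ disjointed U k) := by
      conv_lhs => rw [h1]
      refine measure_iUnion ?_ fun k => hB.inter (hmeas k)
      intro i j hij
      exact ((disjoint_disjointed U) hij).mono Set.inter_subset_right Set.inter_subset_right
    rw [h2, hμ, Measure.sum_apply _ hB]
    refine tsum_congr fun k => ?_
    rw [Measure.restrict_apply hB]
    exact chartMeasure_eq σ _ _ (hB.inter (hmeas k))
      (Set.inter_subset_right.trans (disjointed_subset U k)) (Set.inter_subset_left.trans hq)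
  have hle : areaMeasure σ ≤ μ := by
    refine iSup_le fun q => Measure.le_iff.mpr fun B hB => ?_
    rw [← chartMeasure_inter_source σ q hB,
      ← key q _ (hB.inter (chartAt (Euc 2) q).open_source.measurableSet) Set.inter_subset_right]
    exact measure_mono Set.inter_subset_left
  refine le_antisymm ((hle A).trans (key p A hA hp).le) ?_
  exact (le_iSup (fun q => chartMeasure σ q) p : chartMeasure σ p ≤ areaMeasure σ) A

theorem areaMeasure_restrict_source (σ : FormField 2 S) (p : S) :
    (areaMeasure σ).restrict (chartAt (Euc 2) p).source = chartMeasure σ p := by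
  ext A hA
  rw [Measure.restrict_apply hA, areaMeasure_apply σ p
    (hA.inter (chartAt (Euc 2) p).open_source.measurableSet) Set.inter_subset_right,
    chartMeasure_inter_source σ p hA]

/-- By compactness finiteness is needed only near each point, and there the continuous density is
bounded on a small coordinate ball of finite volume. -/
theorem isFiniteMeasure_areaMeasure (hσ : IsSmoothForm σ) : IsFiniteMeasure (areaMeasure σ) := by
  refine ⟨isCompact_univ.measure_lt_top_of_nhdsWithin fun p _ => ?_⟩
  rw [nhdsWithin_univ]
  set x := chartAt (Euc 2) p p with hx
  have hxt := mem_chart_target (Euc 2) p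
  have hc : ContinuousAt (areaDensity σ p) x :=
    (continuousOn_areaDensity hσ p).continuousAt ((chartAt (Euc 2) p).open_target.mem_nhds hxt)
  have hev : ∀ᶠ u in 𝓝 x, areaDensity σ p u < areaDensity σ p x + 1 ∧
      u ∈ (chartAt (Euc 2) p).target :=
    (hc.eventually_lt_const (by linarith)).and ((chartAt (Euc 2) p).open_target.mem_nhds hxt)
  obtain ⟨r, hr, hball⟩ := Metric.eventually_nhds_iff_ball.mp hev
  have hopen := (chartAt (Euc 2) p).isOpen_inter_preimage (Metric.isOpen_ball (x := x) (ε := r))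
  refine ⟨_, hopen.mem_nhds ⟨mem_chart_source (Euc 2) p, Metric.mem_ball_self hr⟩, ?_⟩
  rw [areaMeasure_apply σ p hopen.measurableSet Set.inter_subset_left,
    chartMeasure_apply σ p hopen.measurableSet]
  calc _ ≤ ∫⁻ u in Metric.ball x r, ENNReal.ofReal (areaDensity σ p u) := by
        refine lintegral_mono_set ?_
        rintro u ⟨⟨-, h1⟩, h2⟩
        rw [Set.mem_preimage, (chartAt (Euc 2) p).right_inv h2] at h1
        exact h1
    _ ≤ ∫⁻ _ in Metric.ball x r, ENNReal.ofReal (areaDensity σ p x + 1) :=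
        setLIntegral_mono measurable_const fun u hu => ENNReal.ofReal_le_ofReal (hball u hu).1.le
    _ < ⊤ := by
        rw [setLIntegral_const]
        exact ENNReal.mul_lt_top ENNReal.ofReal_lt_top measure_ball_lt_top

/-- Integration of a function supported in a chart. -/
theorem integral_areaMeasure_eq (hσ : IsSmoothForm σ) (p : S) {f : S → ℝ} (hf : Continuous f)
    (hsupp : ∀ q, q ∉ (chartAt (Euc 2) p).source → f q = 0) :
    ∫ q, f q ∂(areaMeasure σ) = ∫ u in (chartAt (Euc 2) p).target,
      areaDensity σ p u * f ((chartAt (Euc 2) p).symm u) := by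
  rw [← setIntegral_eq_integral_of_forall_compl_eq_zero hsupp, areaMeasure_restrict_source,
    chartMeasure, integral_map
      ((aemeasurable_chart_symm p).mono_ac (withDensity_absolutelyContinuous _ _))
      hf.measurable.aestronglyMeasurable, integral_withDensity_eq_integral_toReal_smul₀]
  · refine integral_congr_ae (Filter.Eventually.of_forall fun u => ?_)
    simp only [smul_eq_mul]
    rw [ENNReal.toReal_ofReal (Real.sqrt_nonneg _)]
    rfl
  · exact ((continuousOn_areaDensity hσ p).aemeasurable
      (chartAt (Euc 2) p).open_target.measurableSet).ennreal_ofReal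
  · exact Filter.Eventually.of_forall fun u => ENNReal.ofReal_lt_top

end Measure

end QuasiLocal

end

noncomputable section

namespace QuasiLocal

set_option maxSynthPendingDepth 3

/-! ### The divergence form of the Laplacian -/

theorem gram_inv_two (B : BForm 2) :
    (gram B)⁻¹ = ((gram B).det)⁻¹ • !![B (basisVec 1) (basisVec 1), -B (basisVec 0) (basisVec 1);
      -B (basisVec 1) (basisVec 0), B (basisVec 0) (basisVec 0)] := by
  rw [Matrix.inv_def, Ring.inverse_eq_inv', Matrix.adjugate_fin_two]
  rfl

theorem det_gram_two (B : BForm 2) : (gram B).det =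
    B (basisVec 0) (basisVec 0) * B (basisVec 1) (basisVec 1) -
      B (basisVec 0) (basisVec 1) * B (basisVec 1) (basisVec 0) := by
  rw [Matrix.det_fin_two]
  rfl

theorem sharp_zero_two {B : BForm 2} (β : Euc 2 →L[ℝ] ℝ) : sharp B β 0 =
    (B (basisVec 1) (basisVec 1) * β (basisVec 0) - B (basisVec 0) (basisVec 1) * β (basisVec 1)) /
      (gram B).det := by
  rw [sharp_apply, Fin.sum_univ_two, gram_inv_two]
  simp
  ring

theorem sharp_one_two {B : BForm 2} (β : Euc 2 →L[ℝ] ℝ) : sharp B β 1 =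
    (B (basisVec 0) (basisVec 0) * β (basisVec 1) - B (basisVec 1) (basisVec 0) * β (basisVec 0)) /
      (gram B).det := by
  rw [sharp_apply, Fin.sum_univ_two, gram_inv_two]
  simp
  ring

theorem det_gram_pos_two {B : BForm 2} (hsymm : ∀ v w, B v w = B w v)
    (h : ∀ v, v ≠ 0 → 0 < B v v) : 0 < (gram B).det := by
  have hne : ∀ a : Fin 2, (basisVec a : Euc 2) ≠ 0 := fun a h0 => by
    have := congrArg (fun z : Euc 2 => z a) h0
    simp [basisVec] at this
  have h0 := h (basisVec 0) (hne 0)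
  -- This is the Gram–Schmidt vector orthogonal to `basisVec 0`, scaled to avoid division; its
  -- square length is `B (basisVec 0) (basisVec 0)` times the determinant.
  have h1 := h (B (basisVec 0) (basisVec 0) • basisVec 1 - B (basisVec 0) (basisVec 1) • basisVec 0)
    (fun h2 => by
      have := congrArg (fun z : Euc 2 => z 1) h2
      simp [basisVec] at this
      exact h0.ne' this)
  simp only [map_sub, map_smul, _root_.sub_apply, _root_.smul_apply, smul_eq_mul,
    hsymm (basisVec 1) (basisVec 0)] at h1
  rw [det_gram_two, hsymm (basisVec 1) (basisVec 0)]
  have h2 : 0 < B (basisVec 0) (basisVec 0) * (B (basisVec 0) (basisVec 0) *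
      B (basisVec 1) (basisVec 1) - B (basisVec 0) (basisVec 1) * B (basisVec 0) (basisVec 1)) := by
    linarith
  exact (mul_pos_iff_of_pos_left h0).mp h2

theorem hasDerivAt_comp_line {V : Type*} [NormedAddCommGroup V] [NormedSpace ℝ V] {n : ℕ}
    {f : Euc n → V} {u : Euc n} (hf : DifferentiableAt ℝ f u) (v : Euc n) :
    HasDerivAt (fun t : ℝ => f (u + t • v)) (fderiv ℝ f u v) 0 :=
  hf.hasFDerivAt.hasLineDerivAt v

/-- The vector density `√(det G) ∇h`. -/
def gradDensity (G : Euc 2 → BForm 2) (h : Euc 2 → ℝ) (u : Euc 2) : Euc 2 :=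
  Real.sqrt (gram (G u)).det • sharp (G u) (fderiv ℝ h u)

theorem contDiffAt_gradDensity {G : Euc 2 → BForm 2} {h : Euc 2 → ℝ} {u : Euc 2}
    (hG : IsMetricAt G u) (hpos : 0 < (gram (G u)).det) (hh : ContDiffAt ℝ ∞ h u) :
    ContDiffAt ℝ ∞ (gradDensity G h) u :=
  ((contDiffAt_det (contDiffAt_gram hG.smooth)).sqrt hpos.ne').smul
    (contDiffAt_sharp hG.smooth hG.det_ne_zero (contDiffAt_fderiv hh))

/-- The algebraic identity behind `√(det G) Δh = ∂_a (√(det G) G^{ab} ∂_b h)` in two dimensions. -/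
theorem divergence_identity_two (E F K E₀ E₁ F₀ F₁ K₀ K₁ h₀ h₁ h₀₀ h₀₁ h₁₁ r : ℝ) (hr : r ≠ 0)
    (hD : E * K - F * F = r ^ 2) :
    ((K₀ * h₀ + K * h₀₀ - (F₀ * h₁ + F * h₀₁)) * r -
        (K * h₀ - F * h₁) * ((E₀ * K + E * K₀ - (F₀ * F + F * F₀)) / (2 * r))) / r ^ 2 +
      ((E₁ * h₁ + E * h₁₁ - (F₁ * h₀ + F * h₀₁)) * r -
        (E * h₁ - F * h₀) * ((E₁ * K + E * K₁ - (F₁ * F + F * F₁)) / (2 * r))) / r ^ 2 =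
    r * (K / r ^ 2 * (h₀₀ - ((K * (E₀ / 2) - F * (F₀ - E₁ / 2)) / r ^ 2 * h₀ +
          (E * (F₀ - E₁ / 2) - F * (E₀ / 2)) / r ^ 2 * h₁)) +
        2 * (-F / r ^ 2) * (h₀₁ - ((K * (E₁ / 2) - F * (K₀ / 2)) / r ^ 2 * h₀ +
          (E * (K₀ / 2) - F * (E₁ / 2)) / r ^ 2 * h₁)) +
        E / r ^ 2 * (h₁₁ - ((K * (F₁ - K₀ / 2) - F * (K₁ / 2)) / r ^ 2 * h₀ +
          (E * (K₁ / 2) - F * (F₁ - K₀ / 2)) / r ^ 2 * h₁))) := by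
  field_simp
  rw [← hD]
  ring

/-- The components of `G` and of the differential of `h` are differentiated along the coordinate
lines, and the result is matched with the algebraic identity above. Symmetry is required at all
points because the derivatives of the components must be symmetric as well. -/
theorem lapCoord_eq_divergence {G : Euc 2 → BForm 2} {h : Euc 2 → ℝ} {u : Euc 2}
    (hG : IsMetricAt G u) (hsymm : ∀ y v w, G y v w = G y w v) (hpos : 0 < (gram (G u)).det)
    (hh : ContDiffAt ℝ ∞ h u) :
    fderiv ℝ (gradDensity G h) u (basisVec 0) 0 + fderiv ℝ (gradDensity G h) u (basisVec 1) 1 =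
      Real.sqrt (gram (G u)).det * lapCoord G h u := by
  have hGd : DifferentiableAt ℝ G u := hG.smooth.differentiableAt (by simp)
  have hhd : DifferentiableAt ℝ (fderiv ℝ h) u :=
    (contDiffAt_fderiv hh).differentiableAt (by simp)
  have hYd : DifferentiableAt ℝ (gradDensity G h) u :=
    (contDiffAt_gradDensity hG hpos hh).differentiableAt (by simp)
  have hline : ∀ v : Euc 2, Filter.Tendsto (fun t : ℝ => u + t • v) (𝓝 0) (𝓝 u) := fun v => by
    have : Continuous fun t : ℝ => u + t • v := by fun_prop
    simpa using this.tendsto 0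
  have hdetpos : ∀ᶠ y in 𝓝 u, 0 < (gram (G y)).det :=
    (contDiffAt_det (contDiffAt_gram hG.smooth)).continuousAt.eventually_const_lt hpos
  have hform : ∀ v a b, HasDerivAt (fun t : ℝ => G (u + t • v) (basisVec a) (basisVec b))
      (fderiv ℝ G u v (basisVec a) (basisVec b)) 0 := by
    intro v a b
    have h1 := ((hasDerivAt_comp_line hGd v).clm_apply (hasDerivAt_const 0 (basisVec a))).clm_apply
      (hasDerivAt_const 0 (basisVec b))
    simpa using h1
  have hcov : ∀ v a, HasDerivAt (fun t : ℝ => fderiv ℝ h (u + t • v) (basisVec a))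
      (fderiv ℝ (fderiv ℝ h) u v (basisVec a)) 0 := by
    intro v a
    have h1 := (hasDerivAt_comp_line hhd v).clm_apply (hasDerivAt_const 0 (basisVec a))
    simpa using h1
  have hcomp : ∀ v a, HasDerivAt (fun t : ℝ => gradDensity G h (u + t • v) a)
      (fderiv ℝ (gradDensity G h) u v a) 0 := by
    intro v a
    have h1 := (EuclideanSpace.proj (𝕜 := ℝ) a : Euc 2 →L[ℝ] ℝ).hasFDerivAt.comp_hasDerivAt 0
      (hasDerivAt_comp_line hYd v)
    exact h1
  have hDG : ∀ v, fderiv ℝ G u v (basisVec 1) (basisVec 0) =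
      fderiv ℝ G u v (basisVec 0) (basisVec 1) := by
    intro v
    refine (hform v 1 0).unique ?_
    simp only [hsymm _ (basisVec 1) (basisVec 0)]
    exact hform v 0 1
  have hD2 : fderiv ℝ (fderiv ℝ h) u (basisVec 1) (basisVec 0) =
      fderiv ℝ (fderiv ℝ h) u (basisVec 0) (basisVec 1) :=
    (hh.isSymmSndFDerivAt (by simp; norm_cast)) _ _
  have hdet : ∀ y, (gram (G y)).det = G y (basisVec 0) (basisVec 0) *
      G y (basisVec 1) (basisVec 1) - G y (basisVec 0) (basisVec 1) *
        G y (basisVec 0) (basisVec 1) := by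
    intro y
    rw [det_gram_two, hsymm y (basisVec 1) (basisVec 0)]
  set r := Real.sqrt (gram (G u)).det with hr
  have hrpos : 0 < r := Real.sqrt_pos.mpr hpos
  have hr2 : (gram (G u)).det = r ^ 2 := (Real.sq_sqrt hpos.le).symm
  have hsqrt : ∀ v, HasDerivAt (fun t : ℝ => Real.sqrt (gram (G (u + t • v))).det)
      ((fderiv ℝ G u v (basisVec 0) (basisVec 0) * G u (basisVec 1) (basisVec 1) +
        G u (basisVec 0) (basisVec 0) * fderiv ℝ G u v (basisVec 1) (basisVec 1) -
        (fderiv ℝ G u v (basisVec 0) (basisVec 1) * G u (basisVec 0) (basisVec 1) +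
          G u (basisVec 0) (basisVec 1) * fderiv ℝ G u v (basisVec 0) (basisVec 1))) /
        (2 * r)) 0 := by
    intro v
    simp only [hdet]
    have h1 := (((hform v 0 0).mul (hform v 1 1)).sub ((hform v 0 1).mul (hform v 0 1))).sqrt
      (by simpa [hdet] using hpos.ne')
    simpa [hr, hdet] using h1
  -- In two dimensions `√det` times the inverse matrix is the adjugate divided by `√det`. The vector
  -- density is therefore a polynomial expression over one square root, and no matrix inverse needs
  -- differentiating.
  have hY0 : HasDerivAt (fun t : ℝ => gradDensity G h (u + t • basisVec 0) 0) _ 0 :=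
    ((((hform (basisVec 0) 1 1).mul (hcov (basisVec 0) 0)).sub
      ((hform (basisVec 0) 0 1).mul (hcov (basisVec 0) 1))).div (hsqrt (basisVec 0))
        (by simpa using hrpos.ne')).congr_of_eventuallyEq (by
      filter_upwards [(hline (basisVec 0)).eventually hdetpos] with t ht
      rw [gradDensity, PiLp.smul_apply, sharp_zero_two, smul_eq_mul]
      have h2 := Real.sq_sqrt ht.le
      have h3 := (Real.sqrt_pos.mpr ht).ne'
      simp only [Pi.sub_apply, Pi.mul_apply, Pi.div_apply]
      conv_lhs => rw [← h2]
      field_simp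
      rw [Real.sqrt_sq (Real.sqrt_nonneg _)])
  have hY1 : HasDerivAt (fun t : ℝ => gradDensity G h (u + t • basisVec 1) 1) _ 0 :=
    ((((hform (basisVec 1) 0 0).mul (hcov (basisVec 1) 1)).sub
      ((hform (basisVec 1) 0 1).mul (hcov (basisVec 1) 0))).div (hsqrt (basisVec 1))
        (by simpa using hrpos.ne')).congr_of_eventuallyEq (by
      filter_upwards [(hline (basisVec 1)).eventually hdetpos] with t ht
      rw [gradDensity, PiLp.smul_apply, sharp_one_two, smul_eq_mul, hsymm _ (basisVec 1)]
      have h2 := Real.sq_sqrt ht.le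
      have h3 := (Real.sqrt_pos.mpr ht).ne'
      simp only [Pi.sub_apply, Pi.mul_apply, Pi.div_apply]
      conv_lhs => rw [← h2]
      field_simp
      rw [Real.sqrt_sq (Real.sqrt_nonneg _)])
  rw [(hcomp (basisVec 0) 0).unique hY0, (hcomp (basisVec 1) 1).unique hY1]
  have hchr : ∀ v w, fderiv ℝ h u (christoffel G u v w) =
      christoffel G u v w 0 * fderiv ℝ h u (basisVec 0) +
        christoffel G u v w 1 * fderiv ℝ h u (basisVec 1) := by
    intro v w
    have h1 := map_eq_sum_basisVec (fderiv ℝ h u : Euc 2 →ₗ[ℝ] ℝ) (christoffel G u v w)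
    simpa [Fin.sum_univ_two] using h1
  have hid := divergence_identity_two (G u (basisVec 0) (basisVec 0))
    (G u (basisVec 0) (basisVec 1)) (G u (basisVec 1) (basisVec 1))
    (fderiv ℝ G u (basisVec 0) (basisVec 0) (basisVec 0))
    (fderiv ℝ G u (basisVec 1) (basisVec 0) (basisVec 0))
    (fderiv ℝ G u (basisVec 0) (basisVec 0) (basisVec 1))
    (fderiv ℝ G u (basisVec 1) (basisVec 0) (basisVec 1))
    (fderiv ℝ G u (basisVec 0) (basisVec 1) (basisVec 1))
    (fderiv ℝ G u (basisVec 1) (basisVec 1) (basisVec 1))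
    (fderiv ℝ h u (basisVec 0)) (fderiv ℝ h u (basisVec 1))
    (fderiv ℝ (fderiv ℝ h) u (basisVec 0) (basisVec 0))
    (fderiv ℝ (fderiv ℝ h) u (basisVec 0) (basisVec 1))
    (fderiv ℝ (fderiv ℝ h) u (basisVec 1) (basisVec 1)) r hrpos.ne' (by rw [← hdet, hr2])
  simp only [lapCoord, metricTrace, Fin.sum_univ_two, gram_inv_two, hr2, hessCoord, hchr, hD2,
    hsymm u (basisVec 1) (basisVec 0), smul_eq_mul, Matrix.smul_apply, Matrix.of_apply,
    Matrix.cons_val_zero, Matrix.cons_val_one, Matrix.cons_val', Matrix.cons_val_fin_one]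
  simp only [christoffel, sharp_zero_two, sharp_one_two, _root_.smul_apply, _root_.add_apply,
    _root_.sub_apply, ContinuousLinearMap.flip_apply, hsymm u (basisVec 1) (basisVec 0), hDG,
    smul_eq_mul, hr2]
  simp only [Pi.mul_apply, Pi.sub_apply, zero_smul, add_zero, ← hr]
  refine (Eq.trans ?_ hid).trans ?_ <;> ring

end QuasiLocal

end

noncomputable section

namespace QuasiLocal

set_option maxSynthPendingDepth 3

/-! ### Green's identity -/

/-- Integration by parts against the constant function 1, which needs no decay at infinity because
`f` has compact support. -/
theorem integral_fderiv_apply_eq_zero {E : Type*} [NormedAddCommGroup E] [NormedSpace ℝ E]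
    [FiniteDimensional ℝ E] [MeasurableSpace E] [BorelSpace E] (μ : Measure E)
    [μ.IsAddHaarMeasure] {f : E → ℝ} (hf : ContDiff ℝ 1 f) (hs : HasCompactSupport f) (v : E) :
    ∫ u, fderiv ℝ f u v ∂μ = 0 := by
  have hf' : Continuous fun u => fderiv ℝ f u v :=
    (hf.continuous_fderiv (by simp)).clm_apply continuous_const
  have hs' : HasCompactSupport fun u => fderiv ℝ f u v := hs.fderiv_apply ℝ v
  have h := integral_mul_fderiv_eq_neg_fderiv_mul_of_integrable (μ := μ) (f := fun _ => (1 : ℝ))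
    (g := f) (v := v) (by simp)
    (by simpa using hf'.integrable_of_hasCompactSupport hs')
    (by simpa using hf.continuous.integrable_of_hasCompactSupport hs)
    (fun x _ => differentiableAt_const _) (fun x _ => hf.differentiable (by simp) x)
  simpa using h

section Green

variable {S : Type*} [TopologicalSpace S] [ChartedSpace (Euc 2) S]
  {σ : FormField 2 S} {h ψ θ : S → ℝ}

theorem dFun_eq_zero_of_notMem_tsupport {q : S} (hq : q ∉ tsupport ψ) : dFun ψ q = 0 := by
  have h1 : ψ =ᶠ[𝓝 q] fun _ => (0 : ℝ) := by
    filter_upwards [(isClosed_tsupport ψ).isOpen_compl.mem_nhds hq] with x hx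
    exact image_eq_zero_of_notMem_tsupport hx
  rw [dFun, h1.mfderiv_eq]
  exact mfderiv_const

variable [IsManifold 𝓘(ℝ, Euc 2) ∞ S]

theorem IsSmoothForm.continuous_green_integrand (hσ : IsSmoothForm σ)
    (hh : ContMDiff 𝓘(ℝ, Euc 2) 𝓘(ℝ, ℝ) ∞ h) (hψ : ContMDiff 𝓘(ℝ, Euc 2) 𝓘(ℝ, ℝ) ∞ ψ) :
    Continuous fun q => ψ q * laplacian σ h q + dFun ψ q (surfGrad σ h q) :=
  (hψ.continuous.mul (hσ.contMDiff_laplacian hh).continuous).add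
    (hσ.contMDiff_dFun_surfGrad hψ hh).continuous

theorem coordMetric_pos (hσ : IsRiemannian σ) {p : S} {z : Euc 2}
    (hz : z ∈ (chartAt (Euc 2) p).target) (v : Euc 2) (hv : v ≠ 0) :
    0 < coordMetric σ p z v v := by
  refine hσ.pos _ _ fun h0 => hv ?_
  have h1 := tmap_chart_tmap_chart_symm hz v
  exact h1.symm.trans ((congrArg (tmap (m := 2) (n := 2) (chartAt (Euc 2) p) _) h0).trans
    (map_zero (tmap (m := 2) (n := 2) (chartAt (Euc 2) p) _)))

variable [CompactSpace S] [MeasurableSpace S] [BorelSpace S]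

theorem integrable_areaMeasure (hσ : IsSmoothForm σ) {f : S → ℝ} (hf : Continuous f) :
    Integrable f (areaMeasure σ) := by
  have := isFiniteMeasure_areaMeasure hσ
  exact hf.integrable_of_hasCompactSupport (HasCompactSupport.of_compactSpace f)

/-- In the chart, `√det (ψ Δh + dψ(∇h))` is the divergence of `ψ √det ∇h`, a compactly supported
vector field in the plane, so its integral vanishes. -/
theorem IsRiemannian.integral_green_of_tsupport_subset (hσ : IsRiemannian σ)
    (hh : ContMDiff 𝓘(ℝ, Euc 2) 𝓘(ℝ, ℝ) ∞ h) (hψ : ContMDiff 𝓘(ℝ, Euc 2) 𝓘(ℝ, ℝ) ∞ ψ) {p : S}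
    (hp : tsupport ψ ⊆ (chartAt (Euc 2) p).source) :
    ∫ q, (ψ q * laplacian σ h q + dFun ψ q (surfGrad σ h q)) ∂(areaMeasure σ) = 0 := by
  classical
  set c := chartAt (Euc 2) p with hc
  set G := coordMetric σ p with hG
  have hsymm : ∀ y v w, G y v w = G y w v := fun y v w => hσ.symm _ _ _
  set hc' : Euc 2 → ℝ := h ∘ c.symm with hh'
  set ψc : Euc 2 → ℝ := ψ ∘ c.symm with hψ'
  have hhs : ∀ z ∈ c.target, ContDiffAt ℝ ∞ hc' z := fun z hz =>
    contDiffAt_comp_chart_symm hz hh.contMDiffAt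
  have hψs : ∀ z ∈ c.target, ContDiffAt ℝ ∞ ψc z := fun z hz =>
    contDiffAt_comp_chart_symm hz hψ.contMDiffAt
  have hGm : ∀ z ∈ c.target, IsMetricAt G z := fun z hz => hσ.isMetricAt hz
  have hGp : ∀ z ∈ c.target, 0 < (gram (G z)).det := fun z hz =>
    det_gram_pos_two (hsymm z) (coordMetric_pos hσ hz)
  -- Outside the target the inverse chart carries no information, so the field is extended by zero.
  -- The extension is smooth because the field already vanishes off the compact set `K` inside the
  -- target.
  set Z : Euc 2 → Euc 2 := c.target.indicator fun u => ψc u • gradDensity G hc' u with hZ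
  set K : Set (Euc 2) := c '' tsupport ψ with hK
  have hKc : IsCompact K :=
    (isClosed_tsupport ψ).isCompact.image_of_continuousOn (c.continuousOn.mono hp)
  have hKt : K ⊆ c.target := by
    rintro _ ⟨q, hq, rfl⟩
    exact c.map_source (hp hq)
  have hZK : ∀ u, u ∉ K → Z u = 0 := by
    intro u hu
    by_cases hut : u ∈ c.target
    · rw [hZ, Set.indicator_of_mem hut]
      have : ψ (c.symm u) = 0 :=
        image_eq_zero_of_notMem_tsupport fun hmem => hu ⟨_, hmem, c.right_inv hut⟩
      change ψc u • gradDensity G hc' u = 0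
      change ψc u = 0 at this
      rw [this, zero_smul]
    · exact Set.indicator_of_notMem hut _
  have hZev : ∀ u ∈ c.target, Z =ᶠ[𝓝 u] fun u => ψc u • gradDensity G hc' u := by
    intro u hu
    filter_upwards [c.open_target.mem_nhds hu] with y hy
    exact Set.indicator_of_mem hy _
  have hZoff : ∀ u, u ∉ K → Z =ᶠ[𝓝 u] fun _ => 0 := by
    intro u hu
    filter_upwards [hKc.isClosed.isOpen_compl.mem_nhds hu] with y hy
    exact hZK y hy
  have hYs : ∀ z ∈ c.target, ContDiffAt ℝ ∞ (gradDensity G hc') z := fun z hz =>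
    contDiffAt_gradDensity (hGm z hz) (hGp z hz) (hhs z hz)
  have hZs : ContDiff ℝ 1 Z := by
    refine contDiff_iff_contDiffAt.mpr fun u => ?_
    by_cases hu : u ∈ K
    · refine ContDiffAt.congr_of_eventuallyEq ?_ (hZev u (hKt hu))
      exact (((hψs u (hKt hu)).smul (hYs u (hKt hu))).of_le (by norm_cast))
    · exact contDiffAt_const.congr_of_eventuallyEq (hZoff u hu)
  have hint : ∀ a : Fin 2, ∫ u, fderiv ℝ Z u (basisVec a) a = 0 := by
    intro a
    have h1 : ContDiff ℝ 1 (fun u => Z u a) :=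
      (EuclideanSpace.proj (𝕜 := ℝ) a : Euc 2 →L[ℝ] ℝ).contDiff.comp hZs
    have h2 : HasCompactSupport (fun u => Z u a) :=
      HasCompactSupport.intro hKc fun u hu => by simp [hZK u hu]
    rw [← integral_fderiv_apply_eq_zero volume h1 h2 (basisVec a)]
    refine integral_congr_ae (Filter.Eventually.of_forall fun u => ?_)
    have h3 := ((EuclideanSpace.proj (𝕜 := ℝ) a : Euc 2 →L[ℝ] ℝ).hasFDerivAt.comp u
      (hZs.differentiable (by simp) u).hasFDerivAt).fderiv
    exact (DFunLike.congr_fun h3 (basisVec a)).symm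
  have hintegrable : ∀ a : Fin 2, Integrable (fun u => fderiv ℝ Z u (basisVec a) a) := by
    intro a
    have h1 : Continuous fun u => fderiv ℝ Z u (basisVec a) :=
      (hZs.continuous_fderiv (by simp)).clm_apply continuous_const
    refine ((EuclideanSpace.proj (𝕜 := ℝ) a : Euc 2 →L[ℝ] ℝ).continuous.comp
      h1).integrable_of_hasCompactSupport (HasCompactSupport.intro hKc fun u hu => ?_)
    simp [(hZoff u hu).fderiv_eq]
  have hdiv : ∀ u ∈ c.target, areaDensity σ p u * (ψ (c.symm u) * laplacian σ h (c.symm u) +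
      dFun ψ (c.symm u) (surfGrad σ h (c.symm u))) =
      fderiv ℝ Z u (basisVec 0) 0 + fderiv ℝ Z u (basisVec 1) 1 := by
    intro u hu
    have hsrc := c.map_target hu
    have h1 := hσ.laplacian_eq_lapCoord hh hsrc
    have h2 := hσ.tmap_surfGrad hh hsrc
    rw [c.right_inv hu] at h1 h2
    have h3 := dFun_eq_fderiv_comp hψ hsrc (surfGrad σ h (c.symm u))
    rw [h2, c.right_inv hu] at h3
    have h4 := lapCoord_eq_divergence (hGm u hu) hsymm (hGp u hu) (hhs u hu)
    have h5 := (((hψs u hu).differentiableAt (by simp)).hasFDerivAt.smul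
      ((hYs u hu).differentiableAt (by simp)).hasFDerivAt).fderiv
    have h6 : fderiv ℝ Z u = _ := (hZev u hu).fderiv_eq.trans h5
    have h7 : ∀ a, fderiv ℝ Z u (basisVec a) a =
        ψc u * fderiv ℝ (gradDensity G hc') u (basisVec a) a +
          fderiv ℝ ψc u (basisVec a) * gradDensity G hc' u a := by
      intro a
      rw [h6]
      simp
    have h8 := map_eq_sum_basisVec (fderiv ℝ ψc u : Euc 2 →ₗ[ℝ] ℝ) (sharp (G u) (fderiv ℝ hc' u))
    simp only [ContinuousLinearMap.coe_coe, Fin.sum_univ_two, smul_eq_mul] at h8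
    rw [h1, h3, h7, h7, h8]
    simp only [gradDensity, PiLp.smul_apply, smul_eq_mul] at h4 ⊢
    have h9 : ψ (c.symm u) = ψc u := rfl
    have h10 : areaDensity σ p u = Real.sqrt (gram (G u)).det := rfl
    rw [h9, h10]
    have h11 : lapCoord (coordMetric σ p) (h ∘ c.symm) u = lapCoord G hc' u := rfl
    rw [h11]
    linear_combination (-ψc u) * h4
  rw [integral_areaMeasure_eq hσ.toIsSmoothForm p (hσ.continuous_green_integrand hh hψ)]
  · rw [setIntegral_congr_fun c.open_target.measurableSet hdiv,
      setIntegral_eq_integral_of_forall_compl_eq_zero, integral_add (hintegrable 0) (hintegrable 1),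
      hint, hint, add_zero]
    intro u hu
    have hu' : u ∉ K := fun h0 => hu (hKt h0)
    simp [(hZoff u hu').fderiv_eq]
  · intro q hq
    have hq' : q ∉ tsupport ψ := fun h0 => hq (hp h0)
    rw [image_eq_zero_of_notMem_tsupport hq', dFun_eq_zero_of_notMem_tsupport hq']
    simp

/-- Green's identity on a closed surface. -/
theorem IsRiemannian.integral_green [T2Space S] (hσ : IsRiemannian σ)
    (hh : ContMDiff 𝓘(ℝ, Euc 2) 𝓘(ℝ, ℝ) ∞ h) (hθ : ContMDiff 𝓘(ℝ, Euc 2) 𝓘(ℝ, ℝ) ∞ θ) :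
    ∫ q, (θ q * laplacian σ h q + dFun θ q (surfGrad σ h q)) ∂(areaMeasure σ) = 0 := by
  -- The identity is linear in `θ`. With a partition of unity subordinate to the charts, finite on
  -- the compact surface, `θ` becomes a finite sum of functions each supported in one chart.
  obtain ⟨f, hf⟩ :=
    SmoothPartitionOfUnity.exists_isSubordinate_chartAt_source 𝓘(ℝ, Euc 2) S
  have hfin := f.locallyFinite.finite_nonempty_of_compact
  have hterm : ∀ i, ContMDiff 𝓘(ℝ, Euc 2) 𝓘(ℝ, ℝ) ∞ (fun q => f i q * θ q) := fun i =>
    (f i).contMDiff.mul hθ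
  have key : ∀ t : Finset S, ContMDiff 𝓘(ℝ, Euc 2) 𝓘(ℝ, ℝ) ∞ (fun q => ∑ i ∈ t, f i q * θ q) ∧
      ∫ q, ((∑ i ∈ t, f i q * θ q) * laplacian σ h q +
        dFun (fun q => ∑ i ∈ t, f i q * θ q) q (surfGrad σ h q)) ∂(areaMeasure σ) = 0 := by
    classical
    intro t
    induction t using Finset.induction_on with
    | empty =>
      refine ⟨by simpa using contMDiff_const, ?_⟩
      have h1 : ∀ q : S, dFun (fun _ : S => (0 : ℝ)) q = 0 := fun q => mfderiv_const
      simp [h1]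
    | insert i t hi ih =>
      have hs : (fun q => ∑ j ∈ insert i t, f j q * θ q) =
          fun q => 1 * (f i q * θ q) + 1 * ∑ j ∈ t, f j q * θ q := by
        funext q
        rw [Finset.sum_insert hi, one_mul, one_mul]
      have hsupp : tsupport (fun q => f i q * θ q) ⊆ (chartAt (Euc 2) i).source :=
        (tsupport_mul_subset_left (f := f i) (g := θ)).trans (hf i)
      have h1 := hσ.integral_green_of_tsupport_subset hh (hterm i) hsupp
      refine ⟨hs ▸ (contMDiff_const.mul (hterm i)).add (contMDiff_const.mul ih.1), ?_⟩
      simp only [Finset.sum_insert hi]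
      simp only [Finset.sum_insert hi] at hs
      have h2 : ∀ q, (f i q * θ q + ∑ j ∈ t, f j q * θ q) * laplacian σ h q +
          dFun (fun q => f i q * θ q + ∑ j ∈ t, f j q * θ q) q (surfGrad σ h q) =
          (f i q * θ q * laplacian σ h q + dFun (fun q => f i q * θ q) q (surfGrad σ h q)) +
          ((∑ j ∈ t, f j q * θ q) * laplacian σ h q +
            dFun (fun q => ∑ j ∈ t, f j q * θ q) q (surfGrad σ h q)) := by
        intro q
        rw [hs, dFun_lincomb (hterm i) ih.1, one_smul, one_smul, _root_.add_apply]
        ring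
      simp only [h2]
      rw [integral_add (integrable_areaMeasure hσ.toIsSmoothForm
        (hσ.continuous_green_integrand hh (hterm i)))
        (integrable_areaMeasure hσ.toIsSmoothForm (hσ.continuous_green_integrand hh ih.1)),
        h1, ih.2, add_zero]
  have hsum : (fun q => ∑ i ∈ hfin.toFinset, f i q * θ q) = θ := by
    funext q
    rw [← Finset.sum_mul, ← finsum_eq_sum_of_support_subset (fun i => f i q),
      f.sum_eq_one (Set.mem_univ q), one_mul]
    intro i hi
    rw [Set.Finite.coe_toFinset]
    exact ⟨q, hi⟩
  have h3 := (key hfin.toFinset).2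
  have h4 : ∀ q, ∑ i ∈ hfin.toFinset, f i q * θ q = θ q := fun q => congrFun hsum q
  simpa only [h4] using h3

end Green

end QuasiLocal

end

noncomputable section

namespace QuasiLocal

/-! ### The energy density as a function of `|∇τ|²` and `Δτ` -/

/-- The function `ρ` in terms of `a = |H₀|`, `b = |H|`, `u = 1 + |∇τ|²` and `L = Δτ`. -/
def rhoFn (a b u L : ℝ) : ℝ :=
  (Real.sqrt (a ^ 2 + L ^ 2 / u) - Real.sqrt (b ^ 2 + L ^ 2 / u)) / Real.sqrt u

/-- The function `sinh⁻¹(ρ Δτ / (|H₀| |H|))` in terms of the same variables. -/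
def thetaFn (a b u L : ℝ) : ℝ := Real.arsinh (rhoFn a b u L * L / (a * b))

theorem arsinh_sub_arsinh (x y : ℝ) : Real.arsinh x - Real.arsinh y =
    Real.arsinh (x * Real.sqrt (1 + y ^ 2) - Real.sqrt (1 + x ^ 2) * y) := by
  apply Real.sinh_injective
  rw [Real.sinh_sub, Real.sinh_arsinh, Real.sinh_arsinh, Real.sinh_arsinh, Real.cosh_arsinh,
    Real.cosh_arsinh]

theorem sqrt_add_div_eq {a u L : ℝ} (hu : 0 < u) :
    Real.sqrt (a ^ 2 + L ^ 2 / u) = Real.sqrt (a ^ 2 * u + L ^ 2) / Real.sqrt u := by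
  rw [← Real.sqrt_div' _ hu.le]
  congr 1
  field_simp

theorem sqrt_one_add_div_sq {a u L : ℝ} (ha : 0 < a) (hu : 0 < u) :
    Real.sqrt (1 + (L / (a * Real.sqrt u)) ^ 2) =
      Real.sqrt (a ^ 2 * u + L ^ 2) / (a * Real.sqrt u) := by
  have hau : 0 < a * Real.sqrt u := mul_pos ha (Real.sqrt_pos.mpr hu)
  have h1 : 1 + (L / (a * Real.sqrt u)) ^ 2 = (a ^ 2 * u + L ^ 2) / (a * Real.sqrt u) ^ 2 := by
    rw [mul_pow, Real.sq_sqrt hu.le, div_pow, mul_pow, Real.sq_sqrt hu.le]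
    field_simp
  rw [h1, Real.sqrt_div' _ (sq_nonneg _), Real.sqrt_sq hau.le]

/-- The subtraction formula with `x = L/(b√u)` and `y = L/(a√u)`; its argument is `L (√(a²u + L²) -
√(b²u + L²)) / (abu)`. The point is that the contributions of `a` and `b` separate. -/
theorem thetaFn_eq {a b u L : ℝ} (ha : 0 < a) (hb : 0 < b) (hu : 0 < u) : thetaFn a b u L =
    Real.arsinh (L / (b * Real.sqrt u)) - Real.arsinh (L / (a * Real.sqrt u)) := by
  have hsu : 0 < Real.sqrt u := Real.sqrt_pos.mpr hu
  rw [arsinh_sub_arsinh, sqrt_one_add_div_sq ha hu, sqrt_one_add_div_sq hb hu, thetaFn, rhoFn,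
    sqrt_add_div_eq hu, sqrt_add_div_eq hu]
  congr 1
  field_simp

theorem rhoFn_mul {a b u L : ℝ} (hu : 0 < u) : rhoFn a b u L * u =
    Real.sqrt (a ^ 2 * u + L ^ 2) - Real.sqrt (b ^ 2 * u + L ^ 2) := by
  have hsu : 0 < Real.sqrt u := Real.sqrt_pos.mpr hu
  rw [rhoFn, sqrt_add_div_eq hu, sqrt_add_div_eq hu]
  conv_lhs => rw [← Real.sq_sqrt hu.le]
  rw [Real.sqrt_sq hsu.le]
  field_simp
  rw [Real.sq_sqrt hu.le, mul_comm u]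

/-- Put `Q = √(a²u + L²)`. The arsinh factor has derivative `(L' - L u'/(2u))/Q`. Its product with
`L` cancels the term `L L'/Q` coming from the root, and the remaining `u'` terms add up to `(a²u +
L²) u'/(2uQ) = Q u'/(2u)`. -/
theorem hasDerivAt_sqrt_sub_mul_arsinh {a : ℝ} (ha : 0 < a) {u L : ℝ → ℝ} {u' L' s : ℝ}
    (hu : HasDerivAt u u' s) (hL : HasDerivAt L L' s) (hpos : 0 < u s) :
    HasDerivAt (fun t => Real.sqrt (a ^ 2 * u t + L t ^ 2) -
        L t * Real.arsinh (L t / (a * Real.sqrt (u t))))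
      (Real.sqrt (a ^ 2 * u s + L s ^ 2) / (2 * u s) * u' -
        Real.arsinh (L s / (a * Real.sqrt (u s))) * L') s := by
  have hsu : 0 < Real.sqrt (u s) := Real.sqrt_pos.mpr hpos
  have hq : 0 < a ^ 2 * u s + L s ^ 2 := by positivity
  have hsq : 0 < Real.sqrt (a ^ 2 * u s + L s ^ 2) := Real.sqrt_pos.mpr hq
  have h1 := ((hu.const_mul (a ^ 2)).add (hL.pow 2)).sqrt hq.ne'
  have h2 := (hL.div ((hu.sqrt hpos.ne').const_mul a) (mul_pos ha hsu).ne').arsinh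
  have h3 := h1.sub (hL.mul h2)
  refine (h3.congr_deriv ?_)
  simp only [Pi.div_apply, Pi.add_apply, Pi.pow_apply, smul_eq_mul]
  rw [sqrt_one_add_div_sq ha hpos]
  have e1 : Real.sqrt (a ^ 2 * u s + L s ^ 2) ^ 2 = a ^ 2 * u s + L s ^ 2 := Real.sq_sqrt hq.le
  have e2 : Real.sqrt (u s) ^ 2 = u s := Real.sq_sqrt hpos.le
  set Q := Real.sqrt (a ^ 2 * u s + L s ^ 2) with hQ
  set w := Real.sqrt (u s) with hw
  rw [← e2] at e1 ⊢
  field_simp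
  push_cast
  linear_combination (-u') * e1

/-- The previous lemma for `a` minus the one for `b`. In effect `ρ/2` and `θ` are the partial
derivatives of the density in `u` and `L`, so the first variation contains no derivative of `ρ` or
`θ`. -/
theorem hasDerivAt_energyDensity {a b : ℝ} (ha : 0 < a) (hb : 0 < b) {u L : ℝ → ℝ} {u' L' s : ℝ}
    (hu : HasDerivAt u u' s) (hL : HasDerivAt L L' s) (hpos : ∀ t, 0 < u t) :
    HasDerivAt (fun t => rhoFn a b (u t) (L t) * u t + L t * thetaFn a b (u t) (L t))
      (rhoFn a b (u s) (L s) * u' / 2 + thetaFn a b (u s) (L s) * L') s := by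
  have h := (hasDerivAt_sqrt_sub_mul_arsinh ha hu hL (hpos s)).sub
    (hasDerivAt_sqrt_sub_mul_arsinh hb hu hL (hpos s))
  have hfun : (fun t => rhoFn a b (u t) (L t) * u t + L t * thetaFn a b (u t) (L t)) =
      (fun t => Real.sqrt (a ^ 2 * u t + L t ^ 2) -
        L t * Real.arsinh (L t / (a * Real.sqrt (u t)))) -
      (fun t => Real.sqrt (b ^ 2 * u t + L t ^ 2) -
        L t * Real.arsinh (L t / (b * Real.sqrt (u t)))) := by
    funext t
    rw [Pi.sub_apply, rhoFn_mul (hpos t), thetaFn_eq ha hb (hpos t)]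
    ring
  rw [hfun]
  refine h.congr_deriv ?_
  have h1 : rhoFn a b (u s) (L s) = (Real.sqrt (a ^ 2 * u s + L s ^ 2) -
      Real.sqrt (b ^ 2 * u s + L s ^ 2)) / u s := by
    rw [← rhoFn_mul (hpos s), mul_div_cancel_right₀ _ (hpos s).ne']
  rw [h1, thetaFn_eq ha hb (hpos s)]
  have := (hpos s).ne'
  field_simp
  ring

theorem continuous_rhoFn {Y : Type*} [TopologicalSpace Y] {a b u L : Y → ℝ} (ha : Continuous a)
    (hb : Continuous b) (hu : Continuous u) (hL : Continuous L) (hpos : ∀ y, 0 < u y) :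
    Continuous fun y => rhoFn (a y) (b y) (u y) (L y) := by
  have h1 : Continuous fun y => L y ^ 2 / u y := (hL.pow 2).div hu fun y => (hpos y).ne'
  exact (((ha.pow 2).add h1).sqrt.sub ((hb.pow 2).add h1).sqrt).div hu.sqrt
    fun y => (Real.sqrt_pos.mpr (hpos y)).ne'

theorem continuous_thetaFn {Y : Type*} [TopologicalSpace Y] {a b u L : Y → ℝ} (ha : Continuous a)
    (hb : Continuous b) (hu : Continuous u) (hL : Continuous L) (hpos : ∀ y, 0 < u y)
    (hapos : ∀ y, 0 < a y) (hbpos : ∀ y, 0 < b y) :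
    Continuous fun y => thetaFn (a y) (b y) (u y) (L y) :=
  (((continuous_rhoFn ha hb hu hL hpos).mul hL).div (ha.mul hb)
    fun y => (mul_pos (hapos y) (hbpos y)).ne').arsinh

end QuasiLocal

end

noncomputable section

namespace QuasiLocal

set_option maxSynthPendingDepth 3
set_option linter.unusedSectionVars false

/-! ### Time functions and coordinate functions of an isometric embedding -/

section Energy

variable {S : Type*} [TopologicalSpace S] [ChartedSpace (Euc 2) S]
  [IsManifold 𝓘(ℝ, Euc 2) ∞ S]

/-- The data `(|H|, α_H)` of a surface with metric `σ` are smooth, `|H|` is positive and `α_H` is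
linear. -/
structure IsSmoothData (D : SurfaceData S) : Prop where
  riemannian : IsRiemannian D.metric
  normH_pos : ∀ p, 0 < D.normH p
  contMDiff_normH : ContMDiff 𝓘(ℝ, Euc 2) 𝓘(ℝ, ℝ) ∞ D.normH
  alphaH_lincomb : ∀ (p : S) (a b : ℝ) (v w : Euc 2),
    D.alphaH p (a • v + b • w) = a * D.alphaH p v + b * D.alphaH p w
  continuous_alphaH : ∀ V : S → Euc 2, IsSmoothAlong 2 (id : S → S) V →
    Continuous fun p => D.alphaH p (V p)

theorem isSmoothData_surfaceData {N : Type*} [TopologicalSpace N] [ChartedSpace (Euc 4) N]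
    [IsManifold 𝓘(ℝ, Euc 4) ∞ N] {g : LorentzMetric N} {ι : S → N}
    (hι : ContMDiff 𝓘(ℝ, Euc 2) 𝓘(ℝ, Euc 4) ∞ ι) (h : IsSpacelike g ι)
    (hH : HasSpacelikeMeanCurv g ι) {ℓ : ∀ p : S, Tan 4 (ι p)} (hℓ : IsNullNormal g ι ℓ) :
    IsSmoothData (surfaceData g ι ℓ) where
  riemannian := ⟨h.isSmoothForm hι, h⟩
  normH_pos := normMeanCurv_pos hH
  contMDiff_normH := contMDiff_normMeanCurv h hι hH
  alphaH_lincomb p a b v w := connectionForm_lincomb g ι ℓ p a b v w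
  continuous_alphaH _ hV := (contMDiff_connectionForm h hι hH hℓ hV).continuous

theorem dFun_clm_comp {X : S → Euc 4} (hX : ContMDiff 𝓘(ℝ, Euc 2) 𝓘(ℝ, Euc 4) ∞ X)
    (L : Euc 4 →L[ℝ] ℝ) (p : S) (v : Euc 2) :
    dFun (fun q => L (X q)) p v = L (tmap (m := 2) (n := 4) X p v) := by
  have hL : ContMDiff 𝓘(ℝ, Euc 2) 𝓘(ℝ, ℝ) ∞ (fun q => L (X q)) :=
    L.contMDiff.comp hX
  have h1 := contDiffAt_comp_chart_symm (mem_chart_target (Euc 2) p) (hX.contMDiffAt)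
  have h2 := (L.hasFDerivAt.comp _ (h1.differentiableAt (by simp)).hasFDerivAt).fderiv
  rw [dFun_eq_fderiv (hL.contMDiffAt.mdifferentiableAt (by simp)),
    tmap_eq_fderiv_locRep (hX.contMDiffAt.mdifferentiableAt (by simp))]
  exact DFunLike.congr_fun h2 v

/-- The coordinate function `X^γ` is smooth. -/
theorem contMDiff_coord {X : S → Euc 4} (hX : ContMDiff 𝓘(ℝ, Euc 2) 𝓘(ℝ, Euc 4) ∞ X) (γ : Fin 4) :
    ContMDiff 𝓘(ℝ, Euc 2) 𝓘(ℝ, ℝ) ∞ (fun q => X q γ) :=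
  (EuclideanSpace.proj (𝕜 := ℝ) γ : Euc 4 →L[ℝ] ℝ).contMDiff.comp hX

theorem contMDiff_timeFn {X : S → Euc 4} (hX : ContMDiff 𝓘(ℝ, Euc 2) 𝓘(ℝ, Euc 4) ∞ X)
    (T : Euc 4) : ContMDiff 𝓘(ℝ, Euc 2) 𝓘(ℝ, ℝ) ∞ (timeFn X T) :=
  (-(eta.flip T)).contMDiff.comp hX

/-- The parameter enters only through two scalar coefficients of fixed smooth functions, so `Δτ`,
`|∇τ|²` and the one-forms evaluated on `∇τ` become explicit functions of `s`. -/
theorem timeFn_boostedObserver (X : S → Euc 4) {i : Fin 4} (hi : i ≠ 0) (s : ℝ) :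
    timeFn X (boostedObserver i s) =
      fun p => Real.sqrt (1 + s ^ 2) * X p 0 + -s * X p i := by
  funext p
  rw [timeFn, eta_apply]
  fin_cases i
  · exact absurd rfl hi
  all_goals
    simp [boostedObserver, partialX, basisVec]
    ring

theorem eta_boostedObserver_self {i : Fin 4} (hi : i ≠ 0) (s : ℝ) :
    eta (boostedObserver i s) (boostedObserver i s) = -1 := by
  have h : Real.sqrt (1 + s ^ 2) * Real.sqrt (1 + s ^ 2) = 1 + s ^ 2 :=
    Real.mul_self_sqrt (by positivity)
  rw [eta_apply]
  fin_cases i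
  · exact absurd rfl hi
  all_goals
    simp [boostedObserver, partialX, basisVec]
    linarith

theorem boostedObserver_zero (i : Fin 4) : boostedObserver i 0 = partialX 0 := by
  simp [boostedObserver]

theorem eta_partialX {i : Fin 4} (hi : i ≠ 0) (w : Euc 4) : eta (partialX i) w = w i := by
  rw [eta_apply]
  fin_cases i
  · exact absurd rfl hi
  all_goals simp [partialX, basisVec]

/-- Differentiating `τ = -⟨X, T⟩` gives `dτ = -⟨T, dX⟩`; both sides are dual vectors of this
covector up to sign. -/
theorem tangentialVec_self {X : S → Euc 4} (hX : ContMDiff 𝓘(ℝ, Euc 2) 𝓘(ℝ, Euc 4) ∞ X)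
    (σ : FormField 2 S) (T : Euc 4) (p : S) :
    tangentialVec σ X T p = (-1 : ℝ) • surfGrad σ (timeFn X T) p := by
  rw [surfGrad, ← sharp_smul, tangentialVec]
  congr 1
  ext v
  have h := dFun_clm_comp hX (-(eta.flip T)) p v
  have h' : dFun (timeFn X T) p v = _ := h
  rw [_root_.smul_apply, h', ContinuousLinearMap.comp_apply, _root_.neg_apply,
    ContinuousLinearMap.flip_apply, smul_neg, neg_one_smul, neg_neg, eta_apply, eta_apply]
  ring

theorem tangentialVec_partialX {X : S → Euc 4} (hX : ContMDiff 𝓘(ℝ, Euc 2) 𝓘(ℝ, Euc 4) ∞ X)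
    (σ : FormField 2 S) {i : Fin 4} (hi : i ≠ 0) (p : S) :
    tangentialVec σ X (partialX i) p = surfGrad σ (fun q => X q i) p := by
  rw [surfGrad, tangentialVec]
  congr 1
  ext v
  have h := dFun_clm_comp hX (EuclideanSpace.proj (𝕜 := ℝ) i : Euc 4 →L[ℝ] ℝ) p v
  exact (eta_partialX hi _).trans h.symm

/-! ### Smoothness of `ρ` and of the angle function -/

theorem IsRiemannian.gradSq_nonneg {σ : FormField 2 S} (hσ : IsRiemannian σ) (h : S → ℝ) (p : S) :
    0 ≤ gradSq σ h p := by
  by_cases h0 : surfGrad σ h p = 0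
  · rw [gradSq, h0]
    simp
  · exact (hσ.pos p _ h0).le

theorem IsSmoothForm.gradSq_eq {σ : FormField 2 S} (hσ : IsSmoothForm σ) (h : S → ℝ) (p : S) :
    gradSq σ h p = dFun h p (surfGrad σ h p) :=
  hσ.apply_surfGrad h p _

theorem ContMDiff.sqrt_of_pos {f : S → ℝ} (hf : ContMDiff 𝓘(ℝ, Euc 2) 𝓘(ℝ, ℝ) ∞ f)
    (hpos : ∀ p, 0 < f p) : ContMDiff 𝓘(ℝ, Euc 2) 𝓘(ℝ, ℝ) ∞ (fun p => Real.sqrt (f p)) :=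
  fun p => (contMDiffAt_iff_contDiffAt.mpr (Real.contDiffAt_sqrt (hpos p).ne')).comp p (hf p)

variable {D D₀ : SurfaceData S} {X : S → Euc 4}

theorem rho_eq_rhoFn (D D₀ : SurfaceData S) (X : S → Euc 4) (T : Euc 4) (p : S) :
    rho D D₀ X T p = rhoFn (D₀.normH p) (D.normH p) (1 + gradSq D.metric (timeFn X T) p)
      (laplacian D.metric (timeFn X T) p) := rfl

theorem angleFn_eq_thetaFn (D D₀ : SurfaceData S) (X : S → Euc 4) (T : Euc 4) (p : S) :
    angleFn D D₀ X T p = thetaFn (D₀.normH p) (D.normH p) (1 + gradSq D.metric (timeFn X T) p)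
      (laplacian D.metric (timeFn X T) p) := rfl

theorem contMDiff_gradSq (hD : IsSmoothData D)
    (hX : ContMDiff 𝓘(ℝ, Euc 2) 𝓘(ℝ, Euc 4) ∞ X) (T : Euc 4) :
    ContMDiff 𝓘(ℝ, Euc 2) 𝓘(ℝ, ℝ) ∞ (gradSq D.metric (timeFn X T)) :=
  (hD.riemannian.contMDiff_dFun_surfGrad (contMDiff_timeFn hX T) (contMDiff_timeFn hX T)).congr
    fun p => hD.riemannian.gradSq_eq _ p

theorem contMDiff_rho (hD : IsSmoothData D) (hD₀ : IsSmoothData D₀)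
    (hX : ContMDiff 𝓘(ℝ, Euc 2) 𝓘(ℝ, Euc 4) ∞ X) (T : Euc 4) :
    ContMDiff 𝓘(ℝ, Euc 2) 𝓘(ℝ, ℝ) ∞ (rho D D₀ X T) := by
  have hu : ContMDiff 𝓘(ℝ, Euc 2) 𝓘(ℝ, ℝ) ∞ (fun p => 1 + gradSq D.metric (timeFn X T) p) :=
    contMDiff_const.add (contMDiff_gradSq hD hX T)
  have hpos : ∀ p, 0 < 1 + gradSq D.metric (timeFn X T) p := fun p => by
    linarith [hD.riemannian.gradSq_nonneg (timeFn X T) p]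
  have hq : ContMDiff 𝓘(ℝ, Euc 2) 𝓘(ℝ, ℝ) ∞ (fun p => laplacian D.metric (timeFn X T) p ^ 2 /
      (1 + gradSq D.metric (timeFn X T) p)) :=
    ((hD.riemannian.contMDiff_laplacian (contMDiff_timeFn hX T)).pow 2).div₀ hu
      fun p => (hpos p).ne'
  have hq0 : ∀ p, 0 ≤ laplacian D.metric (timeFn X T) p ^ 2 /
      (1 + gradSq D.metric (timeFn X T) p) := fun p => div_nonneg (sq_nonneg _) (hpos p).le
  have h1 := ContMDiff.sqrt_of_pos ((hD₀.contMDiff_normH.pow 2).add hq) fun p =>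
    add_pos_of_pos_of_nonneg (pow_pos (hD₀.normH_pos p) 2) (hq0 p)
  have h2 := ContMDiff.sqrt_of_pos ((hD.contMDiff_normH.pow 2).add hq) fun p =>
    add_pos_of_pos_of_nonneg (pow_pos (hD.normH_pos p) 2) (hq0 p)
  exact (h1.sub h2).div₀ (ContMDiff.sqrt_of_pos hu hpos) fun p =>
    (Real.sqrt_pos.mpr (hpos p)).ne'

theorem contMDiff_angleFn (hD : IsSmoothData D) (hD₀ : IsSmoothData D₀)
    (hX : ContMDiff 𝓘(ℝ, Euc 2) 𝓘(ℝ, Euc 4) ∞ X) (T : Euc 4) :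
    ContMDiff 𝓘(ℝ, Euc 2) 𝓘(ℝ, ℝ) ∞ (angleFn D D₀ X T) := by
  have h1 := ((contMDiff_rho hD hD₀ hX T).mul
    (hD.riemannian.contMDiff_laplacian (contMDiff_timeFn hX T))).div₀
    (hD₀.contMDiff_normH.mul hD.contMDiff_normH)
    fun p => (mul_pos (hD₀.normH_pos p) (hD.normH_pos p)).ne'
  exact (contMDiff_iff_contDiff.mpr Real.contDiff_arsinh).comp h1

theorem IsSmoothData.continuous_alphaH_surfGrad (hD : IsSmoothData D) {σ : FormField 2 S}
    (hσ : IsSmoothForm σ) {h : S → ℝ} (hh : ContMDiff 𝓘(ℝ, Euc 2) 𝓘(ℝ, ℝ) ∞ h) :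
    Continuous fun p => D.alphaH p (surfGrad σ h p) :=
  hD.continuous_alphaH _ (hσ.isSmoothAlong_surfGrad hh)

theorem continuous_current_surfGrad (hD : IsSmoothData D) (hD₀ : IsSmoothData D₀)
    (hX : ContMDiff 𝓘(ℝ, Euc 2) 𝓘(ℝ, Euc 4) ∞ X) (T : Euc 4) {h : S → ℝ}
    (hh : ContMDiff 𝓘(ℝ, Euc 2) 𝓘(ℝ, ℝ) ∞ h) :
    Continuous fun p => current D D₀ X T p (surfGrad D.metric h p) := by
  have h1 := (hD.riemannian.contMDiff_dFun_surfGrad (contMDiff_timeFn hX T) hh).continuous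
  have h2 := (hD.riemannian.contMDiff_dFun_surfGrad (contMDiff_angleFn hD hD₀ hX T) hh).continuous
  exact ((((contMDiff_rho hD hD₀ hX T).continuous.mul h1).sub h2).sub
    (hD₀.continuous_alphaH_surfGrad hD.riemannian.toIsSmoothForm hh)).add
    (hD.continuous_alphaH_surfGrad hD.riemannian.toIsSmoothForm hh)

theorem current_neg_smul (hD : IsSmoothData D) (hD₀ : IsSmoothData D₀) (X : S → Euc 4) (T : Euc 4)
    (p : S) (v : Euc 2) :
    current D D₀ X T p ((-1 : ℝ) • v) = -current D D₀ X T p v := by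
  have h1 := hD.alphaH_lincomb p (-1) 0 v 0
  have h2 := hD₀.alphaH_lincomb p (-1) 0 v 0
  simp only [zero_smul, add_zero, zero_mul] at h1 h2
  have h3 : ∀ L : Euc 2 →L[ℝ] ℝ, L ((-1 : ℝ) • v) = -L v := fun L => by
    rw [map_smul, neg_one_smul]
  simp only [current]
  erw [h1, h2, h3, h3]
  ring

variable [T2Space S] [CompactSpace S] [MeasurableSpace S] [BorelSpace S]

/-- For a unit timelike observer, the conserved quantity of the observer itself is the energy. -/
theorem conservedQuantity_self (hD : IsSmoothData D) (hD₀ : IsSmoothData D₀)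
    (hX : ContMDiff 𝓘(ℝ, Euc 2) 𝓘(ℝ, Euc 4) ∞ X) {T : Euc 4} (hT : eta T T = -1) :
    conservedQuantity D D₀ X T (fun _ => T) = quasiLocalEnergy D D₀ X T := by
  have hτ := contMDiff_timeFn hX T
  have hσ := hD.riemannian
  have hgreen := hσ.integral_green hτ (contMDiff_angleFn hD hD₀ hX T)
  have hI : Integrable (fun p => rho D D₀ X T p +
      current D D₀ X T p (surfGrad D.metric (timeFn X T) p)) (areaMeasure D.metric) :=
    integrable_areaMeasure hσ.toIsSmoothForm ((contMDiff_rho hD hD₀ hX T).continuous.add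
      (continuous_current_surfGrad hD hD₀ hX T hτ))
  have hG := integrable_areaMeasure hσ.toIsSmoothForm
    (hσ.continuous_green_integrand hτ (contMDiff_angleFn hD hD₀ hX T))
  have h1 : ∀ p, eta T T * rho D D₀ X T p +
      current D D₀ X T p (tangentialVec D.metric X T p) =
      -(rho D D₀ X T p + current D D₀ X T p (surfGrad D.metric (timeFn X T) p)) := fun p => by
    rw [hT, tangentialVec_self hX, current_neg_smul hD hD₀]
    ring
  -- The energy density exceeds `ρ + j(∇τ)` by exactly the Green integrand of the angle function and
  -- `τ`: the summand `-dθ(∇τ)` of `j` is traded for `θ Δτ`.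
  have h2 : ∀ p, rho D D₀ X T p * (1 + gradSq D.metric (timeFn X T) p) +
      laplacian D.metric (timeFn X T) p * angleFn D D₀ X T p -
      D₀.alphaH p (surfGrad D.metric (timeFn X T) p) +
      D.alphaH p (surfGrad D.metric (timeFn X T) p) =
      (rho D D₀ X T p + current D D₀ X T p (surfGrad D.metric (timeFn X T) p)) +
      (angleFn D D₀ X T p * laplacian D.metric (timeFn X T) p +
        dFun (angleFn D D₀ X T) p (surfGrad D.metric (timeFn X T) p)) := fun p => by
    rw [current, hσ.gradSq_eq]
    ring
  rw [conservedQuantity, quasiLocalEnergy]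
  simp only [h1, h2]
  rw [integral_neg, integral_add hI hG, hgreen]
  ring

/-- The conserved quantity of a spatial translation is minus the linear momentum. -/
theorem conservedQuantity_partialX (hX : ContMDiff 𝓘(ℝ, Euc 2) 𝓘(ℝ, Euc 4) ∞ X) {i : Fin 4}
    (hi : i ≠ 0) :
    conservedQuantity D D₀ X (partialX 0) (fun _ => partialX i) =
      -energyMomentum D D₀ X (partialX 0) i := by
  rw [conservedQuantity, energyMomentum]
  have h1 : eta (partialX i) (partialX 0) = 0 := by
    rw [eta_partialX hi]
    simp [partialX, basisVec, hi]
  have h2 : (partialX 0 : Euc 4) i = 0 := by simp [partialX, basisVec, hi]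
  simp only [h1, h2, tangentialVec_partialX hX D.metric hi, zero_mul, mul_zero, zero_add]
  ring

end Energy

end QuasiLocal

end

noncomputable section

namespace QuasiLocal

set_option maxSynthPendingDepth 3

/-! ### The derivative of the energy along a family of observers -/

section Energy

variable {S : Type*} [TopologicalSpace S] [ChartedSpace (Euc 2) S]
  [IsManifold 𝓘(ℝ, Euc 2) ∞ S] [CompactSpace S] [MeasurableSpace S] [BorelSpace S]

/-- Differentiation under the integral sign on a compact surface. -/
theorem hasDerivAt_integral_areaMeasure {σ : FormField 2 S} (hσ : IsSmoothForm σ)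
    {F F' : ℝ → S → ℝ} (hF : ∀ s, Continuous (F s))
    (hF' : Continuous fun z : ℝ × S => F' z.1 z.2)
    (h : ∀ s p, HasDerivAt (fun t => F t p) (F' s p) s) (s : ℝ) :
    HasDerivAt (fun t => ∫ p, F t p ∂(areaMeasure σ)) (∫ p, F' s p ∂(areaMeasure σ)) s := by
  have := isFiniteMeasure_areaMeasure hσ
  -- A constant dominates the derivative: `F'` is bounded on the compact set `[s-1, s+1] × S`, and
  -- constants are integrable for the finite area measure.
  obtain ⟨C, hC⟩ := ((isCompact_Icc (a := s - 1) (b := s + 1)).prod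
    (isCompact_univ (X := S))).exists_bound_of_continuousOn hF'.continuousOn
  have hF's : Continuous (F' s) := hF'.comp (Continuous.prodMk_right s)
  refine (hasDerivAt_integral_of_dominated_loc_of_deriv_le (bound := fun _ => C)
    (Icc_mem_nhds (by linarith : s - 1 < s) (by linarith : s < s + 1))
    (Filter.Eventually.of_forall fun t => (integrable_areaMeasure hσ (hF t)).aestronglyMeasurable)
    (integrable_areaMeasure hσ (hF s)) (integrable_areaMeasure hσ hF's).aestronglyMeasurable
    (Filter.Eventually.of_forall fun p t ht => hC (t, p) ⟨ht, Set.mem_univ p⟩)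
    (integrable_const C) (Filter.Eventually.of_forall fun p t _ => h t p)).2

theorem hasDerivAt_sqrt_one_add_sq (s : ℝ) :
    HasDerivAt (fun t : ℝ => Real.sqrt (1 + t ^ 2)) (s / Real.sqrt (1 + s ^ 2)) s := by
  have h := (((hasDerivAt_id s).pow 2).const_add 1).sqrt
    (by simpa using (by positivity : (1 + s ^ 2 : ℝ) ≠ 0))
  refine h.congr_deriv ?_
  simp
  field_simp

variable [T2Space S] {D D₀ : SurfaceData S} {X : S → Euc 4}

/-- The first variation of the energy under boosts of the observer `∂/∂X⁰` in the direction
`∂/∂X^i`. -/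
theorem hasDerivAt_quasiLocalEnergy_boostedObserver (hD : IsSmoothData D) (hD₀ : IsSmoothData D₀)
    (hX : ContMDiff 𝓘(ℝ, Euc 2) 𝓘(ℝ, Euc 4) ∞ X) {i : Fin 4} (hi : i ≠ 0) :
    HasDerivAt (fun s => quasiLocalEnergy D D₀ X (boostedObserver i s))
      (conservedQuantity D D₀ X (partialX 0) (fun _ => partialX i)) 0 := by
  have hσ := hD.riemannian
  have h0 := contMDiff_coord hX 0
  have h1 := contMDiff_coord hX i
  set x : S → ℝ := fun q => X q 0
  set y : S → ℝ := fun q => X q i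
  set σ := D.metric
  set c : ℝ → ℝ := fun s => Real.sqrt (1 + s ^ 2)
  have hcpos : ∀ s, 0 < c s := fun s => Real.sqrt_pos.mpr (by positivity)
  have hc : Continuous c := by fun_prop
  -- Only continuity of `d = c'` and `d 0 = 0` are needed: to first order the boost leaves the
  -- coefficient of `X⁰` unchanged.
  obtain ⟨d, hd, hd0, hc'⟩ : ∃ d : ℝ → ℝ, Continuous d ∧ d 0 = 0 ∧ ∀ s, HasDerivAt c (d s) s :=
    ⟨fun s => s / c s, continuous_id.div hc fun s => (hcpos s).ne', by simp,
      hasDerivAt_sqrt_one_add_sq⟩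
  set A := laplacian σ x
  set B := laplacian σ y
  set gxx : S → ℝ := fun p => dFun x p (surfGrad σ x p)
  set gxy : S → ℝ := fun p => dFun x p (surfGrad σ y p)
  set gyy : S → ℝ := fun p => dFun y p (surfGrad σ y p)
  set kx : S → ℝ := fun p => D.alphaH p (surfGrad σ x p) - D₀.alphaH p (surfGrad σ x p)
  set ky : S → ℝ := fun p => D.alphaH p (surfGrad σ y p) - D₀.alphaH p (surfGrad σ y p)
  have hA : Continuous A := (hσ.contMDiff_laplacian h0).continuous
  have hB : Continuous B := (hσ.contMDiff_laplacian h1).continuous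
  have hgxx : Continuous gxx := (hσ.contMDiff_dFun_surfGrad h0 h0).continuous
  have hgxy : Continuous gxy := (hσ.contMDiff_dFun_surfGrad h0 h1).continuous
  have hgyy : Continuous gyy := (hσ.contMDiff_dFun_surfGrad h1 h1).continuous
  have hkx : Continuous kx := (hD.continuous_alphaH_surfGrad hσ.toIsSmoothForm h0).sub
    (hD₀.continuous_alphaH_surfGrad hσ.toIsSmoothForm h0)
  have hky : Continuous ky := (hD.continuous_alphaH_surfGrad hσ.toIsSmoothForm h1).sub
    (hD₀.continuous_alphaH_surfGrad hσ.toIsSmoothForm h1)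
  have hsymm : ∀ p, dFun y p (surfGrad σ x p) = gxy p := fun p => by
    rw [← hσ.apply_surfGrad y, hσ.symm]
    exact hσ.apply_surfGrad x p _
  -- The expansion of `1 + |∇(c X⁰ - s Xⁱ)|²`. In this form joint continuity in `(s, p)` and the
  -- derivative in `s` follow from those of `c`.
  set u : ℝ → S → ℝ := fun s p => 1 + (c s ^ 2 * gxx p - 2 * (c s * s) * gxy p + s ^ 2 * gyy p)
  set L : ℝ → S → ℝ := fun s p => c s * A p + -s * B p
  have hu : ∀ s p, 1 + gradSq σ (timeFn X (boostedObserver i s)) p = u s p := fun s p => by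
    have e1 := dFun_lincomb h0 h1 (c s) (-s) p
    have e2 := surfGrad_lincomb σ h0 h1 (c s) (-s) p
    have e3 : ∀ a b : ℝ, ∀ M : Euc 2 →L[ℝ] ℝ, ∀ v w : Euc 2,
        M (a • v + b • w) = a * M v + b * M w := fun a b M v w => by simp
    rw [hσ.gradSq_eq, timeFn_boostedObserver X hi, e1, e2]
    erw [e3]
    simp only [_root_.add_apply, _root_.smul_apply, smul_eq_mul, hsymm]
    simp only [u, gxx, gyy, gxy]
    ring
  have hL : ∀ s p, laplacian σ (timeFn X (boostedObserver i s)) p = L s p := fun s p => by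
    rw [timeFn_boostedObserver X hi]
    exact laplacian_lincomb σ h0 h1 (c s) (-s) p
  have hk : ∀ s p, D.alphaH p (surfGrad σ (timeFn X (boostedObserver i s)) p) -
      D₀.alphaH p (surfGrad σ (timeFn X (boostedObserver i s)) p) =
      c s * kx p + -s * ky p := fun s p => by
    rw [timeFn_boostedObserver X hi, surfGrad_lincomb σ h0 h1 (c s) (-s) p]
    erw [hD.alphaH_lincomb, hD₀.alphaH_lincomb]
    simp only [kx, ky]
    ring
  have hupos : ∀ s p, 0 < u s p := fun s p => by
    rw [← hu]
    linarith [hσ.gradSq_nonneg (timeFn X (boostedObserver i s)) p]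
  have hucont : Continuous fun z : ℝ × S => u z.1 z.2 := by fun_prop
  have hLcont : Continuous fun z : ℝ × S => L z.1 z.2 := by fun_prop
  have hacont := hD₀.contMDiff_normH.continuous
  have hbcont := hD.contMDiff_normH.continuous
  have hrho := continuous_rhoFn (hacont.comp (continuous_snd (X := ℝ)))
    (hbcont.comp (continuous_snd (X := ℝ))) hucont hLcont fun z => hupos z.1 z.2
  have htheta := continuous_thetaFn (hacont.comp (continuous_snd (X := ℝ)))
    (hbcont.comp (continuous_snd (X := ℝ))) hucont hLcont (fun z => hupos z.1 z.2)
    (fun z => hD₀.normH_pos z.2) (fun z => hD.normH_pos z.2)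
  set r : ℝ → S → ℝ := fun s p => rhoFn (D₀.normH p) (D.normH p) (u s p) (L s p)
  set θ : ℝ → S → ℝ := fun s p => thetaFn (D₀.normH p) (D.normH p) (u s p) (L s p)
  replace hrho : Continuous fun z : ℝ × S => r z.1 z.2 := hrho
  replace htheta : Continuous fun z : ℝ × S => θ z.1 z.2 := htheta
  have hr : ∀ s p, rho D D₀ X (boostedObserver i s) p = r s p := fun s p => by
    rw [rho_eq_rhoFn, hu, hL]
  have hθ : ∀ s p, angleFn D D₀ X (boostedObserver i s) p = θ s p := fun s p => by
    rw [angleFn_eq_thetaFn, hu, hL]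
  set u' : ℝ → S → ℝ := fun s p => 2 * (c s * d s) * gxx p - 2 * (d s * s + c s) * gxy p +
    2 * s * gyy p
  set L' : ℝ → S → ℝ := fun s p => d s * A p + -1 * B p
  have hu'cont : Continuous fun z : ℝ × S => u' z.1 z.2 := by fun_prop
  have hL'cont : Continuous fun z : ℝ × S => L' z.1 z.2 := by fun_prop
  have hud : ∀ s p, HasDerivAt (fun t => u t p) (u' s p) s := fun s p => by
    have e1 := (((hc' s).pow 2).mul_const (gxx p)).sub
      ((((hc' s).mul (hasDerivAt_id s)).const_mul 2).mul_const (gxy p))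
    have e2 := (e1.add (((hasDerivAt_id s).pow 2).mul_const (gyy p))).const_add 1
    refine e2.congr_deriv ?_
    simp only [u', id]
    ring
  have hLd : ∀ s p, HasDerivAt (fun t => L t p) (L' s p) s := fun s p =>
    ((hc' s).mul_const (A p)).add ((hasDerivAt_id s).neg.mul_const (B p))
  have hmain := hasDerivAt_integral_areaMeasure hσ.toIsSmoothForm
    (F := fun s p => r s p * u s p + L s p * θ s p + (c s * kx p + -s * ky p))
    (F' := fun s p => r s p * u' s p / 2 + θ s p * L' s p + (d s * kx p + -1 * ky p))
    (fun s => by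
      have hcurry : ∀ {f : ℝ → S → ℝ}, (Continuous fun z : ℝ × S => f z.1 z.2) →
        Continuous (f s) := fun hf => hf.comp (Continuous.prodMk_right s)
      exact (((hcurry hrho).mul (hcurry hucont)).add ((hcurry hLcont).mul (hcurry htheta))).add
        (by fun_prop))
    ((((hrho.mul hu'cont).div_const 2).add (htheta.mul hL'cont)).add (by fun_prop))
    (fun s p => (hasDerivAt_energyDensity (hD₀.normH_pos p) (hD.normH_pos p) (hud s p) (hLd s p)
      fun t => hupos t p).add
        (((hc' s).mul_const (kx p)).add ((hasDerivAt_id s).neg.mul_const (ky p)))) 0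
  have hE : ∀ s, quasiLocalEnergy D D₀ X (boostedObserver i s) = 1 / (8 * Real.pi) *
      ∫ p, (r s p * u s p + L s p * θ s p + (c s * kx p + -s * ky p)) ∂(areaMeasure σ) :=
    fun s => by
      rw [quasiLocalEnergy]
      congr 2
      funext p
      rw [hr, hθ, hu, hL, ← hk]
      ring
  simp only [hE]
  refine (hmain.const_mul _).congr_deriv ?_
  have hdτ : ∀ p, dFun (timeFn X (boostedObserver i 0)) p (surfGrad σ y p) = gxy p := fun p => by
    rw [timeFn_boostedObserver X hi, dFun_lincomb h0 h1 _ _ p]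
    simp [x, y, gxy]
  have hθm := contMDiff_angleFn hD hD₀ hX (boostedObserver i 0)
  have hG := integrable_areaMeasure hσ.toIsSmoothForm (hσ.continuous_green_integrand h1 hθm)
  have hJ := integrable_areaMeasure hσ.toIsSmoothForm
    (continuous_current_surfGrad hD hD₀ hX (boostedObserver i 0) h1)
  have hgreen := hσ.integral_green h1 hθm
  have hc0 : c 0 = 1 := by simp [c]
  -- At `s = 0` one has `u' = -2⟨∇X⁰, ∇Xⁱ⟩` and `L' = -ΔXⁱ`, and the `kx` term disappears. Adding
  -- and subtracting `dθ(∇Xⁱ)` completes the terms to `j(∇Xⁱ)` and to the Green integrand of `Xⁱ`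
  -- and `θ`.
  have hp : ∀ p, r 0 p * u' 0 p / 2 + θ 0 p * L' 0 p + (d 0 * kx p + -1 * ky p) =
      -(current D D₀ X (boostedObserver i 0) p (surfGrad σ y p) +
        (angleFn D D₀ X (boostedObserver i 0) p * laplacian σ y p +
          dFun (angleFn D D₀ X (boostedObserver i 0)) p (surfGrad σ y p))) := fun p => by
    rw [current, hdτ, hr, hθ]
    simp only [u', L', hc0, hd0, ky]
    ring
  simp only [hp]
  rw [integral_neg, integral_add hJ hG, hgreen, boostedObserver_zero, conservedQuantity]
  have e1 : eta (partialX i) (partialX 0) = 0 := by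
    rw [eta_partialX hi]
    simp [partialX, basisVec, hi]
  simp only [e1, tangentialVec_partialX hX D.metric hi, zero_mul, zero_add, add_zero]
  ring

end Energy

end QuasiLocal

end

/-! ### Assembly for the physical surface and its isometric image -/

theorem theorem4p2
    {S : Type*} [TopologicalSpace S] [T2Space S] [CompactSpace S]
    [ChartedSpace (Euc 2) S] [IsManifold 𝓘(ℝ, Euc 2) ∞ S]
    [MeasurableSpace S] [BorelSpace S]
    {N : Type*} [TopologicalSpace N] [ChartedSpace (Euc 4) N] [IsManifold 𝓘(ℝ, Euc 4) ∞ N]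
    (g : LorentzMetric N) (ι : S → N)
    (hι : Manifold.IsSmoothEmbedding 𝓘(ℝ, Euc 2) 𝓘(ℝ, Euc 4) ∞ ι)
    (hspace : IsSpacelike g ι) (hH : HasSpacelikeMeanCurv g ι)
    (ℓ : ∀ p : S, Tan 4 (ι p)) (hℓ : IsNullNormal g ι ℓ)
    (X : S → Euc 4)
    (hX : Manifold.IsSmoothEmbedding 𝓘(ℝ, Euc 2) 𝓘(ℝ, Euc 4) ∞ X)
    (hiso : IsIsometric (inducedMetric g ι) X) (hH₀ : HasSpacelikeMeanCurv minkowski X)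
    (ℓ₀ : ∀ p : S, Tan 4 (X p)) (hℓ₀ : IsNullNormal minkowski X ℓ₀)
    (i : Fin 4) (hi : i ≠ 0) :
    let D := surfaceData g ι ℓ
    let D₀ := surfaceData minkowski X ℓ₀
    let f : ℝ → ℝ := fun s =>
      conservedQuantity D D₀ X (boostedObserver i s) (fun _ => boostedObserver i s)
    (∀ s, f s = quasiLocalEnergy D D₀ X (boostedObserver i s)) ∧
      HasDerivAt f (conservedQuantity D D₀ X (partialX 0) (fun _ => partialX i)) 0 ∧
      conservedQuantity D D₀ X (partialX 0) (fun _ => partialX i) =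
        -energyMomentum D D₀ X (partialX 0) i := by
  intro D D₀ f
  -- Isometry identifies the two induced metrics. The image in Minkowski space is therefore
  -- spacelike, and the regularity results for a spacelike surface with spacelike mean curvature
  -- apply to it as well.
  have hmetric : inducedMetric minkowski X = inducedMetric g ι := by
    funext p
    ext v w
    exact hiso p v w
  have hspace₀ : IsSpacelike minkowski X := fun p v hv => by
    rw [hmetric]
    exact hspace p v hv
  have hXs := hX.contMDiff
  have hD : IsSmoothData D := isSmoothData_surfaceData hι.contMDiff hspace hH hℓ
  have hD₀ : IsSmoothData D₀ := isSmoothData_surfaceData hXs hspace₀ hH₀ hℓ₀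
  have hf : ∀ s, f s = quasiLocalEnergy D D₀ X (boostedObserver i s) := fun s =>
    conservedQuantity_self hD hD₀ hXs (eta_boostedObserver_self hi s)
  refine ⟨hf, ?_, conservedQuantity_partialX hXs hi⟩
  rw [funext hf]
  exact hasDerivAt_quasiLocalEnergy_boostedObserver hD hD₀ hXs hi
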